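/- Work in the ring $\mathrm{Sym}$ of symmetric functions with coefficients in $\mathbb{Q}[[t]]$, that is, polynomials in the power sums $p_1,p_2,\dots$. Let $S_k$ be the complete functions ($S_0=1$, $S_k=0$ for $k<0$) and, for $v\in\mathbb{Z}^r$, let $S_v=\det(S_{v_i+j-i})_{1\le i,j\le r}$. For arguments $A,B$ write $p_i(A+B)=p_iA+p_iB$, $p_i(AB)=p_iA\,p_iB$, $p_i(A(1-t))=(1-t^i)p_iA$, $p_i(1)=1$, and $\sigma_1(A)=\sum_{k\ge0}S_k(A)$. For a partition $\lambda$ of length $r=\ell(\lambda)$ let $$Q'_\lambda=\sum_{a} t^{\sum_{i<j}a_{ij}}\,S_{v(a)},\qquad v(a)=\lambda+\sum_{1\le i<j\le r}a_{ij}(e_i-e_j),$$ the sum being over all families $a=(a_{ij})_{1\le i<j\le r}$ of nonnegative integers such that $v(a)_k+\cdots+v(a)_r\ge 0$ for every $k$ (this is the image of $x^\lambda\prod_{i<j}(1-tx_i/x_j)^{-1}$ under truncation and $x^v\mapsto S_v$). Let $b_\lambda=\prod_{i\ge1}\prod_{j=1}^{m_i}(1-t^j)$, where $m_i$ is the multiplicity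 of the part $i$ in $\lambda$, let $Q_\lambda(X)=Q'_\lambda(X(1-t))$, $P_\lambda=b_\lambda^{-1}Q_\lambda$, and define the skew functions $Q'_{\lambda/\mu}$ as the coefficients in the expansion $Q'_\lambda(X+Y)=\sum_\mu Q'_{\lambda/\mu}(X)\,Q'_\mu(Y)$. **Proposition.** Let $X,Y$ be two (finite or infinite) sets of indeterminates, let $n\in\mathbb{N}\cup\{\infty\}$ be such that $X$ has at most $n$ elements, and let $\mathfrak{Part}$ be the set of partitions of length at most $n$. Then, in the ring of formal power series in $X\cup Y$ over $\mathbb{Q}[[t]]$ (infinite sums and products converging coefficientwise), $$\sigma_1\bigl(X+XY(1-t)\bigr)=\prod_{x\in X}\frac1{1-x}\prod_{x\in X,\,y\in Y}\frac{1-txy}{1-xy}=\sum_{\lambda\in\mathfrak{Part}}\ \sum_{\mu\subseteq\lambda}P_\lambda(X)\,P_\mu(Y)\,b_\mu\,Q'_{\lambda/\mu}(1).$$ Moreover, for all partitions $\mu\subseteq\lambda$, $$Q'_{\lambda/\mu}(1)=b_\mu^{-1}\,t^{\mathbf n(\lambda/\mu)}\prod_{k=1}^{\ell(\mu)}\bigl(1-t^{\nu_k-k+1}\bigr),\qquad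 \mathbf n(\lambda/\mu)=\sum_i\binom{\lambda^\sim_i-\mu^\sim_i}{2},$$ where $\lambda^\sim,\mu^\sim$ are the conjugate partitions and $\nu_k=\lambda^\sim_{\mu_k}$ is the part of index $\mu_k$ of $\lambda^\sim$. -/

import Mathlib

open scoped TensorProduct

noncomputable section

namespace HallLittlewood

/-- The coefficient ring `ℚ[[t]]`. -/
abbrev Coef : Type := PowerSeries ℚ

/-- The indeterminate `t` of the coefficient ring. -/
def t : Coef := PowerSeries.X

/-- The ring of symmetric functions with coefficients in `ℚ[[t]]`, presented as the ring of
polynomials in the power sums: the variable `MvPolynomial.X i` is the power sum `p_i`, `i ≥ 1`. -/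
abbrev Sym : Type := MvPolynomial ℕ+ Coef

/-- The value `f(A)` of a symmetric function at the argument `A` whose power sums are
`p_i(A) = a i`. -/
def evalAt {R : Type*} [CommRing R] [Algebra Coef R] (a : ℕ+ → R) : Sym →ₐ[Coef] R :=
  MvPolynomial.aeval a

/-- The complete symmetric functions `S_k` (also denoted `h_k`) for `k ≥ 0`, in terms of the power
sums: `S_0 = 1` and `k S_k = ∑_{i = 1}^k p_i S_{k - i}`, i.e. `∑ S_k z^k = exp (∑ p_i z^i / i)`. -/
def complete : ℕ → Sym
  | 0 => 1
  | k + 1 => ((k : ℚ) + 1)⁻¹ • ∑ i : Fin (k + 1),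
      MvPolynomial.X (Nat.succPNat i) * complete (k - i)
termination_by k => k
decreasing_by omega

/-- The complete functions with an integer index: `S_k = 0` for `k < 0`. -/
def completeInt (k : ℤ) : Sym := if 0 ≤ k then complete k.toNat else 0

/-- The Schur function `S_v = det (S_{v_i + j - i})` for an arbitrary `v ∈ ℤ^n`. -/
def schur {n : ℕ} (v : Fin n → ℤ) : Sym :=
  Matrix.det (Matrix.of fun i j : Fin n => completeInt (v i + (j : ℤ) - (i : ℤ)))

/-- The pairs `i < j` of indices. -/
abbrev Pairs (n : ℕ) : Type := {p : Fin n × Fin n // p.1 < p.2}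

/-- The exponent of the monomial `x^u ∏_{i < j} (x_i / x_j)^{a i j}`. -/
def raise {n : ℕ} (u : Fin n → ℤ) (a : Pairs n → ℕ) : Fin n → ℤ := fun k =>
  u k + ∑ p : Pairs n, (a p : ℤ) *
    ((if p.1.1 = k then 1 else 0) - (if p.1.2 = k then 1 else 0))

/-- The order relation `v ≥ 0` on `ℤ^n`: all the sums `v_k + ⋯ + v_n` are nonnegative. -/
def TailNonneg {n : ℕ} (v : Fin n → ℤ) : Prop :=
  ∀ k : Fin n, 0 ≤ ∑ i ∈ Finset.univ.filter (fun i => k ≤ i), v i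

/-- Only finitely many monomials (counted with multiplicity) in the expansion of
`x^u ∏_{i < j} (1 - t x_i / x_j)⁻¹` survive the truncation. -/
theorem finite_tailNonneg_raise {n : ℕ} (u : Fin n → ℤ) :
    {a : Pairs n → ℕ | TailNonneg (raise u a)}.Finite := by
  classical
  let s : Fin n → ℤ := fun k => ∑ i ∈ Finset.univ.filter (fun i => k ≤ i), u i
  refine (Set.finite_Iic (fun p : Pairs n => (s p.1.2).toNat)).subset ?_
  intro a ha p
  have h := ha p.1.2
  have key : ∑ i ∈ Finset.univ.filter (fun i => p.1.2 ≤ i), raise u a i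
      = s p.1.2 - ∑ q : Pairs n, (a q : ℤ) * (if q.1.1 < p.1.2 ∧ p.1.2 ≤ q.1.2 then 1 else 0) := by
    simp only [raise, Finset.sum_add_distrib, s]
    rw [Finset.sum_comm, sub_eq_add_neg, ← Finset.sum_neg_distrib]
    congr 1
    refine Finset.sum_congr rfl fun q _ => ?_
    rw [← Finset.mul_sum, Finset.sum_sub_distrib, Finset.sum_ite_eq, Finset.sum_ite_eq, ← mul_neg]
    congr 1
    have hq := q.2
    simp only [Finset.mem_filter, Finset.mem_univ, true_and]
    by_cases h1 : p.1.2 ≤ q.1.1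
    · have h2 : p.1.2 ≤ q.1.2 := h1.trans hq.le
      simp [h1, h2]
    · by_cases h2 : p.1.2 ≤ q.1.2
      · simp [h1, h2, not_le.mp h1]
      · simp [h1, h2]
  rw [key] at h
  have hle : (a p : ℤ) ≤
      ∑ q : Pairs n, (a q : ℤ) * (if q.1.1 < p.1.2 ∧ p.1.2 ≤ q.1.2 then 1 else 0) := by
    have := Finset.single_le_sum (s := Finset.univ)
      (f := fun q : Pairs n => (a q : ℤ) * (if q.1.1 < p.1.2 ∧ p.1.2 ≤ q.1.2 then 1 else 0))
      (fun q _ => by positivity) (Finset.mem_univ p)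
    simpa [p.2] using this
  show a p ≤ (s p.1.2).toNat
  omega

/-- The modified Hall-Littlewood function `Q'_u`, `u ∈ ℤ^n`: expand
`x^u ∏_{i < j} (1 - t x_i / x_j)⁻¹ = ∑_a t^{|a|} x^{raise u a}`, drop the monomials `x^v` for which
`v ≥ 0` fails, and replace each remaining `x^v` by `S_v`. -/
def modQVec {n : ℕ} (u : Fin n → ℤ) : Sym :=
  ∑ a ∈ (finite_tailNonneg_raise u).toFinset, t ^ (∑ p, a p) • schur (raise u a)

/-- The length (number of positive parts) of a partition. -/
abbrev len (l : YoungDiagram) : ℕ := l.colLen 0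

/-- `Q'_λ` for a partition `λ`, whose parts are the row lengths of its diagram. -/
def modQ (l : YoungDiagram) : Sym := modQVec fun i : Fin (len l) => (l.rowLen i : ℤ)

/-- `b_λ = ∏_i ∏_{j = 1}^{m_i} (1 - t^j)`, with `m_i` the multiplicity of the part `i ≥ 1`. -/
def b (l : YoungDiagram) : Coef :=
  ∏ i ∈ l.rowLens.toFinset, ∏ j ∈ Finset.Icc 1 (l.rowLens.count i), (1 - t ^ j)

/-- `Q_λ(X) = Q'_λ(X (1 - t))`, where `p_i(X (1 - t)) = (1 - t^i) p_i(X)`. -/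
def Q (l : YoungDiagram) : Sym :=
  evalAt (fun i : ℕ+ => (1 - t ^ (i : ℕ)) • (MvPolynomial.X i : Sym)) (modQ l)

/-- `P_λ = b_λ⁻¹ Q_λ`. -/
def P (l : YoungDiagram) : Sym := (b l)⁻¹ • Q l

/-- `f(X) ↦ f(X + Y)`, with values in `Sym(X) ⊗ Sym(Y)`: `p_i(X + Y) = p_i(X) + p_i(Y)`. -/
def addAlphabet : Sym →ₐ[Coef] Sym ⊗[Coef] Sym :=
  evalAt fun i : ℕ+ => (MvPolynomial.X i : Sym) ⊗ₜ[Coef] (1 : Sym) +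
    (1 : Sym) ⊗ₜ[Coef] (MvPolynomial.X i : Sym)

open Classical in
/-- The skew function `Q'_{λ/μ}`: the coefficient of `Q'_μ(Y)` in the (unique) expansion
`Q'_λ(X + Y) = ∑_μ Q'_{λ/μ}(X) Q'_μ(Y)`. -/
def skewModQ (l m : YoungDiagram) : Sym :=
  if h : ∃! c : YoungDiagram →₀ Sym,
      addAlphabet (modQ l) = c.sum fun k f => f ⊗ₜ[Coef] modQ k
  then h.exists.choose m else 0

/-- `f(1)`: all the power sums are specialized to `1`. -/
def evalOne : Sym →ₐ[Coef] Coef := evalAt fun _ => 1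

/-- `n(λ/μ) = ∑_i (λ~_i - μ~_i) (λ~_i - μ~_i - 1) / 2`, for `μ ⊆ λ`, where `λ~` is the conjugate
partition, i.e. the sequence of column lengths. -/
def nSkew (l m : YoungDiagram) : ℕ :=
  ∑ i ∈ Finset.range (l.rowLen 0), (l.colLen i - m.colLen i).choose 2

/-- `ℵ(λ/μ) = b_μ⁻¹ t^{n(λ/μ)} (1 - t^{ν_1}) (1 - t^{ν_2 - 1}) ⋯ (1 - t^{ν_r - r + 1})` for `μ ⊆ λ`,
where `r` is the length of `μ` and `ν_k` is the part of index `μ_k` of the conjugate of `λ`.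
(Columns and rows of diagrams are numbered from `0`.) -/
def aleph (l m : YoungDiagram) : Coef :=
  (b m)⁻¹ * t ^ nSkew l m *
    ∏ k ∈ Finset.range (len m), (1 - t ^ (l.colLen (m.rowLen k - 1) - k))

theorem finite_subdiagrams (l : YoungDiagram) : (Set.Iic l).Finite := by
  refine Set.Finite.of_finite_image (f := YoungDiagram.cells)
    ((l.cells.powerset.finite_toSet).subset ?_) ?_
  · rintro _ ⟨m, hm, rfl⟩
    simpa using YoungDiagram.cells_subset_iff.mpr hm
  · intro m _ k _ h
    exact YoungDiagram.ext h

/-- The finite set of all partitions `μ ⊆ λ`. -/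
def subdiagrams (l : YoungDiagram) : Finset YoungDiagram := (finite_subdiagrams l).toFinset

/-- The partitions of length at most `n`; all partitions for `n = ∞`. -/
abbrev Part (n : ℕ∞) : Type := {l : YoungDiagram // (len l : ℕ∞) ≤ n}

section Series

variable {ν : Type*} {ι : Type*}

open Classical in
/-- The power sum `p_i = ∑_x x^i` of the (possibly infinite) set of distinct indeterminates
`f x` among the indeterminates of a power series ring. -/
def powerSum (f : ι ↪ ν) (i : ℕ+) : MvPowerSeries ν Coef :=
  fun d => if ∃ x, d = Finsupp.single (f x) (i : ℕ) then 1 else 0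

open scoped MvPowerSeries.WithPiTopology

/-- Formal convergence of a sum: each coefficient of the finite partial sums is eventually
constant, equal to that of `F`. -/
def FormalHasSum {R : Type*} [CommRing R] (f : ι → MvPowerSeries ν R) (F : MvPowerSeries ν R) :
    Prop :=
  letI : TopologicalSpace R := ⊥
  HasSum f F

/-- Formal convergence of a product: each coefficient of the finite partial products is eventually
constant, equal to that of `F`. -/
def FormalHasProd {R : Type*} [CommRing R] (f : ι → MvPowerSeries ν R) (F : MvPowerSeries ν R) :
    Prop :=
  letI : TopologicalSpace R := ⊥
  HasProd f F

end Series

section TwoAlphabets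

variable (α β : Type*)

/-- `ℚ[[t]][[X, Y]]` for two sets of indeterminates `X`, `Y` indexed by `α` and `β`. -/
abbrev Series : Type _ := MvPowerSeries (α ⊕ β) Coef

/-- The power sums `p_i(X)`. -/
def pX (i : ℕ+) : Series α β := powerSum Function.Embedding.inl i

/-- The power sums `p_i(Y)`. -/
def pY (i : ℕ+) : Series α β := powerSum Function.Embedding.inr i

/-- The power sums of `X + XY(1 - t)`: `p_i(X) + (1 - t^i) p_i(X) p_i(Y)`. -/
def pKernel (i : ℕ+) : Series α β :=
  pX α β i + (1 - t ^ (i : ℕ)) • (pX α β i * pY α β i)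

variable {α β}

/-- The letter `x` of the alphabet `X`. -/
def letterX (x : α) : Series α β := MvPowerSeries.X (Sum.inl x)

/-- The letter `y` of the alphabet `Y`. -/
def letterY (y : β) : Series α β := MvPowerSeries.X (Sum.inr y)

/-- The inverse of a power series with constant term `1`. -/
def inv (F : Series α β) : Series α β := MvPowerSeries.invOfUnit F 1

end TwoAlphabets

end HallLittlewood

end

open HallLittlewood

open scoped TensorProduct

noncomputable section

namespace HallLittlewood

/-! ### Generating series of complete functions -/

section Generating

open PowerSeries

/-! Since `X + XY(1 - t) = X (1 + Y(1 - t))`, the expansion is a Cauchy identity followed by a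
branching rule. Take the scalar product for which products of power sums are orthogonal and `⟨p_i,
p_i⟩ = i (1 - t^i)`. Once the `Q'_λ` are known to form an orthogonal basis with square norms `b_λ`
(`pairing_modQ`, `modQBasis`), one gets `S_d(AC) = ∑_{|λ| = d} P_λ(A) Q'_λ(C)`
(`evalAt_mul_complete`). Put `A = X`, `C = 1 + Y(1 - t)`, expand `Q'_λ(1 + Z) = ∑_μ ℵ(λ/μ) Q'_μ(Z)`
(`addOne_modQ`) and use `Q'_μ(Y(1 - t)) = b_μ P_μ(Y)`.

All properties of `Q'` come from the vertex operators `B_m f = ∑_k S_{m+k}(X) [w^k] f(X - (1 - t)w)`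
(`creation`). Writing `X - (1 - t)w` as `X + tw - w`, the action of `B_m` on a Schur determinant is
exactly that of the raising operators attached to a new first row, so `Q'_(m,μ) = B_m Q'_μ`
(`modQVec_cons`). The exchange relation of two such operators (`creation_creation`) straightens `B_m
Q'_λ` when `m < λ_1`; hence the `Q'_λ` span, with control of the length. The exchange relation with
the adjoints (`annihilation_creation`) gives orthogonality.

For the branching rule, `(B_m f)(X + 1) = (B_{m-1} f)(X + 1) + B_m (f(X + 1))`, and `B_{m-1} B_m = t
B_m B_{m-1}` evaluates the first term on `Q'`. The resulting recursion on `λ` is also satisfied by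
the product formula `ℵ(λ/μ)` (`aleph_consRow`).

The restriction to length at most `n` is free: multiplication by `S_k` raises the length by at most
one, its adjoint extracts one letter, so by orthogonality `P_λ` vanishes on fewer than `ℓ(λ)`
letters (`evalAt_P_eq_zero`). Convergence is settled one monomial `d` at a time, modulo `truncIdeal
d`, where only finitely many letters survive and all the identities are finite. -/

theorem geom_mul {R : Type*} [CommRing R] (x : R) : (1 - C x * X) * (mk fun k => x ^ (k + 1) : R⟦X⟧) = C x := by
  ext n
  cases n with
  | zero => simp
  | succ n =>
    rw [sub_mul, one_mul, map_sub, coeff_mk, mul_assoc, coeff_C_mul, coeff_succ_X_mul, coeff_mk,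
      coeff_C]
    simp [pow_succ']

variable {R : Type*} [CommRing R] [Algebra Coef R]

/-- `R` contains `ℚ` through `Coef`, so nonzero integers are units even when `R` has zero divisors,
as the quotients used for truncation do. -/
theorem natCast_mul_cancel {k : ℕ} (hk : k ≠ 0) {x y : R} (h : (k : R) * x = k * y) : x = y := by
  have hu : algebraMap Coef R (PowerSeries.C ((k : ℚ)⁻¹)) * (k : R) = 1 := by
    rw [← map_natCast (algebraMap Coef R), ← map_mul, ← map_natCast (PowerSeries.C (R := ℚ)),
      ← map_mul, inv_mul_cancel₀ (by exact_mod_cast hk), map_one, map_one]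
  calc x = algebraMap Coef R (PowerSeries.C ((k : ℚ)⁻¹)) * ((k : R) * x) := by
        rw [← mul_assoc, hu, one_mul]
    _ = y := by rw [h, ← mul_assoc, hu, one_mul]

theorem complete_zero : complete 0 = 1 := by rw [complete]

/-- Newton's identity. -/
theorem newton (k : ℕ) : ((k + 1 : ℕ) : Sym) * complete (k + 1) =
    ∑ i ∈ Finset.range (k + 1), MvPolynomial.X (Nat.succPNat i) * complete (k - i) := by
  rw [complete, Fin.sum_univ_eq_sum_range
    (fun i => (MvPolynomial.X (Nat.succPNat i) : Sym) * complete (k - i)), mul_smul_comm,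
    ← nsmul_eq_mul, ← Nat.cast_smul_eq_nsmul ℚ, smul_smul]
  push_cast
  rw [inv_mul_cancel₀ (by positivity), one_smul]

theorem evalAt_X (a : ℕ+ → R) (i : ℕ+) : evalAt a (MvPolynomial.X i) = a i :=
  MvPolynomial.aeval_X a i

theorem newton_evalAt (a : ℕ+ → R) (k : ℕ) :
    ((k + 1 : ℕ) : R) * evalAt a (complete (k + 1)) =
      ∑ i ∈ Finset.range (k + 1), a (Nat.succPNat i) * evalAt a (complete (k - i)) := by
  rw [← map_natCast (evalAt a), ← map_mul, newton, map_sum]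
  simp only [map_mul, evalAt_X]

/-- The generating series of the complete functions of an argument. -/
def hSeries (a : ℕ+ → R) : R⟦X⟧ := mk fun k => evalAt a (complete k)

/-- The generating series of the power sums of an argument. -/
def pSeries (a : ℕ+ → R) : R⟦X⟧ := mk fun k => a (Nat.succPNat k)

theorem derivative_hSeries (a : ℕ+ → R) : d⁄dX R (hSeries a) = pSeries a * hSeries a := by
  ext k
  rw [coeff_derivative, hSeries, coeff_mk, coeff_mul,
    Finset.Nat.sum_antidiagonal_eq_sum_range_succ_mk, mul_comm]
  have := newton_evalAt a k
  push_cast at this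
  rw [this]
  simp [pSeries]

theorem constantCoeff_hSeries (a : ℕ+ → R) : constantCoeff (hSeries a) = 1 := by
  simp [hSeries, complete_zero]

/-- Uniqueness for a linear first order equation: it expresses `n + 1` times each coefficient
through the earlier ones. -/
theorem eq_of_derivative_eq_mul {A F G : R⟦X⟧} (hF : d⁄dX R F = A * F) (hG : d⁄dX R G = A * G)
    (h0 : constantCoeff F = constantCoeff G) : F = G := by
  ext n
  induction n using Nat.strong_induction_on with
  | _ n ih =>
    cases n with
    | zero => simpa using h0
    | succ n =>
      apply natCast_mul_cancel (k := n + 1) (by omega)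
      have h1 := congrArg (coeff n) hF
      have h2 := congrArg (coeff n) hG
      rw [coeff_derivative, coeff_mul] at h1 h2
      push_cast
      rw [mul_comm, h1, mul_comm, h2]
      refine Finset.sum_congr rfl fun p hp => ?_
      rw [ih p.2 (by have := Finset.HasAntidiagonal.mem_antidiagonal.mp hp; omega)]

/-- Both sides have logarithmic derivative `pSeries a - y / (1 - yX)`: the factor `1 - xX` cancels
the contribution of the new letter `x`. All later formulas for `S_n` at a modified argument are
instances of this one. -/
theorem hSeries_add_pow_sub_pow {a a' : ℕ+ → R} {x y : R}
    (h : ∀ i : ℕ+, a' i = a i + x ^ (i : ℕ) - y ^ (i : ℕ)) :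
    (1 - C x * X) * hSeries a' = (1 - C y * X) * hSeries a := by
  set G : R → R⟦X⟧ := fun x => mk fun k => x ^ (k + 1) with hG
  have hp : pSeries a' = pSeries a + G x - G y := by
    ext k; simp [pSeries, h, hG]
  have hd : ∀ z : R, d⁄dX R (1 - C z * X : R⟦X⟧) = - C z := fun z => by
    simp [map_sub, Derivation.leibniz]
  have hx := geom_mul x
  have hy := geom_mul y
  refine eq_of_derivative_eq_mul (A := pSeries a - G y) ?_ ?_ ?_
  · rw [Derivation.leibniz, hd, derivative_hSeries, hp]
    simp only [smul_eq_mul]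
    linear_combination (hSeries a') * hx
  · rw [Derivation.leibniz, hd, derivative_hSeries]
    simp only [smul_eq_mul]
    linear_combination (hSeries a) * hy
  · simp [constantCoeff_hSeries]

theorem hSeries_mul_hSeries_neg (a : ℕ+ → R) : hSeries a * hSeries (-a) = 1 := by
  refine eq_of_derivative_eq_mul (A := 0) ?_ ?_ ?_
  · rw [Derivation.leibniz, derivative_hSeries, derivative_hSeries]
    have : pSeries (-a) = - pSeries a := by ext k; simp [pSeries]
    rw [this]; simp only [smul_eq_mul]; ring
  · simp
  · simp [constantCoeff_hSeries]

theorem evalAt_zero_complete (k : ℕ) :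
    evalAt (0 : ℕ+ → R) (complete k) = if k = 0 then 1 else 0 := by
  cases k with
  | zero => simp [complete_zero]
  | succ k =>
    apply natCast_mul_cancel (k := k + 1) (by omega)
    rw [newton_evalAt]; simp

theorem completeInt_natCast (k : ℕ) : completeInt k = complete k := by
  simp [completeInt]

theorem completeInt_of_neg {n : ℤ} (h : n < 0) : completeInt n = 0 := by
  simp [completeInt, not_le.mpr h]

theorem completeInt_zero : completeInt 0 = 1 := by
  simpa [complete_zero] using completeInt_natCast 0

/-- Adding `x` and removing `y` from an argument. -/
theorem evalAt_completeInt_add_sub {a a' : ℕ+ → R} {x y : R}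
    (h : ∀ i : ℕ+, a' i = a i + x ^ (i : ℕ) - y ^ (i : ℕ)) (n : ℤ) :
    evalAt a' (completeInt n) - x * evalAt a' (completeInt (n - 1)) =
      evalAt a (completeInt n) - y * evalAt a (completeInt (n - 1)) := by
  have key := hSeries_add_pow_sub_pow h
  rcases lt_or_ge n 0 with hn | hn
  · rw [completeInt_of_neg hn, completeInt_of_neg (by omega)]; simp
  · lift n to ℕ using hn
    cases n with
    | zero => simp [completeInt_zero, completeInt_of_neg]
    | succ n =>
      have := congrArg (coeff (n + 1)) key
      simp only [sub_mul, one_mul, map_sub, mul_assoc, coeff_C_mul, coeff_succ_X_mul, hSeries,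
        coeff_mk] at this
      have e : ((n + 1 : ℕ) : ℤ) - 1 = (n : ℕ) := by push_cast; ring
      rw [e, completeInt_natCast, completeInt_natCast]
      exact this

theorem evalAt_completeInt_add {a a' : ℕ+ → R} {x y : R}
    (h : ∀ i : ℕ+, a' i + y ^ (i : ℕ) = a i + x ^ (i : ℕ)) (n : ℤ) :
    evalAt a' (completeInt n) + y * evalAt a (completeInt (n - 1)) =
      evalAt a (completeInt n) + x * evalAt a' (completeInt (n - 1)) := by
  have := evalAt_completeInt_add_sub (fun i => eq_sub_of_add_eq (h i)) n
  linear_combination (exp := 1) this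

theorem sum_complete_mul_neg (a : ℕ+ → R) (n : ℕ) :
    ∑ p ∈ Finset.HasAntidiagonal.antidiagonal n, evalAt a (complete p.1) * evalAt (-a) (complete p.2) =
      if n = 0 then 1 else 0 := by
  have := congrArg (coeff n) (hSeries_mul_hSeries_neg a)
  rw [coeff_mul, coeff_one] at this
  simpa [hSeries] using this

end Generating

/-! ### The scalar product -/

theorem one_sub_t_pow_ne_zero {k : ℕ} (hk : k ≠ 0) : (1 - t ^ k : Coef) ≠ 0 := by
  intro h
  have := congrArg (PowerSeries.constantCoeff (R := ℚ)) h
  simp [t, hk] at this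

theorem coef_natCast_ne_zero {k : ℕ} (hk : k ≠ 0) : (k : Coef) ≠ 0 := by
  intro h
  have := congrArg (PowerSeries.constantCoeff (R := ℚ)) h
  rw [map_natCast, map_zero] at this
  exact hk (by exact_mod_cast this)

/-- The square norm of the product of power sums `∏ p_i ^ (s i)`. -/
def normSq (s : ℕ+ →₀ ℕ) : Coef :=
  s.prod fun i k => (k.factorial : Coef) * ((i : ℕ) * (1 - t ^ (i : ℕ))) ^ k

theorem normSq_ne_zero (s : ℕ+ →₀ ℕ) : normSq s ≠ 0 := by
  refine Finset.prod_ne_zero_iff.mpr fun i _ => mul_ne_zero ?_ (pow_ne_zero _ (mul_ne_zero ?_ ?_))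
  · exact coef_natCast_ne_zero (Nat.factorial_ne_zero _)
  · exact coef_natCast_ne_zero i.ne_zero
  · exact one_sub_t_pow_ne_zero i.ne_zero

theorem normSq_add_single (s : ℕ+ →₀ ℕ) (i : ℕ+) :
    normSq (s + Finsupp.single i 1) =
      normSq s * ((s i + 1 : ℕ) * ((i : ℕ) * (1 - t ^ (i : ℕ)))) := by
  classical
  unfold normSq
  have h1 : s.support ⊆ insert i s.support := Finset.subset_insert _ _
  have h2 : (s + Finsupp.single i 1).support ⊆ insert i s.support := by
    intro j hj
    rw [Finset.mem_insert, Finsupp.mem_support_iff]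
    by_contra! hc
    simp [hc.2, hc.1.symm] at hj
  rw [Finsupp.prod_of_support_subset _ h1 _ (by simp),
    Finsupp.prod_of_support_subset _ h2 _ (by simp),
    ← Finset.mul_prod_erase _ _ (Finset.mem_insert_self i s.support),
    ← Finset.mul_prod_erase (insert i s.support) _ (Finset.mem_insert_self i s.support)]
  have h3 : ∀ j ∈ (insert i s.support).erase i, (s + Finsupp.single i 1 : ℕ+ →₀ ℕ) j = s j := by
    intro j hj
    simp [(Finset.mem_erase.mp hj).1.symm]
  rw [Finset.prod_congr rfl fun j hj => by rw [h3 j hj]]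
  simp only [Finsupp.add_apply, Finsupp.single_eq_same, Nat.factorial_succ]
  push_cast
  ring

/-- The scalar product for which the products of power sums are orthogonal, with
`⟨p_i, p_i⟩ = i (1 - t^i)`. -/
def pairing : Sym →ₗ[Coef] Sym →ₗ[Coef] Coef :=
  (MvPolynomial.basisMonomials ℕ+ Coef).constr Coef fun s => normSq s • MvPolynomial.lcoeff Coef s

theorem pairing_monomial (s : ℕ+ →₀ ℕ) (c : Coef) (g : Sym) :
    pairing (MvPolynomial.monomial s c) g = c * (normSq s * MvPolynomial.coeff s g) := by
  have h : (MvPolynomial.monomial s c : Sym) = c • (MvPolynomial.basisMonomials ℕ+ Coef s) := by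
    simp [MvPolynomial.smul_monomial]
  rw [h, map_smul, pairing, Module.Basis.constr_basis]
  simp

theorem pairing_comm (f g : Sym) : pairing f g = pairing g f := by
  induction f using MvPolynomial.induction_on' with
  | add p q hp hq => simp [hp, hq]
  | monomial s c =>
    induction g using MvPolynomial.induction_on' with
    | add p q hp hq => simp [hp, hq]
    | monomial r d =>
      rw [pairing_monomial, pairing_monomial, MvPolynomial.coeff_monomial,
        MvPolynomial.coeff_monomial]
      by_cases h : r = s
      · subst h; simp; ring
      · simp [h, Ne.symm h]

/-- The Gram matrix of the monomials in the power sums is diagonal with nonzero entries. This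
nondegeneracy carries identities between multiplication operators over to their adjoints. -/
theorem eq_of_pairing_eq {f g : Sym} (h : ∀ k, pairing k f = pairing k g) : f = g := by
  ext1 s
  have := h (MvPolynomial.monomial s 1)
  rw [pairing_monomial, pairing_monomial, one_mul, one_mul] at this
  exact mul_left_cancel₀ (normSq_ne_zero s) this

/-- The factor `s i + 1` by which the factorial in `normSq` grows is the one produced by the
derivative. -/
theorem pairing_X_mul (i : ℕ+) (f g : Sym) :
    pairing (MvPolynomial.X i * f) g =
      pairing f (((i : ℕ) * (1 - t ^ (i : ℕ)) : Coef) • MvPolynomial.pderiv i g) := by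
  induction f using MvPolynomial.induction_on' with
  | add p q hp hq => simp only [mul_add, map_add, LinearMap.add_apply, hp, hq]
  | monomial s c =>
    have : (MvPolynomial.X i * MvPolynomial.monomial s c : Sym) =
        MvPolynomial.monomial (s + Finsupp.single i 1) c := by
      rw [MvPolynomial.X, MvPolynomial.monomial_mul, one_mul, add_comm]
    rw [this, pairing_monomial, pairing_monomial, MvPolynomial.coeff_smul,
      MvPolynomial.coeff_pderiv, normSq_add_single, smul_eq_mul]
    push_cast
    ring

/-! ### Shifts of the argument -/

/-- The shift `f(X) ↦ f(X + ε (1 - t) w)`, as a polynomial in `w`. -/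
def shift (ε : Coef) : Sym →ₐ[Coef] Polynomial Sym :=
  evalAt fun i : ℕ+ => Polynomial.C (MvPolynomial.X i : Sym) +
    (ε * (1 - t ^ (i : ℕ))) • Polynomial.X ^ (i : ℕ)

theorem shift_X (ε : Coef) (i : ℕ+) : shift ε (MvPolynomial.X i) =
    Polynomial.C (MvPolynomial.X i) + (ε * (1 - t ^ (i : ℕ))) • Polynomial.X ^ (i : ℕ) :=
  evalAt_X _ i

/-- The coefficient of `w^k` in `f(X + ε (1 - t) w)`. -/
def shiftCoeff (ε : Coef) (k : ℕ) : Sym →ₗ[Coef] Sym :=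
  (Polynomial.lcoeff Sym k).restrictScalars Coef ∘ₗ (shift ε).toLinearMap

theorem shiftCoeff_apply (ε : Coef) (k : ℕ) (f : Sym) :
    shiftCoeff ε k f = (shift ε f).coeff k := rfl

theorem shiftCoeff_zero (ε : Coef) (f : Sym) : shiftCoeff ε 0 f = f := by
  have h : (Polynomial.aeval (0 : Sym)).toRingHom.comp (shift ε).toRingHom = RingHom.id Sym := by
    apply MvPolynomial.ringHom_ext
    · intro r; simp
    · intro i; simp [shift_X]
  have := congrArg (fun φ : Sym →+* Sym => φ f) h
  rw [shiftCoeff_apply, Polynomial.coeff_zero_eq_aeval_zero]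
  exact this

/-- The chain rule for shifts. -/
theorem exists_X_mul_derivative_shift (ε : Coef) (f : Sym) : ∃ S₀ : Finset ℕ+, ∀ S, S₀ ⊆ S →
    Polynomial.X * Polynomial.derivative (shift ε f) =
      ∑ i ∈ S, (ε * ((i : ℕ) * (1 - t ^ (i : ℕ)))) •
        (Polynomial.X ^ (i : ℕ) * shift ε (MvPolynomial.pderiv i f)) := by
  classical
  induction f using MvPolynomial.induction_on with
  | C c => exact ⟨∅, fun S _ => by simp⟩
  | add p q hp hq =>
    obtain ⟨S₁, h₁⟩ := hp
    obtain ⟨S₂, h₂⟩ := hq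
    refine ⟨S₁ ∪ S₂, fun S hS => ?_⟩
    simp only [map_add, mul_add, smul_add, Finset.sum_add_distrib]
    rw [h₁ S (Finset.union_subset_left hS), h₂ S (Finset.union_subset_right hS)]
  | mul_X p j hp =>
    obtain ⟨S₁, h₁⟩ := hp
    refine ⟨insert j S₁, fun S hS => ?_⟩
    have hj : j ∈ S := hS (Finset.mem_insert_self _ _)
    have h := h₁ S ((Finset.subset_insert _ _).trans hS)
    have hX : (Polynomial.X : Polynomial Sym) * Polynomial.derivative (shift ε (MvPolynomial.X j))
        = (ε * ((j : ℕ) * (1 - t ^ (j : ℕ)))) • Polynomial.X ^ (j : ℕ) := by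
      rw [shift_X, Polynomial.derivative_add, Polynomial.derivative_C, zero_add,
        Polynomial.derivative_smul, Polynomial.derivative_X_pow, mul_smul_comm, ← mul_assoc,
        mul_comm Polynomial.X, mul_assoc, ← pow_succ', Nat.sub_add_cancel j.pos]
      have : (Polynomial.C ((j : ℕ) : Sym)) = algebraMap Coef (Polynomial Sym) ((j : ℕ) : Coef) := by
        simp
      rw [this, ← Algebra.smul_def, smul_smul]
      congr 1; ring
    have hs : ∑ i ∈ S, (ε * ((i : ℕ) * (1 - t ^ (i : ℕ)))) •
        (Polynomial.X ^ (i : ℕ) * shift ε (MvPolynomial.pderiv i (p * MvPolynomial.X j))) =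
        (∑ i ∈ S, (ε * ((i : ℕ) * (1 - t ^ (i : ℕ)))) •
        (Polynomial.X ^ (i : ℕ) * shift ε (MvPolynomial.pderiv i p))) * shift ε (MvPolynomial.X j)
        + (ε * ((j : ℕ) * (1 - t ^ (j : ℕ)))) • Polynomial.X ^ (j : ℕ) * shift ε p := by
      rw [← Finset.sum_erase_add _ _ hj, ← Finset.sum_erase_add (a := j) S _ hj, add_mul,
        Finset.sum_mul, add_assoc]
      congr 1
      · refine Finset.sum_congr rfl fun i hi => ?_
        rw [MvPolynomial.pderiv_mul, MvPolynomial.pderiv_X_of_ne (Finset.mem_erase.mp hi).1.symm,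
          mul_zero, add_zero, map_mul, smul_mul_assoc, mul_assoc]
      · rw [MvPolynomial.pderiv_mul, MvPolynomial.pderiv_X_self, mul_one, map_add, map_mul,
          mul_add, smul_add, smul_mul_assoc, smul_mul_assoc, mul_assoc]
    rw [hs, ← h, map_mul, Polynomial.derivative_mul, mul_add, ← mul_assoc, ← hX]
    ring

/-- The chain rule read on the coefficient of `w^(k+1)`. It has the shape of Newton's identity for
`S_(k+1)(ε X)`, with each `p_i` replaced by its adjoint derivation. -/
theorem succ_mul_shiftCoeff (ε : Coef) (k : ℕ) (f : Sym) :
    ((k + 1 : ℕ) : Coef) • shiftCoeff ε (k + 1) f = ∑ i ∈ Finset.range (k + 1),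
      (ε * ((i + 1 : ℕ) * (1 - t ^ (i + 1)))) •
        shiftCoeff ε (k - i) (MvPolynomial.pderiv (Nat.succPNat i) f) := by
  classical
  obtain ⟨S₀, hS⟩ := exists_X_mul_derivative_shift ε f
  -- The index set is enlarged to contain `1, …, k + 1`; its other elements exceed `k + 1` and do
  -- not contribute to `w^(k+1)`.
  have h := congrArg (fun P => Polynomial.coeff P (k + 1))
    (hS (S₀ ∪ (Finset.range (k + 1)).image Nat.succPNat) Finset.subset_union_left)
  simp only [Polynomial.coeff_X_mul, Polynomial.coeff_derivative, Polynomial.finsetSum_coeff,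
    Polynomial.coeff_smul, Polynomial.coeff_X_pow_mul'] at h
  have e : ((k + 1 : ℕ) : Coef) • shiftCoeff ε (k + 1) f =
      (shift ε f).coeff (k + 1) * ((k : Sym) + 1) := by
    rw [shiftCoeff_apply, Nat.cast_smul_eq_nsmul, nsmul_eq_mul]
    push_cast; ring
  rw [e, h, ← Finset.sum_subset (Finset.subset_union_right (s₁ := S₀)), Finset.sum_image]
  · refine Finset.sum_congr rfl fun i hi => ?_
    have := Finset.mem_range.mp hi
    rw [if_pos (by simpa using by omega), shiftCoeff_apply]
    simp
  · intro a _ b _ hab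
    exact Nat.succPNat_injective hab
  · intro i _ hi
    rw [if_neg, smul_zero]
    intro hle
    refine hi (Finset.mem_image.mpr ⟨i.natPred, ?_, by simp⟩)
    have := i.natPred_add_one
    rw [Finset.mem_range]; omega

/-- The complete function `S_k(ε X)`. -/
def scaledComplete (ε : Coef) (k : ℕ) : Sym :=
  evalAt (fun i : ℕ+ => ε • (MvPolynomial.X i : Sym)) (complete k)

/-- Multiplication by `S_k(ε X)` is adjoint to taking the coefficient of `w^k` in
`f(X + ε (1 - t) w)`. -/
theorem pairing_scaledComplete_mul (ε : Coef) (k : ℕ) (f g : Sym) :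
    pairing (scaledComplete ε k * f) g = pairing f (shiftCoeff ε k g) := by
  induction k using Nat.strong_induction_on generalizing f g with
  | _ k ih =>
    cases k with
    | zero => simp [scaledComplete, complete_zero, shiftCoeff_zero]
    | succ k =>
      have hk : ((k + 1 : ℕ) : Coef) ≠ 0 := coef_natCast_ne_zero k.succ_ne_zero
      apply mul_left_cancel₀ hk
      have h1 : ((k + 1 : ℕ) : Coef) • (scaledComplete ε (k + 1) * f) =
          (((k + 1 : ℕ) : Sym) * scaledComplete ε (k + 1)) * f := by
        rw [Nat.cast_smul_eq_nsmul, nsmul_eq_mul, mul_assoc]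
      have h2 : ∀ x : Coef, ((k + 1 : ℕ) : Coef) * x = ((k + 1 : ℕ) : Coef) • x := fun _ => rfl
      -- Newton's identity on the left meets its adjoint recursion on the right; each `p_i` crosses
      -- the pairing as a derivation and the induction hypothesis handles `S_(k-i)`.
      rw [h2, h2, ← map_smul (pairing f), succ_mul_shiftCoeff, ← LinearMap.smul_apply,
        ← map_smul, h1, scaledComplete, newton_evalAt, Finset.sum_mul, map_sum, LinearMap.sum_apply, map_sum]
      refine Finset.sum_congr rfl fun i hi => ?_
      rw [smul_mul_assoc, smul_mul_assoc, map_smul, LinearMap.smul_apply, mul_assoc,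
        pairing_X_mul, ← scaledComplete, ih (k - i) (by omega), map_smul, map_smul, map_smul,
        smul_smul]
      simp

theorem scaledComplete_one (k : ℕ) : scaledComplete 1 k = complete k := by
  have : (evalAt fun i : ℕ+ => (1 : Coef) • (MvPolynomial.X i : Sym)) = AlgHom.id Coef Sym := by
    apply MvPolynomial.algHom_ext
    intro i; rw [evalAt_X]; simp
  rw [scaledComplete, this]; rfl

/-- The adjoint operators are multiplications, which commute. -/
theorem shiftCoeff_comm (ε δ : Coef) (k l : ℕ) (f : Sym) :
    shiftCoeff ε k (shiftCoeff δ l f) = shiftCoeff δ l (shiftCoeff ε k f) := by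
  apply eq_of_pairing_eq
  intro g
  rw [← pairing_scaledComplete_mul, ← pairing_scaledComplete_mul, ← pairing_scaledComplete_mul,
    ← pairing_scaledComplete_mul, mul_left_comm]

/-- Adjoint of `σ(X) σ(-X) = 1`: the shifts by `(1 - t)w` and `-(1 - t)w` undo each other. -/
theorem sum_shiftCoeff_one_neg_one (n : ℕ) (f : Sym) :
    ∑ p ∈ Finset.HasAntidiagonal.antidiagonal n, shiftCoeff 1 p.1 (shiftCoeff (-1) p.2 f) =
      if n = 0 then f else 0 := by
  apply eq_of_pairing_eq
  intro g
  rw [map_sum]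
  have h := sum_complete_mul_neg (fun i : ℕ+ => (MvPolynomial.X i : Sym)) n
  have e : ∀ p : ℕ × ℕ, evalAt (fun i : ℕ+ => (MvPolynomial.X i : Sym)) (complete p.1) *
      evalAt (-(fun i : ℕ+ => (MvPolynomial.X i : Sym))) (complete p.2) =
      scaledComplete 1 p.1 * scaledComplete (-1) p.2 := fun p => by
    unfold scaledComplete
    congr 3
    · funext i; simp
    · funext i; simp
  simp only [e] at h
  simp only [← pairing_scaledComplete_mul, ← LinearMap.sum_apply, ← map_sum]
  have : ∑ p ∈ Finset.HasAntidiagonal.antidiagonal n,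
      scaledComplete (-1) p.2 * (scaledComplete 1 p.1 * g) = (if n = 0 then 1 else 0) * g := by
    rw [← h, Finset.sum_mul]
    exact Finset.sum_congr rfl fun p _ => by ring
  rw [this]
  split_ifs <;> simp

/-! ### The degree operator -/

/-- The degree operator `∑ i p_i ∂/∂p_i`. -/
def euler : Derivation Coef Sym Sym :=
  MvPolynomial.mkDerivation Coef fun i : ℕ+ => ((i : ℕ) : Coef) • (MvPolynomial.X i : Sym)

/-- The degree of the product of power sums `∏ p_i ^ (s i)`. -/
def weight (s : ℕ+ →₀ ℕ) : ℕ := s.sum fun i k => k * (i : ℕ)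

theorem euler_monomial (s : ℕ+ →₀ ℕ) (c : Coef) :
    euler (MvPolynomial.monomial s c) = (weight s : Coef) • MvPolynomial.monomial s c := by
  rw [euler, MvPolynomial.mkDerivation_monomial, Finsupp.sum, weight, Finsupp.sum]
  push_cast
  rw [Finset.sum_smul, Finset.smul_sum]
  refine Finset.sum_congr rfl fun i hi => ?_
  have h1 : s - Finsupp.single i 1 + Finsupp.single i 1 = s := by
    ext j
    by_cases hj : i = j
    · subst hj
      have := Finsupp.mem_support_iff.mp hi
      simp; omega
    · simp [hj]
  rw [smul_eq_mul, mul_smul_comm, MvPolynomial.X, MvPolynomial.monomial_mul, h1,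
    MvPolynomial.smul_monomial, MvPolynomial.smul_monomial, MvPolynomial.smul_monomial]
  congr 1
  simp only [smul_eq_mul]; ring

theorem coeff_euler (s : ℕ+ →₀ ℕ) (f : Sym) :
    MvPolynomial.coeff s (euler f) = weight s * MvPolynomial.coeff s f := by
  classical
  induction f using MvPolynomial.induction_on' with
  | add p q hp hq => simp [hp, hq, mul_add]
  | monomial r c =>
    rw [euler_monomial, MvPolynomial.coeff_smul, MvPolynomial.coeff_monomial]
    split_ifs with h
    · rw [h]; rfl
    · simp

theorem pairing_euler (f g : Sym) : pairing (euler f) g = pairing f (euler g) := by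
  induction f using MvPolynomial.induction_on' with
  | add p q hp hq => simp [hp, hq]
  | monomial r c =>
    rw [euler_monomial, map_smul, LinearMap.smul_apply, pairing_monomial, pairing_monomial,
      coeff_euler, smul_eq_mul]
    ring

theorem euler_scaledComplete (ε : Coef) (k : ℕ) :
    euler (scaledComplete ε k) = (k : Coef) • scaledComplete ε k := by
  induction k using Nat.strong_induction_on with
  | _ k ih =>
    cases k with
    | zero => simp [scaledComplete, complete_zero]
    | succ k =>
      apply natCast_mul_cancel (k := k + 1) k.succ_ne_zero
      have h : ((k + 1 : ℕ) : Sym) * scaledComplete ε (k + 1) = _ :=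
        newton_evalAt (fun i : ℕ+ => ε • (MvPolynomial.X i : Sym)) k
      rw [mul_smul_comm, h, ← nsmul_eq_mul, ← map_nsmul, nsmul_eq_mul, h, map_sum, Finset.smul_sum]
      refine Finset.sum_congr rfl fun i hi => ?_
      have hi := Finset.mem_range.mp hi
      rw [Derivation.leibniz, ← scaledComplete, ih (k - i) (by omega), Derivation.map_smul, euler,
        MvPolynomial.mkDerivation_X, smul_eq_mul, smul_eq_mul, smul_comm ε, mul_smul_comm,
        mul_smul_comm, mul_comm (scaledComplete ε (k - i)), ← add_smul]
      congr 1
      simp only [Nat.succPNat_coe, Nat.succ_eq_add_one]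
      rw [← Nat.cast_add]
      congr 1; omega

/-- Adjoint of the Leibniz rule for the degree operator applied to `S_k(ε X) g`. -/
theorem euler_shiftCoeff (ε : Coef) (k : ℕ) (f : Sym) :
    euler (shiftCoeff ε k f) = shiftCoeff ε k (euler f) - (k : Coef) • shiftCoeff ε k f := by
  apply eq_of_pairing_eq
  intro g
  rw [← pairing_euler, ← pairing_scaledComplete_mul, map_sub, map_smul,
    ← pairing_scaledComplete_mul, ← pairing_euler, Derivation.leibniz, euler_scaledComplete,
    ← pairing_scaledComplete_mul]
  simp only [smul_eq_mul, map_add, LinearMap.add_apply, map_smul,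
    LinearMap.smul_apply, mul_comm g, smul_mul_assoc]
  ring

/-- With `a = t^i` and `p = w^i` this presents `(1 - t)w` as the letter `w` minus the letter `tw`.
-/
theorem poly_one_sub_smul_add (a : Coef) (p : Polynomial Sym) : (1 - a) • p + a • p = p := by
  rw [← add_smul, sub_add_cancel]; exact one_smul Coef p

/-! ### Operators obtained by contracting shifts -/

/-- The `Sym`-linear functional `w^k ↦ g k` on `Sym[w]`. -/
def contract (g : ℕ → Sym) : Polynomial Sym →ₗ[Sym] Sym :=
  Polynomial.lsum fun k => g k • LinearMap.id

theorem contract_monomial (g : ℕ → Sym) (k : ℕ) (a : Sym) :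
    contract g (Polynomial.monomial k a) = g k * a := by
  rw [contract, Polynomial.lsum_apply, Polynomial.sum_monomial_index]
  · simp
  · simp

theorem contract_X_mul (g : ℕ → Sym) (p : Polynomial Sym) :
    contract g (Polynomial.X * p) = contract (fun k => g (k + 1)) p := by
  induction p using Polynomial.induction_on' with
  | add p q hp hq => rw [mul_add, map_add, map_add, hp, hq]
  | monomial k a => rw [Polynomial.X_mul_monomial, contract_monomial, contract_monomial]

theorem contract_C_mul (g : ℕ → Sym) (a : Sym) (p : Polynomial Sym) :
    contract g (Polynomial.C a * p) = a * contract g p := by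
  rw [← Polynomial.smul_eq_C_mul, map_smul, smul_eq_mul]

theorem contract_smul (g : ℕ → Sym) (c : Coef) (p : Polynomial Sym) :
    contract g (c • p) = c • contract g p :=
  ((contract g).restrictScalars Coef).map_smul c p

theorem contract_eq_sum (g : ℕ → Sym) {p : Polynomial Sym} {K : ℕ}
    (h : ∀ k, K ≤ k → p.coeff k = 0) :
    contract g p = ∑ k ∈ Finset.range K, g k * p.coeff k := by
  rw [contract, Polynomial.lsum_apply]
  refine Polynomial.sum_eq_of_subset (fun k a => (g k • LinearMap.id : Sym →ₗ[Sym] Sym) a)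
    (by simp) ?_
  intro k hk
  rw [Finset.mem_range]
  by_contra! hc
  exact Polynomial.mem_support_iff.mp hk (h k hc)

/-- The operator `f ↦ ∑ k, g k * [w^k] f(X + ε (1 - t) w)`. -/
def vertex (g : ℕ → Sym) (ε : Coef) : Sym →ₗ[Coef] Sym :=
  (contract g).restrictScalars Coef ∘ₗ (shift ε).toLinearMap

theorem vertex_apply (g : ℕ → Sym) (ε : Coef) (f : Sym) :
    vertex g ε f = contract g (shift ε f) := rfl

theorem vertex_eq_sum (g : ℕ → Sym) {ε : Coef} {f : Sym} {K : ℕ}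
    (h : ∀ k, K ≤ k → shiftCoeff ε k f = 0) :
    vertex g ε f = ∑ k ∈ Finset.range K, g k * shiftCoeff ε k f :=
  contract_eq_sum g h

theorem exists_shiftCoeff_eq_zero (ε : Coef) (f : Sym) :
    ∃ K, ∀ k, K ≤ k → shiftCoeff ε k f = 0 :=
  ⟨(shift ε f).natDegree + 1, fun _ hk => Polynomial.coeff_eq_zero_of_natDegree_lt hk⟩

theorem exists_shiftCoeff_shiftCoeff_eq_zero (ε δ : Coef) (f : Sym) :
    ∃ K, (∀ k, K ≤ k → shiftCoeff ε k f = 0) ∧ (∀ k, K ≤ k → shiftCoeff δ k f = 0) ∧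
      ∀ k l, K ≤ k → shiftCoeff ε k (shiftCoeff δ l f) = 0 := by
  obtain ⟨K₁, h₁⟩ := exists_shiftCoeff_eq_zero ε f
  obtain ⟨K₂, h₂⟩ := exists_shiftCoeff_eq_zero δ f
  refine ⟨max K₁ K₂, fun k hk => h₁ k (le_trans (le_max_left _ _) hk),
    fun k hk => h₂ k (le_trans (le_max_right _ _) hk), fun k l hk => ?_⟩
  rw [shiftCoeff_comm, h₁ k (le_trans (le_max_left _ _) hk), map_zero]

/-- The normally ordered product of two operators. -/
def nested (g : ℕ → Sym) (ε : Coef) (g' : ℕ → Sym) (ε' : Coef) (f : Sym) : Sym :=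
  (shift ε' f).sum fun l a => g' l * vertex g ε a

theorem nested_eq_sum (g : ℕ → Sym) {ε : Coef} (g' : ℕ → Sym) {ε' : Coef} {f : Sym} {K : ℕ}
    (h : ∀ k, K ≤ k → shiftCoeff ε' k f = 0) :
    nested g ε g' ε' f = ∑ l ∈ Finset.range K, g' l * vertex g ε (shiftCoeff ε' l f) := by
  refine Polynomial.sum_eq_of_subset (fun l a => g' l * vertex g ε a) (by simp) ?_
  intro k hk
  rw [Finset.mem_range]
  by_contra! hc
  exact Polynomial.mem_support_iff.mp hk (h k hc)

theorem nested_eq_sum_sum (g : ℕ → Sym) {ε : Coef} (g' : ℕ → Sym) {ε' : Coef} {f : Sym} {K : ℕ}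
    (h : ∀ k, K ≤ k → shiftCoeff ε k f = 0) (h' : ∀ k, K ≤ k → shiftCoeff ε' k f = 0) :
    nested g ε g' ε' f = ∑ l ∈ Finset.range K, ∑ k ∈ Finset.range K,
      g' l * g k * shiftCoeff ε k (shiftCoeff ε' l f) := by
  rw [nested_eq_sum g g' h']
  refine Finset.sum_congr rfl fun l _ => ?_
  rw [vertex_eq_sum (K := K) g (fun k hk => by rw [shiftCoeff_comm, h k hk, map_zero]),
    Finset.mul_sum]
  exact Finset.sum_congr rfl fun k _ => by ring

/-- In normal order the multipliers all stand to the left of the shifts; each of the two families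
commutes. -/
theorem nested_comm (g : ℕ → Sym) (ε : Coef) (g' : ℕ → Sym) (ε' : Coef) (f : Sym) :
    nested g ε g' ε' f = nested g' ε' g ε f := by
  obtain ⟨K, h, h', -⟩ := exists_shiftCoeff_shiftCoeff_eq_zero ε ε' f
  rw [nested_eq_sum_sum g g' h h', nested_eq_sum_sum g' g h' h, Finset.sum_comm]
  refine Finset.sum_congr rfl fun l _ => Finset.sum_congr rfl fun k _ => ?_
  rw [shiftCoeff_comm]; ring

/-- Moving the outer shift past the inner multiplier produces a factor of the form `(1 - d u) / (1 -
c u)`, where `u` raises the outer index by one and replaces `g'` by `g''`. The denominator is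
cleared so that only finite sums occur. -/
theorem vertex_vertex_sub (g : ℕ → Sym) (ε : Coef) (g' g'' : ℕ → Sym) (ε' c d : Coef)
    (h : ∀ l, shift ε (g' l) + d • (Polynomial.X * Polynomial.C (g'' l)) =
      Polynomial.C (g' l) + c • (Polynomial.X * shift ε (g'' l))) (f : Sym) :
    vertex g ε (vertex g' ε' f) - c • vertex (fun k => g (k + 1)) ε (vertex g'' ε' f) =
      nested g ε g' ε' f - d • nested (fun k => g (k + 1)) ε g'' ε' f := by
  obtain ⟨K, hK⟩ := exists_shiftCoeff_eq_zero ε' f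
  rw [nested_eq_sum _ _ hK, nested_eq_sum _ _ hK, vertex_eq_sum g' hK, vertex_eq_sum g'' hK,
    map_sum, map_sum, Finset.smul_sum, Finset.smul_sum, ← Finset.sum_sub_distrib,
    ← Finset.sum_sub_distrib]
  refine Finset.sum_congr rfl fun l _ => ?_
  have h1 : ∀ (c : Coef) (p q r : Polynomial Sym), contract g ((p + c • (Polynomial.X * q)) * r) =
      contract g (p * r) + c • contract (fun k => g (k + 1)) (q * r) := fun c p q r => by
    rw [add_mul, map_add, smul_mul_assoc, contract_smul, mul_assoc, contract_X_mul]
  have h2 := h1 c (Polynomial.C (g' l)) (shift ε (g'' l)) (shift ε (shiftCoeff ε' l f))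
  rw [← h, h1, contract_C_mul, contract_C_mul] at h2
  simp only [vertex_apply, map_mul (shift ε)]
  rw [sub_eq_sub_iff_add_eq_add]
  exact h2

/-! ### Creation operators and their adjoints -/

/-- The elementary functions up to sign: `S_n(-X)`. -/
def negComplete (n : ℤ) : Sym :=
  evalAt (fun i : ℕ+ => (-1 : Coef) • (MvPolynomial.X i : Sym)) (completeInt n)

theorem negComplete_natCast (k : ℕ) : negComplete k = scaledComplete (-1) k := by
  rw [negComplete, completeInt_natCast, scaledComplete]

theorem negComplete_of_neg {n : ℤ} (h : n < 0) : negComplete n = 0 := by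
  rw [negComplete, completeInt_of_neg h, map_zero]

/-- The creation operator `B_m`, for which `Q'_(m, μ) = B_m Q'_μ`. -/
def creation (m : ℤ) : Sym →ₗ[Coef] Sym := vertex (fun k => completeInt (m + k)) (-1)

/-- The adjoint of the creation operator. -/
def annihilation (m : ℤ) : Sym →ₗ[Coef] Sym := vertex (fun k => negComplete (k - m)) 1

/-! ### Complete functions under shifts, and the adjoint of a creation operator. -/

theorem algHom_evalAt {R S : Type*} [CommRing R] [Algebra Coef R] [CommRing S] [Algebra Coef S]
    (φ : R →ₐ[Coef] S) (a : ℕ+ → R) (f : Sym) : φ (evalAt a f) = evalAt (fun i => φ (a i)) f := by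
  have : φ.comp (evalAt a) = evalAt fun i => φ (a i) := by
    apply MvPolynomial.algHom_ext
    intro i; rw [AlgHom.comp_apply, evalAt_X, evalAt_X]
  rw [← this]; rfl

theorem C_evalAt (a : ℕ+ → Sym) (f : Sym) :
    Polynomial.C (evalAt a f) = evalAt (fun i => Polynomial.C (a i)) f := by
  induction f using MvPolynomial.induction_on with
  | C c =>
    rw [← MvPolynomial.algebraMap_eq, AlgHom.commutes, AlgHom.commutes,
      Polynomial.algebraMap_apply]
  | add p q hp hq => rw [map_add, map_add, map_add, hp, hq]
  | mul_X p i hp => rw [map_mul, map_mul, map_mul, hp, evalAt_X, evalAt_X]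

theorem evalAt_X_self : (evalAt fun i : ℕ+ => (MvPolynomial.X i : Sym)) = AlgHom.id Coef Sym :=
  MvPolynomial.algHom_ext fun i => by rw [evalAt_X]; rfl

theorem evalAt_C_X (f : Sym) :
    evalAt (fun i : ℕ+ => Polynomial.C (MvPolynomial.X i : Sym)) f = Polynomial.C f := by
  rw [← C_evalAt, evalAt_X_self]; rfl

/-- The new argument is `X + tw - w`. Together with the two companions for `X + w - tw` and for the
functions `S_n(-X)`, this supplies the constants `c`, `d` needed by `vertex_vertex_sub`: `t`, `1`
for two creation operators, `1`, `t` in the mixed cases. -/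
theorem shift_neg_one_completeInt (n : ℤ) :
    shift (-1) (completeInt n) + (1 : Coef) • (Polynomial.X * Polynomial.C (completeInt (n - 1))) =
      Polynomial.C (completeInt n) + t • (Polynomial.X * shift (-1) (completeInt (n - 1))) := by
  have h := evalAt_completeInt_add (R := Polynomial Sym)
    (a := fun i : ℕ+ => Polynomial.C (MvPolynomial.X i : Sym))
    (a' := fun i : ℕ+ => Polynomial.C (MvPolynomial.X i : Sym) +
      (-1 * (1 - t ^ (i : ℕ)) : Coef) • Polynomial.X ^ (i : ℕ))
    (x := t • Polynomial.X) (y := Polynomial.X)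
    (fun i => by
      nth_rewrite 2 [← poly_one_sub_smul_add (t ^ (i : ℕ)) (Polynomial.X ^ (i : ℕ))]
      rw [smul_pow, add_assoc, ← add_assoc (_ • _), ← add_smul]
      simp) n
  rw [evalAt_C_X, evalAt_C_X] at h
  rw [one_smul, ← smul_mul_assoc]
  exact h

theorem shift_one_completeInt (n : ℤ) :
    shift 1 (completeInt n) + t • (Polynomial.X * Polynomial.C (completeInt (n - 1))) =
      Polynomial.C (completeInt n) +
        (1 : Coef) • (Polynomial.X * shift 1 (completeInt (n - 1))) := by
  have h := evalAt_completeInt_add (R := Polynomial Sym)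
    (a := fun i : ℕ+ => Polynomial.C (MvPolynomial.X i : Sym))
    (a' := fun i : ℕ+ => Polynomial.C (MvPolynomial.X i : Sym) +
      (1 * (1 - t ^ (i : ℕ)) : Coef) • Polynomial.X ^ (i : ℕ))
    (x := Polynomial.X) (y := t • Polynomial.X)
    (fun i => by rw [smul_pow, one_mul, add_assoc, poly_one_sub_smul_add]) n
  rw [evalAt_C_X, evalAt_C_X] at h
  rw [one_smul, ← smul_mul_assoc]
  exact h

theorem shift_neg_one_negComplete (n : ℤ) :
    shift (-1) (negComplete n) + t • (Polynomial.X * Polynomial.C (negComplete (n - 1))) =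
      Polynomial.C (negComplete n) +
        (1 : Coef) • (Polynomial.X * shift (-1) (negComplete (n - 1))) := by
  have h := evalAt_completeInt_add (R := Polynomial Sym)
    (a := fun i : ℕ+ => Polynomial.C ((-1 : Coef) • (MvPolynomial.X i : Sym)))
    (a' := fun i : ℕ+ => shift (-1) ((-1 : Coef) • (MvPolynomial.X i : Sym)))
    (x := Polynomial.X) (y := t • Polynomial.X)
    (fun i => by
      rw [smul_pow, map_smul, shift_X, smul_add, smul_smul, ← Polynomial.smul_C,
        show (-1 * (-1 * (1 - t ^ (i : ℕ))) : Coef) = 1 - t ^ (i : ℕ) by ring, add_assoc,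
        poly_one_sub_smul_add]) n
  rw [← C_evalAt, ← C_evalAt, ← algHom_evalAt, ← algHom_evalAt] at h
  rw [one_smul, ← smul_mul_assoc]
  exact h

/-- Multiplications and shifts being mutually adjoint, both sides are the double sum of `⟨[w^k] f(X
- (1 - t)w), [w^j] g(X + (1 - t)w)⟩` over `j = m + k`. -/
theorem pairing_creation (m : ℤ) (f g : Sym) :
    pairing (creation m f) g = pairing f (annihilation m g) := by
  obtain ⟨K, hK⟩ := exists_shiftCoeff_eq_zero (-1) f
  obtain ⟨L, hL⟩ := exists_shiftCoeff_eq_zero 1 g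
  rw [creation, annihilation, vertex_eq_sum _ hK, vertex_eq_sum _ hL, map_sum, map_sum,
    LinearMap.sum_apply]
  have h1 : ∀ k : ℕ, pairing (completeInt (m + k) * shiftCoeff (-1) k f) g =
      ∑ j ∈ Finset.range L, if (j : ℤ) = m + k then
        pairing (shiftCoeff (-1) k f) (shiftCoeff 1 j g) else 0 := by
    intro k
    rcases lt_or_ge (m + k) 0 with hm | hm
    · rw [completeInt_of_neg hm, zero_mul, map_zero, LinearMap.zero_apply]
      refine (Finset.sum_eq_zero fun j _ => if_neg (by omega)).symm
    · obtain ⟨i, hi⟩ := Int.eq_ofNat_of_zero_le hm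
      rw [hi, completeInt_natCast, ← scaledComplete_one, pairing_scaledComplete_mul]
      simp only [Nat.cast_inj, Finset.sum_ite_eq', Finset.mem_range]
      split_ifs with h
      · rfl
      · rw [hL i (by omega), map_zero]
  have h2 : ∀ j : ℕ, pairing f (negComplete (j - m) * shiftCoeff 1 j g) =
      ∑ k ∈ Finset.range K, if (j : ℤ) = m + k then
        pairing (shiftCoeff (-1) k f) (shiftCoeff 1 j g) else 0 := by
    intro j
    rcases lt_or_ge ((j : ℤ) - m) 0 with hm | hm
    · rw [negComplete_of_neg hm, zero_mul, map_zero]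
      refine (Finset.sum_eq_zero fun j _ => if_neg (by omega)).symm
    · obtain ⟨i, hi⟩ := Int.eq_ofNat_of_zero_le hm
      rw [hi, negComplete_natCast, pairing_comm, pairing_scaledComplete_mul, pairing_comm]
      have : ∀ k : ℕ, ((j : ℤ) = m + k) ↔ k = i := fun k => by omega
      simp only [this, Finset.sum_ite_eq', Finset.mem_range]
      split_ifs with h
      · rfl
      · rw [hK i (by omega), map_zero, LinearMap.zero_apply]
  simp only [h1, h2]
  exact Finset.sum_comm

/-- The normally ordered product of two creation operators. -/
def normalBB (m n : ℤ) (f : Sym) : Sym :=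
  nested (fun k => completeInt (m + k)) (-1) (fun k => completeInt (n + k)) (-1) f

/-! ### Exchange relations of creation operators. -/

theorem creation_creation_sub (m n : ℤ) (f : Sym) :
    creation m (creation n f) - t • creation (m + 1) (creation (n - 1) f) =
      normalBB m n f - normalBB (m + 1) (n - 1) f := by
  have h := vertex_vertex_sub (fun k => completeInt (m + k)) (-1) (fun k => completeInt (n + k))
    (fun k => completeInt (n - 1 + k)) (-1) t 1 (fun l => by
      rw [show n - 1 + (l : ℤ) = n + l - 1 by ring]; exact shift_neg_one_completeInt _) f
  have e : (fun k : ℕ => completeInt (m + (k + 1 : ℕ))) = fun k : ℕ => completeInt (m + 1 + k) := by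
    funext k; congr 1; push_cast; ring
  rw [one_smul, e] at h
  exact h

/-- The previous relation is added for `(m, n)` and `(n - 1, m + 1)`: the normally ordered products
are symmetric, so they cancel. -/
theorem creation_creation (m n : ℤ) (f : Sym) :
    creation m (creation n f) = t • creation (m + 1) (creation (n - 1) f) -
      creation (n - 1) (creation (m + 1) f) + t • creation n (creation m f) := by
  have h1 := creation_creation_sub m n f
  have h2 := creation_creation_sub (n - 1) (m + 1) f
  have h3 : ∀ m n, normalBB m n f = normalBB n m f := fun m n => nested_comm _ _ _ _ f
  rw [h3 (n - 1) (m + 1), sub_add_cancel, add_sub_cancel_right, h3 n m] at h2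
  linear_combination (exp := 1) h1 + h2

/-- For `n = m + 1` the middle term of the exchange relation equals the left side, leaving twice the
claim. -/
theorem creation_creation_succ (m : ℤ) (f : Sym) :
    creation m (creation (m + 1) f) = t • creation (m + 1) (creation m f) := by
  have h := creation_creation m (m + 1) f
  rw [add_sub_cancel_right] at h
  apply natCast_mul_cancel (k := 2) two_ne_zero
  push_cast
  linear_combination (exp := 1) h

/-- Adding the letter `1` to the argument. -/
def addOne : Sym →ₐ[Coef] Sym := evalAt fun i : ℕ+ => (MvPolynomial.X i : Sym) + 1

theorem map_shift_addOne (ε : Coef) (f : Sym) :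
    (shift ε f).map addOne.toRingHom = shift ε (addOne f) := by
  have : (Polynomial.mapAlgHom addOne).comp (shift ε) = (shift ε).comp addOne := by
    apply MvPolynomial.algHom_ext
    intro i
    rw [AlgHom.comp_apply, AlgHom.comp_apply, shift_X, addOne, evalAt_X, map_add, map_add,
      map_smul, shift_X, map_pow, map_one]
    simp [evalAt_X]; ring
  exact congrArg (fun φ : Sym →ₐ[Coef] Polynomial Sym => φ f) this

theorem addOne_completeInt (n : ℤ) :
    addOne (completeInt n) - addOne (completeInt (n - 1)) = completeInt n := by
  have h := evalAt_completeInt_add_sub (R := Sym) (a := fun i : ℕ+ => (MvPolynomial.X i : Sym))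
    (a' := fun i : ℕ+ => (MvPolynomial.X i : Sym) + 1) (x := 1) (y := 0) (fun i => by simp) n
  rw [evalAt_X_self, zero_mul, sub_zero, one_mul] at h
  exact h

/-- Adding the letter `1` commutes with shifts, so only the multipliers matter, and `S_n(X + 1) =
S_(n-1)(X + 1) + S_n(X)`. -/
theorem addOne_creation (m : ℤ) (f : Sym) :
    addOne (creation m f) = addOne (creation (m - 1) f) + creation m (addOne f) := by
  have h : ∀ (g : ℕ → Sym) (p : Polynomial Sym), addOne (contract g p) =
      contract (fun k => addOne (g k)) (p.map addOne.toRingHom) := by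
    intro g p
    induction p using Polynomial.induction_on' with
    | add p q hp hq => rw [Polynomial.map_add, map_add, map_add, map_add, hp, hq]
    | monomial k a =>
      rw [Polynomial.map_monomial, contract_monomial, contract_monomial, map_mul]; rfl
  have h' : ∀ (g g' : ℕ → Sym) (p : Polynomial Sym), contract g p + contract g' p =
      contract (fun k => g k + g' k) p := by
    intro g g' p
    induction p using Polynomial.induction_on' with
    | add p q hp hq => rw [map_add, map_add, map_add, ← hp, ← hq]; ring
    | monomial k a => rw [contract_monomial, contract_monomial, contract_monomial]; ring
  simp only [creation, vertex_apply, h, map_shift_addOne, h']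
  congr 2
  funext k
  have := addOne_completeInt (m + k)
  rw [show m - 1 + (k : ℤ) = m + k - 1 by ring]
  linear_combination (exp := 1) this

theorem euler_completeInt (n : ℤ) : euler (completeInt n) = (n : Coef) • completeInt n := by
  rcases lt_or_ge n 0 with hn | hn
  · rw [completeInt_of_neg hn]; simp
  · lift n to ℕ using hn
    rw [completeInt_natCast, ← scaledComplete_one, euler_scaledComplete, Int.cast_natCast]

theorem euler_creation (m : ℤ) (f : Sym) :
    euler (creation m f) = (m : Coef) • creation m f + creation m (euler f) := by
  obtain ⟨K, hK⟩ := exists_shiftCoeff_eq_zero (-1) f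
  have hK' : ∀ k, K ≤ k → shiftCoeff (-1) k (euler f) = 0 := fun k hk => by
    have := euler_shiftCoeff (-1) k f
    rw [hK k hk, map_zero, smul_zero, sub_zero] at this
    exact this.symm
  rw [creation, vertex_eq_sum _ hK, vertex_eq_sum _ hK', map_sum, Finset.smul_sum,
    ← Finset.sum_add_distrib]
  refine Finset.sum_congr rfl fun k _ => ?_
  rw [Derivation.leibniz, euler_completeInt, euler_shiftCoeff]
  simp only [smul_eq_mul, mul_sub, mul_smul_comm, Int.cast_add, add_smul, Int.cast_natCast, add_mul,
    smul_mul_assoc, mul_comm (shiftCoeff (-1) k f)]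
  abel

/-- The shift inside `creation` is opposite to the one producing the coefficients, so grouping the
double sum by total degree leaves only degree `0`. A multiplication thus becomes a sum of single
creation operators, which is what controls the length. -/
theorem completeInt_mul {f : Sym} {K : ℕ} (hK : ∀ k, K ≤ k → shiftCoeff 1 k f = 0) (m : ℤ) :
    completeInt m * f = ∑ k ∈ Finset.range K, creation (m + k) (shiftCoeff 1 k f) := by
  obtain ⟨L, hL⟩ := exists_shiftCoeff_eq_zero (-1) f
  have h1 : ∀ k : ℕ, creation (m + k) (shiftCoeff 1 k f) = ∑ l ∈ Finset.range L,
      completeInt (m + (k + l : ℕ)) * shiftCoeff 1 k (shiftCoeff (-1) l f) := by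
    intro k
    rw [creation, vertex_eq_sum (K := L)]
    · refine Finset.sum_congr rfl fun l _ => ?_
      rw [shiftCoeff_comm]; push_cast; rw [add_assoc]
    · intro l hl; rw [shiftCoeff_comm, hL l hl, map_zero]
  simp only [h1]
  rw [← Finset.sum_product']
  have h2 : ∑ n ∈ Finset.range (K + L), completeInt (m + n) *
      ∑ p ∈ Finset.HasAntidiagonal.antidiagonal n, shiftCoeff 1 p.1 (shiftCoeff (-1) p.2 f) =
      completeInt m * f := by
    simp only [sum_shiftCoeff_one_neg_one]
    rw [Finset.sum_eq_single 0]
    · simp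
    · intro n _ hn; simp [hn]
    -- An empty range forces `K = 0`; then `f`, which is its own coefficient of `w^0`, vanishes.
    · intro h0
      have : K = 0 := by simp at h0; omega
      have := hK 0 (by omega)
      rw [shiftCoeff_zero] at this
      simp [this]
  rw [← h2]
  simp only [Finset.mul_sum]
  rw [Finset.sum_sigma']
  -- Triangle and rectangle of indices differ only by pairs with `k ≥ K` or `l ≥ L`, whose terms
  -- vanish.
  refine Finset.sum_bij_ne_zero (fun (p : Σ _ : ℕ, ℕ × ℕ) _ _ => p.2) ?_ ?_ ?_ ?_
  · rintro ⟨n, k, l⟩ hp h0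
    have hp := Finset.mem_sigma.mp hp
    simp only [Finset.HasAntidiagonal.mem_antidiagonal] at hp
    rw [Finset.mem_product, Finset.mem_range, Finset.mem_range]
    constructor
    · by_contra! hc
      exact h0 (by rw [shiftCoeff_comm, hK _ hc, map_zero, mul_zero])
    · by_contra! hc
      exact h0 (by rw [hL _ hc, map_zero, mul_zero])
  · rintro ⟨n, k, l⟩ hp h0 ⟨n', k', l'⟩ hp' h0' h
    have hp := (Finset.mem_sigma.mp hp).2
    have hp' := (Finset.mem_sigma.mp hp').2
    simp only [Finset.HasAntidiagonal.mem_antidiagonal] at hp hp'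
    simp only [Prod.mk.injEq] at h
    obtain ⟨rfl, rfl⟩ := h
    subst hp; subst hp'; rfl
  · rintro ⟨k, l⟩ hp h0
    rw [Finset.mem_product, Finset.mem_range, Finset.mem_range] at hp
    refine ⟨⟨k + l, k, l⟩, ?_, h0, rfl⟩
    rw [Finset.mem_sigma]
    simp only [Finset.HasAntidiagonal.mem_antidiagonal, Finset.mem_range, and_true]
    have h1 := hp.1; have h2 := hp.2
    simp only at h1 h2
    omega
  · rintro ⟨n, k, l⟩ hp h0
    have hp := (Finset.mem_sigma.mp hp).2
    simp only [Finset.HasAntidiagonal.mem_antidiagonal] at hp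
    subst hp; rfl

/-- The shift acts on each multiplier `S_(n+l)` through `shift_one_completeInt`, and commutes with
the shift inside `creation`. -/
theorem shiftCoeff_one_creation (k : ℕ) (n : ℤ) (f : Sym) :
    shiftCoeff 1 (k + 1) (creation n f) = shiftCoeff 1 k (creation (n - 1) f) +
      creation n (shiftCoeff 1 (k + 1) f) - t • creation (n - 1) (shiftCoeff 1 k f) := by
  obtain ⟨K, hK⟩ := exists_shiftCoeff_eq_zero (-1) f
  have hK' : ∀ j k, K ≤ k → shiftCoeff (-1) k (shiftCoeff 1 j f) = 0 := fun j k hk => by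
    rw [shiftCoeff_comm, hK k hk, map_zero]
  simp only [creation]
  rw [vertex_eq_sum _ hK, vertex_eq_sum _ hK, vertex_eq_sum _ (hK' _), vertex_eq_sum _ (hK' _),
    map_sum, map_sum, Finset.smul_sum, ← Finset.sum_add_distrib, ← Finset.sum_sub_distrib]
  refine Finset.sum_congr rfl fun l _ => ?_
  have h := congrArg (fun p => (p * shift 1 (shiftCoeff (-1) l f)).coeff (k + 1))
    (shift_one_completeInt (n + l))
  simp only [one_smul, add_mul, mul_assoc, smul_mul_assoc, Polynomial.coeff_add,
    Polynomial.coeff_X_mul, Polynomial.coeff_C_mul, Polynomial.coeff_smul] at h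
  rw [shiftCoeff_comm (-1) 1, shiftCoeff_comm (-1) 1, shiftCoeff_apply 1, shiftCoeff_apply 1,
    shiftCoeff_apply 1, shiftCoeff_apply 1, map_mul, map_mul,
    show n - 1 + (l : ℤ) = n + l - 1 by ring]
  linear_combination (exp := 1) h

/-! ### Exchange relations of annihilation and creation operators. -/

theorem sum_complete_mul_scaledComplete (n : ℕ) :
    ∑ p ∈ Finset.HasAntidiagonal.antidiagonal n, complete p.1 * scaledComplete (-1) p.2 =
      if n = 0 then 1 else 0 := by
  rw [← sum_complete_mul_neg (fun i : ℕ+ => (MvPolynomial.X i : Sym)) n, evalAt_X_self]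
  refine Finset.sum_congr rfl fun p _ => ?_
  congr 1
  unfold scaledComplete
  congr 2
  funext i; simp

/-- This is `σ(X) σ(-X) = 1`; terms outside `p ≤ j ≤ q` vanish, so any large enough interval may be
used. -/
theorem sum_completeInt_mul_negComplete {p q m₀ m₁ : ℤ} (h₀ : m₀ ≤ p) (h₁ : q < m₁) :
    ∑ j ∈ Finset.Ico m₀ m₁, completeInt (j - p) * negComplete (q - j) =
      if p = q then 1 else 0 := by
  rcases lt_or_ge q p with h | h
  · rw [if_neg (by omega)]
    refine Finset.sum_eq_zero fun j _ => ?_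
    rcases lt_or_ge j p with hj | hj
    · rw [completeInt_of_neg (by omega), zero_mul]
    · rw [negComplete_of_neg (by omega), mul_zero]
  · obtain ⟨n, hn⟩ := Int.eq_ofNat_of_zero_le (sub_nonneg.mpr h)
    have e : (if p = q then 1 else 0 : Sym) = if n = 0 then 1 else 0 := by
      congr 1; apply propext; omega
    rw [e, ← sum_complete_mul_scaledComplete]
    symm
    refine Finset.sum_of_injOn (fun a => p + a.1) ?_ ?_ ?_ ?_
    · rintro ⟨a, b⟩ ha ⟨a', b'⟩ ha' hab
      simp only [Finset.mem_coe, Finset.HasAntidiagonal.mem_antidiagonal] at ha ha'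
      simp only [add_right_inj, Nat.cast_inj] at hab
      ext <;> simp only <;> omega
    · rintro ⟨a, b⟩ ha
      simp only [Finset.mem_coe, Finset.HasAntidiagonal.mem_antidiagonal] at ha
      simp only [Finset.coe_Ico, Set.mem_Ico]
      omega
    · intro j _ hj
      rcases lt_or_ge j p with hjp | hjp
      · rw [completeInt_of_neg (by omega), zero_mul]
      · rcases lt_or_ge q j with hjq | hjq
        · rw [negComplete_of_neg (by omega), mul_zero]
        · refine absurd ⟨((j - p).toNat, (q - j).toNat), ?_, ?_⟩ hj
          · simp only [Finset.mem_coe, Finset.HasAntidiagonal.mem_antidiagonal]; omega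
          · simp only; omega
    · rintro ⟨a, b⟩ ha
      rw [Finset.HasAntidiagonal.mem_antidiagonal] at ha
      simp only at ha ⊢
      rw [show p + (a : ℤ) - p = a by ring, show q - (p + (a : ℤ)) = b by omega,
        completeInt_natCast, negComplete_natCast]

/-- The normally ordered product of an annihilation and a creation operator. -/
def normalAB (m n : ℤ) (f : Sym) : Sym :=
  nested (fun k => negComplete (k - m)) 1 (fun k => completeInt (n + k)) (-1) f

/-- Here and in the next lemma the factor is `(1 - tu) / (1 - u)`, so the left sides are differences
along the diagonal `(j, j - d)` and can be telescoped, in opposite directions for the two orders of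
the operators. -/
theorem annihilation_creation_sub (m n : ℤ) (f : Sym) :
    annihilation m (creation n f) - annihilation (m - 1) (creation (n - 1) f) =
      normalAB m n f - t • normalAB (m - 1) (n - 1) f := by
  have h := vertex_vertex_sub (fun k => negComplete (k - m)) 1 (fun k => completeInt (n + k))
    (fun k => completeInt (n - 1 + k)) (-1) 1 t (fun l => by
      rw [show n - 1 + (l : ℤ) = n + l - 1 by ring]; exact shift_one_completeInt _) f
  have e : (fun k : ℕ => negComplete ((k + 1 : ℕ) - m)) = fun k : ℕ => negComplete (k - (m - 1)) := by
    funext k; congr 1; push_cast; ring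
  rw [one_smul, e] at h
  exact h

theorem creation_annihilation_sub (m n : ℤ) (f : Sym) :
    creation n (annihilation m f) - creation (n + 1) (annihilation (m + 1) f) =
      normalAB m n f - t • normalAB (m + 1) (n + 1) f := by
  have h := vertex_vertex_sub (fun k => completeInt (n + k)) (-1) (fun k => negComplete (k - m))
    (fun k => negComplete (k - (m + 1))) 1 1 t (fun l => by
      rw [show (l : ℤ) - (m + 1) = l - m - 1 by ring]; exact shift_neg_one_negComplete _) f
  have e : (fun k : ℕ => completeInt (n + (k + 1 : ℕ))) = fun k : ℕ => completeInt (n + 1 + k) := by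
    funext k; congr 1; push_cast; ring
  rw [one_smul, e, nested_comm, nested_comm (fun k : ℕ => completeInt (n + 1 + k))] at h
  exact h

/-- On a fixed `f` the diagonal of normally ordered products has finite support. Its total over `j`
pairs `S(X)` with `S(-X)`, which forces `k + l = d`, and then the two opposite shifts cancel unless
`d = 0`. -/
theorem exists_normalAB (d : ℕ) (f : Sym) : ∃ M₀ M₁ : ℤ,
    (∀ j ≤ M₀, normalAB j (j - d) f = 0) ∧ (∀ j ≥ M₁, normalAB j (j - d) f = 0) ∧
    (∀ j ≤ M₀, creation (j - d) f = 0) ∧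
    ∀ m₀ ≤ M₀, ∀ m₁ ≥ M₁, ∑ j ∈ Finset.Ico m₀ m₁, normalAB j (j - d) f =
      if d = 0 then f else 0 := by
  obtain ⟨K, hK, hK', -⟩ := exists_shiftCoeff_shiftCoeff_eq_zero 1 (-1) f
  have hN : ∀ j : ℤ, normalAB j (j - d) f = ∑ l ∈ Finset.range K, ∑ k ∈ Finset.range K,
      completeInt (j - d + l) * negComplete (k - j) * shiftCoeff 1 k (shiftCoeff (-1) l f) :=
    fun j => nested_eq_sum_sum _ _ hK hK'
  refine ⟨d - K, K, fun j hj => ?_, fun j hj => ?_, fun j hj => ?_, fun m₀ h₀ m₁ h₁ => ?_⟩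
  · rw [hN]
    refine Finset.sum_eq_zero fun l hl => Finset.sum_eq_zero fun k _ => ?_
    have := Finset.mem_range.mp hl
    rw [completeInt_of_neg (by omega), zero_mul, zero_mul]
  · rw [hN]
    refine Finset.sum_eq_zero fun l _ => Finset.sum_eq_zero fun k hk => ?_
    have := Finset.mem_range.mp hk
    rw [negComplete_of_neg (by omega), mul_zero, zero_mul]
  · rw [creation, vertex_eq_sum _ hK']
    refine Finset.sum_eq_zero fun l hl => ?_
    have := Finset.mem_range.mp hl
    rw [completeInt_of_neg (by omega), zero_mul]
  · simp only [hN]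
    rw [Finset.sum_comm, ← sum_shiftCoeff_one_neg_one d f]
    have h1 : ∀ l ∈ Finset.range K, ∑ j ∈ Finset.Ico m₀ m₁, ∑ k ∈ Finset.range K,
        completeInt (j - d + l) * negComplete (k - j) * shiftCoeff 1 k (shiftCoeff (-1) l f) =
        ∑ k ∈ Finset.range K, if k + l = d then shiftCoeff 1 k (shiftCoeff (-1) l f) else 0 := by
      intro l hl
      rw [Finset.sum_comm]
      refine Finset.sum_congr rfl fun k hk => ?_
      have := Finset.mem_range.mp hk
      have := Finset.mem_range.mp hl
      have h2 := sum_completeInt_mul_negComplete (p := d - l) (q := k) (m₀ := m₀) (m₁ := m₁)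
        (by omega) (by omega)
      rw [← Finset.sum_mul]
      simp only [show ∀ j : ℤ, j - d + l = j - (d - l) by intro j; ring]
      rw [h2, ite_mul, one_mul, zero_mul]
      congr 1; apply propext; omega
    rw [Finset.sum_congr rfl h1, Finset.sum_comm, ← Finset.sum_product', ← Finset.sum_filter]
    refine Finset.sum_subset_zero_on_sdiff (fun p hp => ?_) (fun p hp => ?_) fun _ _ => rfl
    · rw [Finset.HasAntidiagonal.mem_antidiagonal]; exact (Finset.mem_filter.mp hp).2
    · rw [Finset.mem_sdiff, Finset.HasAntidiagonal.mem_antidiagonal] at hp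
      have hp2 := hp.2
      simp only [Finset.mem_filter, Finset.mem_product, Finset.mem_range, hp.1, and_true] at hp2
      rcases lt_or_ge p.1 K with h | h
      · rw [hK' _ (by omega), map_zero]
      · rw [shiftCoeff_comm, hK _ h, map_zero]

/-- Evaluation of `B*_m B_(m - d)` on a vector killed by `B_(j - d) B*_j` for all `j > m`. -/
theorem annihilation_creation (d : ℕ) (m : ℤ) (f : Sym)
    (h : ∀ j, m < j → creation (j - d) (annihilation j f) = 0) :
    annihilation m (creation (m - d) f) =
      (1 - t) • (if d = 0 then f else 0) + t • creation (m - d) (annihilation m f) := by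
  obtain ⟨M₀, M₁, hlow, hhigh, hB, hsum⟩ := exists_normalAB d f
  have hC : ∀ j : ℤ, creation (j - d) (annihilation j f) -
      creation (j + 1 - d) (annihilation (j + 1) f) =
      normalAB j (j - d) f - t • normalAB (j + 1) (j + 1 - d) f := fun j => by
    have := creation_annihilation_sub j (j - d) f
    rwa [show j - (d : ℤ) + 1 = j + 1 - d by ring] at this
  have hA : ∀ j : ℤ, annihilation (j + 1) (creation (j + 1 - d) f) -
      annihilation j (creation (j - d) f) =
      normalAB (j + 1) (j + 1 - d) f - t • normalAB j (j - d) f := fun j => by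
    have := annihilation_creation_sub (j + 1) (j + 1 - d) f
    rwa [show j + 1 - (d : ℤ) - 1 = j - d by ring, add_sub_cancel_right] at this
  -- By `h` the relation `hC` reads `N_j = t N_(j+1)` for `j > m`, with `N_j` the diagonal term; it
  -- vanishes for large `j`, hence for all `j > m` by descent.
  have hN : ∀ (i : ℕ) (j : ℤ), m < j → M₁ ≤ j + i → normalAB j (j - d) f = 0 := by
    intro i
    induction i with
    | zero => intro j _ hj; exact hhigh j (by simpa using hj)
    | succ i ih =>
      intro j hmj hj
      have h1 := hC j
      rw [h j hmj, h (j + 1) (by omega), ih (j + 1) (by omega) (by push_cast at hj ⊢; omega)] at h1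
      simpa using h1.symm
  have hN' : ∀ j : ℤ, m < j → normalAB j (j - d) f = 0 := fun j hj =>
    hN (M₁ - j).toNat j hj (by omega)
  have hNm : normalAB m (m - d) f = creation (m - d) (annihilation m f) := by
    have h1 := hC m
    rw [h (m + 1) (by omega), hN' (m + 1) (by omega)] at h1
    simpa using h1.symm
  obtain ⟨m₀, hm₀, hm₀'⟩ : ∃ m₀ ≤ M₀, m₀ ≤ m := ⟨min M₀ m, min_le_left _ _, min_le_right _ _⟩
  -- Summation of `hA` upwards from an index so low that `B_(j-d) f = 0`.
  have hAsum : ∀ i : ℕ, annihilation (m₀ + i) (creation (m₀ + i - d) f) =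
      normalAB (m₀ + i) (m₀ + i - d) f +
        (1 - t) • ∑ j ∈ Finset.Ico m₀ (m₀ + i), normalAB j (j - d) f := by
    intro i
    induction i with
    | zero => simp [hB m₀ hm₀, hlow m₀ hm₀]
    | succ i ih =>
      have h1 := hA (m₀ + i)
      have h2 : Finset.Ico m₀ (m₀ + (i + 1 : ℕ)) = insert (m₀ + i : ℤ) (Finset.Ico m₀ (m₀ + i)) := by
        ext x; simp only [Finset.mem_Ico, Finset.mem_insert]; push_cast; omega
      rw [h2, Finset.sum_insert (by simp), smul_add, sub_smul, one_smul, Nat.cast_succ, ← add_assoc]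
      rw [ih] at h1
      linear_combination (exp := 1) h1
  obtain ⟨i, hi⟩ := Int.eq_ofNat_of_zero_le (sub_nonneg.mpr hm₀')
  have hmi : m₀ + (i : ℤ) = m := by omega
  have h1 := hAsum i
  rw [hmi] at h1
  -- As `N_j = 0` beyond `m`, the terms below `m` add up to the total minus `N_m`; the result `N_m +
  -- (1 - t)(total - N_m)` is the claim.
  have h2 := hsum m₀ hm₀ (max M₁ (m + 1)) (le_max_left _ _)
  have h3 : ∑ j ∈ Finset.Ico m₀ (max M₁ (m + 1)), normalAB j (j - d) f =
      normalAB m (m - d) f + ∑ j ∈ Finset.Ico m₀ m, normalAB j (j - d) f := by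
    rw [← Finset.sum_insert (f := fun j : ℤ => normalAB j (j - d) f) (by simp : m ∉ Finset.Ico m₀ m)]
    symm
    refine Finset.sum_subset (fun x => ?_) fun x _ hx => hN' x ?_
    · simp only [Finset.mem_insert, Finset.mem_Ico]; omega
    · simp only [Finset.mem_insert, Finset.mem_Ico] at *; omega
  rw [h1, ← h2, h3, hNm]
  simp only [smul_add, sub_smul, one_smul]
  abel

/-! ### The raising operator formula in terms of creation operators -/

/-- For any permutation, the rearrangement inequality bounds the sum of the indices in the rows `i ≥
k` by the tail sum `v_k + ⋯`. If that is negative, some factor has a negative index. The truncation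
in `modQVec` therefore only drops terms that are already zero. -/
theorem schur_eq_zero_of_not_tailNonneg {n : ℕ} {v : Fin n → ℤ} (hv : ¬ TailNonneg v) :
    schur v = 0 := by
  unfold TailNonneg at hv
  push Not at hv
  obtain ⟨k, hk⟩ := hv
  rw [schur, Matrix.det_apply]
  refine Finset.sum_eq_zero fun σ _ => ?_
  suffices h : ∃ i, v (σ i) + (i : ℤ) - (σ i : ℤ) < 0 by
    obtain ⟨i, hi⟩ := h
    rw [Finset.prod_eq_zero (Finset.mem_univ i), smul_zero]
    rw [Matrix.of_apply, completeInt_of_neg hi]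
  by_contra! hc
  have h1 : 0 ≤ ∑ i ∈ Finset.univ.filter (fun i => k ≤ i), (v i + ((σ.symm i : ℕ) : ℤ) - (i : ℤ)) :=
    Finset.sum_nonneg fun i _ => by simpa using hc (σ.symm i)
  have hmono : Monovary (fun i : Fin n => if k ≤ i then (1 : ℤ) else 0)
      (fun i : Fin n => ((i : ℕ) : ℤ)) := by
    intro i j hij
    have hij : i < j := by simpa using hij
    show (if k ≤ i then (1 : ℤ) else 0) ≤ if k ≤ j then 1 else 0
    split_ifs <;> omega
  have h2 := hmono.sum_mul_comp_perm_le_sum_mul (σ := σ.symm)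
  simp only [ite_mul, one_mul, zero_mul, ← Finset.sum_filter] at h2
  rw [Finset.sum_sub_distrib, Finset.sum_add_distrib] at h1
  omega

/-- The substitution `f(X) ↦ f(X + t w)`. -/
def shiftT : Sym →ₐ[Coef] Polynomial Sym :=
  evalAt fun i : ℕ+ => Polynomial.C (MvPolynomial.X i : Sym) + (t • Polynomial.X) ^ (i : ℕ)

theorem shift_neg_one_add_shiftT (n : ℤ) :
    shiftT (completeInt n) = shift (-1) (completeInt n) +
      Polynomial.X * shiftT (completeInt (n - 1)) := by
  have h := evalAt_completeInt_add (R := Polynomial Sym)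
    (a := fun i : ℕ+ => Polynomial.C (MvPolynomial.X i : Sym) + (t • Polynomial.X) ^ (i : ℕ))
    (a' := fun i : ℕ+ => Polynomial.C (MvPolynomial.X i : Sym) +
      (-1 * (1 - t ^ (i : ℕ)) : Coef) • Polynomial.X ^ (i : ℕ))
    (x := 0) (y := Polynomial.X)
    (fun i => by
      nth_rewrite 2 [← poly_one_sub_smul_add (t ^ (i : ℕ)) (Polynomial.X ^ (i : ℕ))]
      rw [smul_pow, add_assoc, ← add_assoc (_ • _), ← add_smul]
      simp) n
  rw [zero_mul, add_zero] at h
  exact h.symm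

theorem shiftT_completeInt (n : ℤ) :
    shiftT (completeInt n) = Polynomial.C (completeInt n) +
      (t • Polynomial.X) * shiftT (completeInt (n - 1)) := by
  have h := evalAt_completeInt_add (R := Polynomial Sym)
    (a := fun i : ℕ+ => Polynomial.C (MvPolynomial.X i : Sym))
    (a' := fun i : ℕ+ => Polynomial.C (MvPolynomial.X i : Sym) + (t • Polynomial.X) ^ (i : ℕ))
    (x := t • Polynomial.X) (y := 0) (fun i => by simp) n
  rw [evalAt_C_X, evalAt_C_X, zero_mul, add_zero] at h
  exact h

theorem eq_sum_of_eq_add_mul {R : Type*} [CommRing R] {g c : ℤ → R} {x : R}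
    (hg : ∀ n, g n = c n + x * g (n - 1)) (hneg : ∀ n < 0, g n = 0) {n : ℤ} {N : ℕ} (h : n < N) :
    g n = ∑ a ∈ Finset.range N, x ^ a * c (n - a) := by
  induction N generalizing n with
  | zero => rw [hneg n (by simpa using h)]; simp
  | succ N ih =>
    rw [hg, ih (n := n - 1) (by push_cast at h ⊢; omega), Finset.sum_range_succ', Finset.mul_sum,
      add_comm]
    congr 1
    · refine Finset.sum_congr rfl fun a _ => ?_
      rw [← mul_assoc, ← pow_succ']
      push_cast
      rw [sub_sub, add_comm (1 : ℤ)]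
    · simp

/-- Border the `r × (r + 1)` array `G` by the row `1, x, x², …`. Subtracting `x` times the preceding
column from each column leaves `F` below the first row `1, 0, …, 0`; expanding the original matrix
along its first row gives the sum. The sign `e = -1` is kept abstract so that it can be
`Polynomial.C (-1)`. -/
theorem det_of_eq_add_mul {R : Type*} [CommRing R] {r : ℕ} {F G : Fin r → ℕ → R} {x e : R}
    (he : e + 1 = 0) (h : ∀ i j, G i (j + 1) = F i j + x * G i j) :
    Matrix.det (Matrix.of fun i j : Fin r => F i j) = ∑ j : Fin (r + 1),
      x ^ (j : ℕ) * (e ^ (j : ℕ) * Matrix.det (Matrix.of fun i j' : Fin r => G i (j.succAbove j'))) := by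
  obtain rfl : e = -1 := eq_neg_of_add_eq_zero_left he
  let A : Matrix (Fin (r + 1)) (Fin (r + 1)) R := Matrix.of fun i j =>
    Fin.cases (x ^ (j : ℕ)) (fun i' => G i' j) i
  let B : Matrix (Fin (r + 1)) (Fin (r + 1)) R := Matrix.of fun i j =>
    Fin.cases (A i 0) (fun j' : Fin r => Fin.cases 0 (fun i' : Fin r => F i' j') i) j
  have hAB : A.det = B.det := by
    refine Matrix.det_eq_of_forall_col_eq_smul_add_pred (fun _ => x) (fun _ => rfl) ?_
    intro i j
    refine Fin.cases ?_ (fun i' => ?_) i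
    · simp [A, B, pow_succ']
    · simpa [A, B] using h i' j
  have hB : B.det = Matrix.det (Matrix.of fun i j : Fin r => F i j) := by
    rw [Matrix.det_succ_row_zero, Fin.sum_univ_succ, Finset.sum_eq_zero]
    · have : B 0 0 = 1 := by simp [B, A]
      rw [this]
      simp only [Fin.val_zero, pow_zero, one_mul, add_zero]
      congr 1
    · intro j _
      have : B 0 j.succ = 0 := by simp [B]
      rw [this]; simp
  rw [← hB, ← hAB, Matrix.det_succ_row_zero]
  refine Finset.sum_congr rfl fun j _ => ?_
  rw [mul_comm ((-1) ^ (j : ℕ)), mul_assoc]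
  congr 1

theorem det_sum_mul {R ι : Type*} [CommRing R] {r : ℕ} (s : Finset ι) (x : ι → R)
    (c : Fin r → Fin r → ι → R) :
    Matrix.det (Matrix.of fun i j => ∑ a ∈ s, x a * c i j a) =
      ∑ a ∈ Fintype.piFinset fun _ : Fin r => s,
        (∏ i, x (a i)) * Matrix.det (Matrix.of fun i j => c i j (a i)) := by
  classical
  have h1 : (Matrix.of fun i j => ∑ a ∈ s, x a * c i j a) =
      fun i => ∑ a ∈ s, x a • fun j => c i j a := by
    funext i j
    rw [Matrix.of_apply, Finset.sum_apply]
    rfl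
  have h2 : ∀ M : Matrix (Fin r) (Fin r) R,
      M.det = (Matrix.detRowAlternating (n := Fin r) (R := R)).toMultilinearMap M := fun _ => rfl
  rw [h2, h1, MultilinearMap.map_sum_finset]
  refine Finset.sum_congr rfl fun a _ => ?_
  rw [MultilinearMap.map_smul_univ]
  rfl

theorem contract_X_pow_mul (g : ℕ → Sym) (k : ℕ) (p : Polynomial Sym) :
    contract g (Polynomial.X ^ k * p) = contract (fun i => g (i + k)) p := by
  induction k generalizing g with
  | zero => simp
  | succ k ih =>
    rw [pow_succ', mul_assoc, contract_X_mul, ih]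
    congr 2

theorem contract_smul_X_pow_mul_C (g : ℕ → Sym) (k : ℕ) (d : Sym) :
    contract g ((t • Polynomial.X) ^ k * Polynomial.C d) = t ^ k • (d * g k) := by
  have h1 : contract (fun i => g (i + k)) (1 : Polynomial Sym) = g k := by
    rw [← Polynomial.monomial_zero_one, contract_monomial, zero_add, mul_one]
  rw [smul_pow, smul_mul_assoc, contract_smul, contract_X_pow_mul, ← mul_one (Polynomial.C d),
    contract_C_mul, h1]

theorem algHom_det {S : Type*} [CommRing S] [Algebra Coef S] (φ : Sym →ₐ[Coef] S) {r : ℕ}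
    (M : Fin r → Fin r → Sym) :
    φ (Matrix.det (Matrix.of M)) = Matrix.det (Matrix.of fun i j => φ (M i j)) :=
  RingHom.map_det φ.toRingHom (Matrix.of M)

theorem shift_det (ε : Coef) {r : ℕ} (M : Fin r → Fin r → Sym) :
    shift ε (Matrix.det (Matrix.of M)) = Matrix.det (Matrix.of fun i j => shift ε (M i j)) :=
  algHom_det (S := Polynomial Sym) (evalAt _) M

theorem C_det {r : ℕ} (M : Fin r → Fin r → Sym) :
    Matrix.det (Matrix.of fun i j => Polynomial.C (M i j)) =
      Polynomial.C (Matrix.det (Matrix.of M)) :=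
  (RingHom.map_det Polynomial.C (Matrix.of M)).symm

theorem shift_neg_one_schur {r : ℕ} (v : Fin r → ℤ) :
    shift (-1) (schur v) = ∑ j : Fin (r + 1), Polynomial.X ^ (j : ℕ) *
      (Polynomial.C (-1) ^ (j : ℕ) * Matrix.det (Matrix.of fun i j' : Fin r =>
        shiftT (completeInt (v i + (j.succAbove j' : ℕ) - (i + 1 : ℤ))))) := by
  rw [schur, shift_det]
  refine det_of_eq_add_mul
    (F := fun (i : Fin r) (j : ℕ) => shift (-1) (completeInt (v i + (j : ℤ) - (i : ℤ))))
    (G := fun (i : Fin r) (j : ℕ) => shiftT (completeInt (v i + (j : ℤ) - (i + 1 : ℤ)))) ?_ ?_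
  · rw [← Polynomial.C_1, ← Polynomial.C_add, neg_add_cancel, Polynomial.C_0]
  · intro i j
    rw [show v i + ((j + 1 : ℕ) : ℤ) - (i + 1 : ℤ) = v i + j - i by push_cast; ring,
      show v i + (j : ℤ) - (i + 1 : ℤ) = v i + j - i - 1 by ring]
    exact shift_neg_one_add_shiftT _

theorem det_shiftT {r N : ℕ} (c : Fin r → Fin r → ℤ) (hN : ∀ i j, c i j < N) :
    Matrix.det (Matrix.of fun i j => shiftT (completeInt (c i j))) =
      ∑ a ∈ Fintype.piFinset fun _ : Fin r => Finset.range N,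
        (t • Polynomial.X) ^ (∑ i, a i) *
          Polynomial.C (Matrix.det (Matrix.of fun i j => completeInt (c i j - a i))) := by
  have h1 : ∀ i j, shiftT (completeInt (c i j)) = ∑ a ∈ Finset.range N,
      (t • Polynomial.X) ^ a * Polynomial.C (completeInt (c i j - a)) := fun i j =>
    eq_sum_of_eq_add_mul (g := fun n => shiftT (completeInt n))
      (c := fun n => Polynomial.C (completeInt n)) shiftT_completeInt
      (fun n hn => by rw [completeInt_of_neg hn, map_zero]) (hN i j)
  simp only [h1]
  rw [det_sum_mul (Finset.range N) (fun a => (t • Polynomial.X : Polynomial Sym) ^ a)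
    (fun i j a => Polynomial.C (completeInt (c i j - a)))]
  refine Finset.sum_congr rfl fun a _ => ?_
  rw [Finset.prod_pow_eq_pow_sum, C_det (fun i j => completeInt (c i j - a i))]

theorem contract_det_shiftT {r N : ℕ} (g : ℕ → Sym) (k : ℕ) (c : Fin r → Fin r → ℤ)
    (hN : ∀ i j, c i j < N) :
    contract g (Polynomial.X ^ k * (Polynomial.C (-1) ^ k *
      Matrix.det (Matrix.of fun i j => shiftT (completeInt (c i j))))) =
      ∑ a ∈ Fintype.piFinset fun _ : Fin r => Finset.range N, t ^ (∑ i, a i) •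
        ((-1) ^ k * g (∑ i, a i + k) *
          Matrix.det (Matrix.of fun i j => completeInt (c i j - a i))) := by
  rw [det_shiftT c hN, ← Polynomial.C_pow, contract_X_pow_mul, contract_C_mul, map_sum,
    Finset.mul_sum]
  refine Finset.sum_congr rfl fun a _ => ?_
  rw [contract_smul_X_pow_mul_C, mul_smul_comm]
  congr 1
  ring

theorem schur_cons {r : ℕ} (m : ℤ) (v : Fin r → ℤ) :
    schur (Fin.cons m v : Fin (r + 1) → ℤ) = ∑ j : Fin (r + 1), (-1) ^ (j : ℕ) *
      completeInt (m + (j : ℕ)) * Matrix.det (Matrix.of fun i j' : Fin r =>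
        completeInt (v i + (j.succAbove j' : ℕ) - (i + 1 : ℤ))) := by
  rw [schur, Matrix.det_succ_row_zero]
  refine Finset.sum_congr rfl fun j _ => ?_
  congr 2
  simp

/-- The argument is `X + tw - w`. Removing `w` yields the cofactors of a new first row; adding `tw`
lowers each `v i` by some `a i` at the price `(tw)^(a i)`, and `w^k` becomes `S_(m+k)` in that row.
Lowering by `N` or more would only give negative indices. -/
theorem creation_schur {r N : ℕ} (m : ℤ) (v : Fin r → ℤ) (hN : ∀ i, v i + r < N) :
    creation m (schur v) = ∑ a ∈ Fintype.piFinset fun _ : Fin r => Finset.range N,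
      t ^ (∑ i, a i) • schur (Fin.cons (m + (∑ i, a i : ℕ)) (fun i => v i - a i) :
        Fin (r + 1) → ℤ) := by
  have h1 : ∀ j : Fin (r + 1), contract (fun k => completeInt (m + k)) (Polynomial.X ^ (j : ℕ) *
      (Polynomial.C (-1) ^ (j : ℕ) * Matrix.det (Matrix.of fun i j' : Fin r =>
        shiftT (completeInt (v i + (j.succAbove j' : ℕ) - (i + 1 : ℤ)))))) =
      ∑ a ∈ Fintype.piFinset fun _ : Fin r => Finset.range N, t ^ (∑ i, a i) •
        ((-1) ^ (j : ℕ) * completeInt (m + (∑ i, a i + (j : ℕ) : ℕ)) * Matrix.det (Matrix.of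
          fun i j' : Fin r => completeInt (v i + (j.succAbove j' : ℕ) - (i + 1 : ℤ) - a i))) :=
    fun j => contract_det_shiftT _ _
      (fun i j' : Fin r => v i + (j.succAbove j' : ℕ) - (i + 1 : ℤ)) fun i j' => by
        have := hN i
        have := (j.succAbove j').isLt
        omega
  rw [creation, vertex_apply, shift_neg_one_schur, map_sum, Finset.sum_congr rfl fun j _ => h1 j,
    Finset.sum_comm]
  refine Finset.sum_congr rfl fun a _ => ?_
  rw [schur_cons, Finset.smul_sum]
  refine Finset.sum_congr rfl fun j _ => ?_
  have e1 : m + ((∑ i, a i + (j : ℕ) : ℕ) : ℤ) = m + (∑ i, a i : ℕ) + (j : ℕ) := by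
    push_cast; ring
  have e2 : ∀ i j' : Fin r, v i + (j.succAbove j' : ℕ) - (i + 1 : ℤ) - a i =
      v i - a i + (j.succAbove j' : ℕ) - (i + 1 : ℤ) := fun i j' => by ring
  simp only [e1, e2]

/-- The pairs of indices in `{0, …, r}`, according to whether `0` is one of them. -/
def pairsSucc (r : ℕ) : Fin r ⊕ Pairs r ≃ Pairs (r + 1) :=
  Equiv.ofBijective (Sum.elim (fun j => ⟨(0, j.succ), Fin.succ_pos j⟩)
    fun q => ⟨(q.1.1.succ, q.1.2.succ), Fin.succ_lt_succ_iff.mpr q.2⟩) <| by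
  constructor
  · rintro (j | ⟨⟨p, q⟩, h⟩) (j' | ⟨⟨p', q'⟩, h'⟩) e
    · simpa using e
    · exact absurd (congrArg (fun x => x.1.1) e) (Fin.succ_ne_zero p').symm
    · exact absurd (congrArg (fun x => x.1.1) e) (Fin.succ_ne_zero p)
    · simpa using e
  · rintro ⟨⟨p, q⟩, h⟩
    obtain ⟨q, rfl⟩ := Fin.exists_succ_eq.mpr (Fin.ne_zero_of_lt h)
    rcases Fin.eq_zero_or_eq_succ p with rfl | ⟨p, rfl⟩
    · exact ⟨Sum.inl q, rfl⟩
    · exact ⟨Sum.inr ⟨(p, q), Fin.succ_lt_succ_iff.mp h⟩, rfl⟩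

theorem sum_pairs_succ {r : ℕ} {M : Type*} [AddCommMonoid M] (F : Pairs (r + 1) → M) :
    ∑ p, F p = ∑ j, F (pairsSucc r (Sum.inl j)) + ∑ q, F (pairsSucc r (Sum.inr q)) := by
  rw [← Equiv.sum_comp (pairsSucc r), Fintype.sum_sum_type]

theorem raise_cons {r : ℕ} (m : ℤ) (u : Fin r → ℤ) (a : Fin r → ℕ) (b : Pairs r → ℕ) :
    raise (Fin.cons m u : Fin (r + 1) → ℤ) (Sum.elim a b ∘ (pairsSucc r).symm) =
      (Fin.cons (m + (∑ i, a i : ℕ)) (fun i => raise u b i - a i) : Fin (r + 1) → ℤ) := by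
  funext k
  have hl : ∀ j, (pairsSucc r (Sum.inl j)).1 = (0, j.succ) := fun _ => rfl
  have hr : ∀ q, (pairsSucc r (Sum.inr q)).1 = (q.1.1.succ, q.1.2.succ) := fun _ => rfl
  rw [raise, sum_pairs_succ]
  simp only [Function.comp_apply, Equiv.symm_apply_apply, Sum.elim_inl, Sum.elim_inr, hl, hr]
  refine Fin.cases ?_ (fun k => ?_) k
  · simp [Fin.succ_ne_zero]
  · simp only [Fin.cons_succ, (Fin.succ_ne_zero k).symm, Fin.succ_inj, raise, if_false, zero_sub,
      mul_neg, Finset.sum_neg_distrib, mul_ite, mul_one, mul_zero, Finset.sum_ite_eq',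
      Finset.mem_univ, if_true]
    ring

/-- Terms outside the truncation vanish, so the sum may run over any larger finite set, in
particular a box. -/
theorem modQVec_eq_sum {n : ℕ} (u : Fin n → ℤ) {S : Finset (Pairs n → ℕ)}
    (hS : ∀ a, TailNonneg (raise u a) → a ∈ S) :
    modQVec u = ∑ a ∈ S, t ^ (∑ p, a p) • schur (raise u a) := by
  refine Finset.sum_subset (fun a ha => hS a ?_) fun a _ ha => ?_
  · simpa using ha
  · rw [schur_eq_zero_of_not_tailNonneg, smul_zero]
    simpa using ha

theorem exists_tailNonneg_raise_bound {n : ℕ} (u : Fin n → ℤ) :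
    ∃ N : ℕ, ∀ a, TailNonneg (raise u a) → ∀ p, a p < N := by
  let S := (finite_tailNonneg_raise u).toFinset
  refine ⟨∑ a ∈ S, ∑ p, a p + 1, fun a ha p => Nat.lt_succ_of_le ?_⟩
  calc a p ≤ ∑ p, a p := Finset.single_le_sum (fun _ _ => Nat.zero_le _) (Finset.mem_univ p)
    _ ≤ _ := Finset.single_le_sum (f := fun a : Pairs n → ℕ => ∑ p, a p)
      (fun _ _ => Nat.zero_le _) (by simpa [S] using ha)

/-- The pairs `i < j` split into those avoiding the index `0`, which build `modQVec u`, and the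
pairs `(0, j)`, whose raising operators are performed by `creation m` through `creation_schur`. -/
theorem modQVec_cons {r : ℕ} (m : ℤ) (u : Fin r → ℤ) :
    modQVec (Fin.cons m u : Fin (r + 1) → ℤ) = creation m (modQVec u) := by
  obtain ⟨N₁, h₁⟩ := exists_tailNonneg_raise_bound u
  obtain ⟨N₂, h₂⟩ := exists_tailNonneg_raise_bound (Fin.cons m u : Fin (r + 1) → ℤ)
  let S : Finset (Pairs r → ℕ) := Fintype.piFinset fun _ => Finset.range (max N₁ N₂)
  -- Bound needed by `creation_schur`, uniform over the families in `S`; in `T` it is joined to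
  -- `N₂`, so that the product box also contains every family surviving truncation for the longer
  -- vector.
  let M : ℕ := ∑ b ∈ S, ∑ i, (raise u b i + r).toNat + 1
  have hM : ∀ b ∈ S, ∀ i, raise u b i + r < M := by
    intro b hb i
    have e1 : (raise u b i + r).toNat ≤ ∑ i, (raise u b i + r).toNat :=
      Finset.single_le_sum (f := fun i => (raise u b i + r).toNat) (fun _ _ => Nat.zero_le _)
        (Finset.mem_univ i)
    have e2 : ∑ i, (raise u b i + r).toNat ≤ ∑ b ∈ S, ∑ i, (raise u b i + r).toNat :=
      Finset.single_le_sum (f := fun b => ∑ i, (raise u b i + r).toNat) (fun _ _ => Nat.zero_le _)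
        hb
    have : M = ∑ b ∈ S, ∑ i, (raise u b i + r).toNat + 1 := rfl
    omega
  let T : Finset (Fin r → ℕ) := Fintype.piFinset fun _ => Finset.range (max M N₂)
  have hcr : creation m (modQVec u) = ∑ b ∈ S, ∑ a ∈ T, t ^ (∑ p, b p) • t ^ (∑ i, a i) •
      schur (Fin.cons (m + (∑ i, a i : ℕ)) (fun i => raise u b i - a i) : Fin (r + 1) → ℤ) := by
    rw [modQVec_eq_sum u (S := S), map_sum]
    · refine Finset.sum_congr rfl fun b hb => ?_
      rw [map_smul, creation_schur m _ (N := max M N₂), Finset.smul_sum]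
      intro i
      exact (hM b hb i).trans_le (by exact_mod_cast le_max_left _ _)
    · intro b hb
      simpa [S] using fun p q hpq => Or.inl (h₁ b hb ⟨(p, q), hpq⟩)
  let E : (Pairs r → ℕ) × (Fin r → ℕ) ↪ (Pairs (r + 1) → ℕ) :=
    ⟨fun x => Sum.elim x.2 x.1 ∘ (pairsSucc r).symm, fun x y hxy => by
      have h := ((pairsSucc r).symm.surjective.injective_comp_right) hxy
      have h1 : x.2 = y.2 := by
        funext j; exact congrFun h (Sum.inl j)
      have h2 : x.1 = y.1 := by
        funext j; exact congrFun h (Sum.inr j)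
      exact Prod.ext h2 h1⟩
  rw [hcr, modQVec_eq_sum _ (S := (S ×ˢ T).map E), Finset.sum_map, Finset.sum_product]
  · refine Finset.sum_congr rfl fun b _ => Finset.sum_congr rfl fun a _ => ?_
    show t ^ (∑ p, (Sum.elim a b ∘ (pairsSucc r).symm) p) •
      schur (raise _ (Sum.elim a b ∘ (pairsSucc r).symm)) = _
    rw [raise_cons, sum_pairs_succ]
    simp only [Function.comp_apply, Equiv.symm_apply_apply, Sum.elim_inl, Sum.elim_inr]
    rw [smul_smul, ← pow_add, add_comm]
  · intro a ha
    have h := h₂ a ha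
    rw [Finset.mem_map]
    refine ⟨(fun q => a (pairsSucc r (Sum.inr q)), fun j => a (pairsSucc r (Sum.inl j))), ?_, ?_⟩
    · simp only [Finset.mem_product, S, T, Fintype.mem_piFinset, Finset.mem_range]
      exact ⟨fun q => (h _).trans_le (le_max_right _ _), fun j => (h _).trans_le (le_max_right _ _)⟩
    · funext p
      obtain ⟨x, rfl⟩ := (pairsSucc r).surjective p
      show Sum.elim _ _ ((pairsSucc r).symm (pairsSucc r x)) = _
      rw [Equiv.symm_apply_apply]
      cases x <;> rfl

theorem modQVec_zero (u : Fin 0 → ℤ) : modQVec u = 1 := by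
  have h : ∀ a : Pairs 0 → ℕ, a ∈ ({fun _ => 0} : Finset (Pairs 0 → ℕ)) := fun a => by
    rw [Finset.mem_singleton]; funext p; exact p.1.1.elim0
  rw [modQVec_eq_sum u fun a _ => h a]
  simp [schur]

/-! ### Adding and removing rows of diagrams -/

/-- The diagram with first row of length `m` and remaining rows those of `l`. -/
def consRow (m : ℕ) (l : YoungDiagram) (h : l.rowLen 0 ≤ m) : YoungDiagram where
  cells := (Finset.range m).image (fun j => (0, j)) ∪ l.cells.image fun c => (c.1 + 1, c.2)
  isLowerSet := by
    rintro ⟨i, j⟩ ⟨i', j'⟩ hle hc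
    obtain ⟨hi, hj⟩ : i' ≤ i ∧ j' ≤ j := hle
    simp only [Finset.coe_union, Finset.coe_image, Set.mem_union,
      Set.mem_image, Finset.mem_coe, Finset.mem_range, YoungDiagram.mem_cells, Prod.mk.injEq,
      Prod.exists] at hc ⊢
    rcases hc with ⟨j₀, hj₀, rfl, rfl⟩ | ⟨i₀, j₀, h₀, rfl, rfl⟩
    · exact Or.inl ⟨j', by omega, by omega, rfl⟩
    · cases i' with
      | zero =>
        refine Or.inl ⟨j', ?_, rfl, rfl⟩
        have h1 : (0, j') ∈ l := l.up_left_mem (Nat.zero_le _) hj h₀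
        exact (YoungDiagram.mem_iff_lt_rowLen.mp h1).trans_le h
      | succ i' => exact Or.inr ⟨i', j', l.up_left_mem (by omega) hj h₀, rfl, rfl⟩

section ConsRow

variable {m : ℕ} {l : YoungDiagram} (h : l.rowLen 0 ≤ m)

theorem zero_mem_consRow {j : ℕ} : (0, j) ∈ consRow m l h ↔ j < m := by
  rw [← YoungDiagram.mem_cells]; simp [consRow]

theorem succ_mem_consRow {i j : ℕ} : (i + 1, j) ∈ consRow m l h ↔ (i, j) ∈ l := by
  rw [← YoungDiagram.mem_cells]; simp [consRow]

theorem rowLen_consRow_zero : (consRow m l h).rowLen 0 = m :=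
  eq_of_forall_lt_iff fun j => by
    rw [← YoungDiagram.mem_iff_lt_rowLen, zero_mem_consRow]

theorem rowLen_consRow_succ (i : ℕ) : (consRow m l h).rowLen (i + 1) = l.rowLen i :=
  eq_of_forall_lt_iff fun j => by
    rw [← YoungDiagram.mem_iff_lt_rowLen, succ_mem_consRow, YoungDiagram.mem_iff_lt_rowLen]

theorem colLen_consRow_of_lt {j : ℕ} (hj : j < m) :
    (consRow m l h).colLen j = l.colLen j + 1 :=
  eq_of_forall_lt_iff fun i => by
    rw [← YoungDiagram.mem_iff_lt_colLen]
    cases i with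
    | zero => simp [zero_mem_consRow, hj]
    | succ i => rw [succ_mem_consRow, YoungDiagram.mem_iff_lt_colLen]; omega

theorem card_consRow : (consRow m l h).card = m + l.card := by
  show Finset.card _ = _
  simp only [consRow]
  rw [Finset.card_union_of_disjoint, Finset.card_image_of_injective, Finset.card_image_of_injective,
    Finset.card_range]
  · rintro ⟨i, j⟩ ⟨i', j'⟩ e
    simpa using e
  · intro j j' e
    simpa using e
  · rw [Finset.disjoint_left]
    intro c h1 h2
    obtain ⟨a, _, rfl⟩ := Finset.mem_image.mp h1
    obtain ⟨b, _, hb⟩ := Finset.mem_image.mp h2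
    exact Nat.succ_ne_zero _ (Prod.ext_iff.mp hb).1

theorem len_consRow (hm : 0 < m) : len (consRow m l h) = len l + 1 :=
  colLen_consRow_of_lt h hm

theorem rowLens_consRow (hm : 0 < m) : (consRow m l h).rowLens = m :: l.rowLens := by
  rw [YoungDiagram.rowLens, show (consRow m l h).colLen 0 = l.colLen 0 + 1 from len_consRow h hm, List.range_succ_eq_map, List.map_cons,
    rowLen_consRow_zero, List.map_map, YoungDiagram.rowLens]
  congr 1
  refine List.map_congr_left fun i _ => ?_
  exact rowLen_consRow_succ h i

end ConsRow

theorem consRow_injective {m : ℕ} {l l' : YoungDiagram} (h : l.rowLen 0 ≤ m)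
    (h' : l'.rowLen 0 ≤ m) (e : consRow m l h = consRow m l' h') : l = l' := by
  ext1
  ext ⟨i, j⟩
  rw [YoungDiagram.mem_cells, YoungDiagram.mem_cells, ← succ_mem_consRow h, e, succ_mem_consRow]

/-- The diagram obtained by removing the first row. -/
def tailRow (l : YoungDiagram) : YoungDiagram where
  cells := (l.cells.filter fun c => c.1 ≠ 0).image fun c => (c.1 - 1, c.2)
  isLowerSet := by
    rintro ⟨i, j⟩ ⟨i', j'⟩ hle hc
    obtain ⟨hi, hj⟩ : i' ≤ i ∧ j' ≤ j := hle
    obtain ⟨⟨i₀, j₀⟩, h0, e⟩ := Finset.mem_image.mp hc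
    obtain ⟨h1, h2⟩ := Finset.mem_filter.mp h0
    simp only [Prod.mk.injEq] at e h2
    refine Finset.mem_image.mpr ⟨(i' + 1, j'), Finset.mem_filter.mpr ⟨?_, Nat.succ_ne_zero _⟩, rfl⟩
    exact l.up_left_mem (by omega) (by omega) h1

theorem mem_tailRow {l : YoungDiagram} {i j : ℕ} : (i, j) ∈ tailRow l ↔ (i + 1, j) ∈ l := by
  rw [← YoungDiagram.mem_cells, ← YoungDiagram.mem_cells, tailRow, Finset.mem_image]
  constructor
  · rintro ⟨⟨i₀, j₀⟩, h0, e⟩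
    obtain ⟨h1, h2⟩ := Finset.mem_filter.mp h0
    simp only [Prod.mk.injEq] at e h2
    rwa [← e.1, ← e.2, Nat.sub_add_cancel (Nat.pos_of_ne_zero h2)]
  · intro h
    exact ⟨(i + 1, j), Finset.mem_filter.mpr ⟨h, Nat.succ_ne_zero _⟩, rfl⟩

theorem rowLen_tailRow (l : YoungDiagram) (i : ℕ) : (tailRow l).rowLen i = l.rowLen (i + 1) :=
  eq_of_forall_lt_iff fun j => by
    rw [← YoungDiagram.mem_iff_lt_rowLen, mem_tailRow, YoungDiagram.mem_iff_lt_rowLen]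

theorem rowLen_tailRow_le (l : YoungDiagram) : (tailRow l).rowLen 0 ≤ l.rowLen 0 := by
  rw [rowLen_tailRow]; exact l.rowLen_anti _ _ (Nat.zero_le _)

theorem consRow_tailRow (l : YoungDiagram) :
    consRow (l.rowLen 0) (tailRow l) (rowLen_tailRow_le l) = l := by
  ext1
  ext ⟨i, j⟩
  rw [YoungDiagram.mem_cells, YoungDiagram.mem_cells]
  cases i with
  | zero => rw [zero_mem_consRow, YoungDiagram.mem_iff_lt_rowLen]
  | succ i => rw [succ_mem_consRow, mem_tailRow]

theorem eq_bot_of_rowLen_zero {l : YoungDiagram} (h : l.rowLen 0 = 0) : l = ⊥ := by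
  ext1
  ext ⟨i, j⟩
  rw [YoungDiagram.mem_cells, YoungDiagram.mem_iff_lt_rowLen]
  have := l.rowLen_anti 0 i (Nat.zero_le _)
  simp only [YoungDiagram.cells_bot, Finset.notMem_empty, iff_false]
  omega

theorem rowLen_bot (i : ℕ) : (⊥ : YoungDiagram).rowLen i = 0 := by
  by_contra h
  exact YoungDiagram.notMem_bot (i, 0) (YoungDiagram.mem_iff_lt_rowLen.mpr (Nat.pos_of_ne_zero h))

theorem colLen_bot (i : ℕ) : (⊥ : YoungDiagram).colLen i = 0 := by
  by_contra h
  exact YoungDiagram.notMem_bot (0, i) (YoungDiagram.mem_iff_lt_colLen.mpr (Nat.pos_of_ne_zero h))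

theorem exists_eq_consRow {l : YoungDiagram} (hl : 0 < l.rowLen 0) :
    ∃ l' h, l = consRow (l.rowLen 0) l' h ∧ l'.card < l.card := by
  refine ⟨tailRow l, rowLen_tailRow_le l, (consRow_tailRow l).symm, ?_⟩
  conv_rhs => rw [← consRow_tailRow l, card_consRow]
  omega

/-- Induction on the number of rows. -/
theorem diagram_induction {p : YoungDiagram → Prop} (bot : p ⊥)
    (cons : ∀ m l h, 0 < m → p l → p (consRow m l h)) (l : YoungDiagram) : p l := by
  induction hn : l.card using Nat.strong_induction_on generalizing l with
  | _ n ih =>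
    rcases Nat.eq_zero_or_pos (l.rowLen 0) with h0 | h0
    · rw [eq_bot_of_rowLen_zero h0]; exact bot
    · obtain ⟨l', h, e, hlt⟩ := exists_eq_consRow h0
      rw [e]
      exact cons _ _ _ h0 (ih _ (hn ▸ hlt) l' rfl)

theorem count_rowLens_eq_zero {l : YoungDiagram} {m : ℕ} (h : l.rowLen 0 < m) :
    l.rowLens.count m = 0 := by
  rw [List.count_eq_zero]
  intro hm
  obtain ⟨i, _, hi⟩ := List.mem_map.mp hm
  have := l.rowLen_anti 0 i (Nat.zero_le _)
  omega

theorem b_bot : b ⊥ = 1 := by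
  have : (⊥ : YoungDiagram).rowLens = [] := by rw [YoungDiagram.rowLens, colLen_bot]; rfl
  rw [b, this]; simp

theorem b_consRow {m : ℕ} {l : YoungDiagram} (h : l.rowLen 0 ≤ m) (hm : 0 < m) :
    b (consRow m l h) = (1 - t ^ (l.rowLens.count m + 1)) * b l := by
  have h1 : b l = ∏ i ∈ insert m l.rowLens.toFinset,
      ∏ j ∈ Finset.Icc 1 (l.rowLens.count i), (1 - t ^ j) := by
    refine Finset.prod_subset (Finset.subset_insert _ _) fun i _ hi => ?_
    rw [List.count_eq_zero.mpr (by simpa using hi)]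
    simp
  rw [h1, b, rowLens_consRow h hm, List.toFinset_cons,
    ← Finset.mul_prod_erase _ _ (Finset.mem_insert_self m l.rowLens.toFinset),
    ← Finset.mul_prod_erase (insert m l.rowLens.toFinset) _ (Finset.mem_insert_self _ _),
    ← mul_assoc, List.count_cons_self, ← Finset.insert_Icc_right_eq_Icc_add_one (by omega),
    Finset.prod_insert (by simp)]
  congr 1
  refine Finset.prod_congr rfl fun i hi => ?_
  rw [List.count_cons_of_ne (Finset.mem_erase.mp hi).1.symm]

theorem constantCoeff_b (l : YoungDiagram) : PowerSeries.constantCoeff (R := ℚ) (b l) = 1 := by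
  rw [b, map_prod]
  refine Finset.prod_eq_one fun i _ => ?_
  rw [map_prod]
  refine Finset.prod_eq_one fun j hj => ?_
  have : j ≠ 0 := by have := (Finset.mem_Icc.mp hj).1; omega
  simp [t, this]

theorem b_mul_inv (l : YoungDiagram) : b l * (b l)⁻¹ = 1 :=
  PowerSeries.mul_inv_cancel _ (by rw [constantCoeff_b]; exact one_ne_zero)

theorem b_ne_zero (l : YoungDiagram) : b l ≠ 0 := fun h => by
  have := b_mul_inv l
  rw [h, zero_mul] at this
  exact zero_ne_one this

/-! ### The functions `Q'_λ` and creation operators -/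

theorem modQ_eq {l : YoungDiagram} {n : ℕ} (h : len l = n) :
    modQ l = modQVec fun i : Fin n => (l.rowLen i : ℤ) := by
  subst h; rfl

theorem modQ_bot : modQ ⊥ = 1 := by
  rw [modQ_eq (n := 0) (colLen_bot 0), modQVec_zero]

theorem shiftCoeff_one_right (ε : Coef) {k : ℕ} (hk : k ≠ 0) : shiftCoeff ε k 1 = 0 := by
  rw [shiftCoeff_apply, map_one, Polynomial.coeff_one, if_neg hk]

theorem creation_one (m : ℤ) : creation m 1 = completeInt m := by
  rw [creation, vertex_eq_sum (K := 1) _ fun k hk => shiftCoeff_one_right _ (by omega)]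
  simp [shiftCoeff_zero]

theorem annihilation_one (m : ℤ) : annihilation m 1 = negComplete (-m) := by
  rw [annihilation, vertex_eq_sum (K := 1) _ fun k hk => shiftCoeff_one_right _ (by omega)]
  simp [shiftCoeff_zero]

theorem modQ_consRow {m : ℕ} {l : YoungDiagram} (h : l.rowLen 0 ≤ m) :
    modQ (consRow m l h) = creation m (modQ l) := by
  rcases Nat.eq_zero_or_pos m with rfl | hm
  -- A first row of length `0` adds nothing, in agreement with `B_0 1 = S_0 = 1`.
  · have e1 : l = ⊥ := eq_bot_of_rowLen_zero (by omega)
    have e2 : consRow 0 l h = ⊥ := eq_bot_of_rowLen_zero (rowLen_consRow_zero h)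
    rw [e2, e1, modQ_bot, creation_one, Nat.cast_zero, completeInt_zero]
  · rw [modQ_eq (len_consRow h hm), modQ, ← modQVec_cons]
    congr 1
    funext i
    refine Fin.cases ?_ (fun i => ?_) i
    · simp [rowLen_consRow_zero]
    · simp [rowLen_consRow_succ]

theorem euler_modQ (l : YoungDiagram) : euler (modQ l) = (l.card : Coef) • modQ l := by
  induction l using diagram_induction with
  | bot =>
    have : (⊥ : YoungDiagram).card = 0 := rfl
    simp [modQ_bot, this]
  | cons m l h hm ih =>
    rw [modQ_consRow, euler_creation, ih, map_smul, card_consRow, ← add_smul]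
    push_cast; rfl

theorem weight_eq_of_coeff_ne_zero {f : Sym} {n : ℕ} (hf : euler f = (n : Coef) • f)
    {s : ℕ+ →₀ ℕ} (hs : MvPolynomial.coeff s f ≠ 0) : weight s = n := by
  have h := coeff_euler s f
  rw [hf, MvPolynomial.coeff_smul, smul_eq_mul] at h
  have h2 := congrArg (PowerSeries.constantCoeff (R := ℚ)) (mul_right_cancel₀ hs h)
  rw [map_natCast, map_natCast] at h2
  exact_mod_cast h2.symm

/-! ### Straightening -/

/-- The span of the `Q'_λ` with `λ` of length at most `r` and size `e`. -/
def spanLenCard (r : ℕ) (e : ℤ) : Submodule Coef Sym :=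
  Submodule.span Coef {f | ∃ l : YoungDiagram, len l ≤ r ∧ (l.card : ℤ) = e ∧ modQ l = f}

theorem spanLenCard_mono {r r' : ℕ} (h : r ≤ r') (e : ℤ) : spanLenCard r e ≤ spanLenCard r' e :=
  Submodule.span_mono fun _ ⟨l, h1, h2⟩ => ⟨l, h1.trans h, h2⟩

theorem len_consRow_le {m : ℕ} {l : YoungDiagram} (h : l.rowLen 0 ≤ m) :
    len (consRow m l h) ≤ len l + 1 := by
  rcases Nat.eq_zero_or_pos m with rfl | hm
  · rw [eq_bot_of_rowLen_zero (rowLen_consRow_zero h), len, colLen_bot]; omega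
  · exact (len_consRow h hm).le

/-- Straightening by induction on `|λ|`. If `m ≥ λ_1` a row is added. Otherwise the exchange
relation rewrites `B_m B_(λ_1)` with inner indices below `λ_1`; the inner function is then a
combination of `Q'_ν` with `|ν| < |λ|`, to which the induction applies again. Recording the size in
the span is what makes this second use possible. -/
theorem creation_modQ_mem (l : YoungDiagram) (m : ℤ) :
    creation m (modQ l) ∈ spanLenCard (len l + 1) (l.card + m) := by
  induction hn : l.card using Nat.strong_induction_on generalizing l m with
  | _ n ih =>
    subst hn
    rcases lt_or_ge m (l.rowLen 0) with hlt | hge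
    · rcases Nat.eq_zero_or_pos (l.rowLen 0) with h0 | h0
      · rw [eq_bot_of_rowLen_zero h0, modQ_bot, creation_one, completeInt_of_neg (by omega)]
        exact zero_mem _
      obtain ⟨l', h, e, hcard⟩ := exists_eq_consRow h0
      set n := l.rowLen 0 with hn
      have hc : (l.card : ℤ) = n + l'.card := by
        have := card_consRow h; rw [← e] at this; exact_mod_cast this
      have hlen : len l = len l' + 1 := by rw [e]; exact len_consRow h h0
      have key : ∀ k k' : ℤ, l'.card + k < l.card → k + k' = m + n →
          creation k' (creation k (modQ l')) ∈ spanLenCard (len l + 1) (l.card + m) := by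
        intro k k' hk hkk
        have hmem := ih l'.card hcard l' k rfl
        rw [← hlen] at hmem
        refine Submodule.span_induction (p := fun f _ => creation k' f ∈ _) ?_ ?_ ?_ ?_ hmem
        · rintro _ ⟨ν, h1, h2, rfl⟩
          have := ih ν.card (by omega) ν k' rfl
          rw [h2, show (l'.card : ℤ) + k + k' = l.card + m by omega] at this
          exact spanLenCard_mono (by omega) _ this
        · rw [map_zero]; exact zero_mem _
        · intro x y _ _ hx hy; rw [map_add]; exact add_mem hx hy
        · intro c x _ hx; rw [map_smul]; exact Submodule.smul_mem _ c hx
      have hQ : modQ l = creation n (modQ l') := by rw [← modQ_consRow h, ← e]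
      rw [hQ]
      -- When `m + 1 = n`, the term `B_(n-1) B_(m+1)` has inner index `n` and does not get smaller;
      -- the two-term relation is used instead.
      rcases eq_or_ne (m + 1) n with he | he
      · rw [← he, creation_creation_succ]
        exact Submodule.smul_mem _ _ (key _ _ (by omega) (by omega))
      · rw [creation_creation]
        exact add_mem (sub_mem (Submodule.smul_mem _ _ (key _ _ (by omega) (by omega)))
          (key _ _ (by omega) (by omega))) (Submodule.smul_mem _ _ (key _ _ (by omega) (by omega)))
    · lift m to ℕ using (by omega)
      have h : l.rowLen 0 ≤ m := by exact_mod_cast hge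
      rw [← modQ_consRow h]
      refine Submodule.subset_span ⟨_, len_consRow_le h, ?_, rfl⟩
      rw [card_consRow]; push_cast; ring

/-- The span of the `Q'_λ` with `λ` of length at most `r`. -/
def spanLen (r : ℕ∞) : Submodule Coef Sym :=
  Submodule.span Coef {f | ∃ l : YoungDiagram, (len l : ℕ∞) ≤ r ∧ modQ l = f}

theorem creation_mem_spanLen {r : ℕ∞} {f : Sym} (hf : f ∈ spanLen r) (m : ℤ) :
    creation m f ∈ spanLen (r + 1) := by
  refine Submodule.span_induction (p := fun f _ => creation m f ∈ spanLen (r + 1)) ?_ ?_ ?_ ?_ hf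
  · rintro _ ⟨l, hl, rfl⟩
    refine Submodule.span_mono ?_ (creation_modQ_mem l m)
    rintro _ ⟨l', h1, -, rfl⟩
    refine ⟨l', le_trans ?_ (add_le_add_left hl 1), rfl⟩
    exact_mod_cast h1
  · rw [map_zero]; exact zero_mem _
  · intro x y _ _ hx hy; rw [map_add]; exact add_mem hx hy
  · intro c x _ hx; rw [map_smul]; exact Submodule.smul_mem _ c hx

theorem spanLen_mono {r r' : ℕ∞} (h : r ≤ r') : spanLen r ≤ spanLen r' :=
  Submodule.span_mono fun _ ⟨l, h1, h2⟩ => ⟨l, h1.trans h, h2⟩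

/-- Each term of the recursion `shiftCoeff_one_creation` is, after induction on `k`, a single
creation operator applied to functions of length at most `ℓ(l)`. -/
theorem shiftCoeff_one_modQ_mem (l : YoungDiagram) (k : ℕ) :
    shiftCoeff 1 k (modQ l) ∈ spanLen (len l) := by
  induction l using diagram_induction generalizing k with
  | bot =>
    have h1 : (1 : Sym) ∈ spanLen (len ⊥) := Submodule.subset_span ⟨⊥, le_rfl, modQ_bot⟩
    rw [modQ_bot]
    cases k with
    | zero => rw [shiftCoeff_zero]; exact h1
    | succ k => rw [shiftCoeff_one_right _ k.succ_ne_zero]; exact zero_mem _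
  | cons m l h hm ih =>
    have h1 : modQ l ∈ spanLen (len l) := Submodule.subset_span ⟨l, le_rfl, rfl⟩
    -- All integers `n` are needed, since the recursion lowers `n`.
    have key : ∀ (k : ℕ) (n : ℤ), shiftCoeff 1 k (creation n (modQ l)) ∈ spanLen (len l + 1) := by
      intro k
      induction k with
      | zero => intro n; rw [shiftCoeff_zero]; exact creation_mem_spanLen h1 n
      | succ k ihk =>
        intro n
        rw [shiftCoeff_one_creation]
        exact sub_mem (add_mem (ihk _) (creation_mem_spanLen (ih _) _))
          (Submodule.smul_mem _ _ (creation_mem_spanLen (ih _) _))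
    rw [modQ_consRow, len_consRow h hm]
    exact_mod_cast key k m

theorem shiftCoeff_one_mem_spanLen {r : ℕ∞} {f : Sym} (hf : f ∈ spanLen r) (k : ℕ) :
    shiftCoeff 1 k f ∈ spanLen r := by
  refine Submodule.span_induction (p := fun f _ => shiftCoeff 1 k f ∈ spanLen r) ?_ ?_ ?_ ?_ hf
  · rintro _ ⟨l, hl, rfl⟩
    exact spanLen_mono hl (shiftCoeff_one_modQ_mem l k)
  · rw [map_zero]; exact zero_mem _
  · intro x y _ _ hx hy; rw [map_add]; exact add_mem hx hy
  · intro c x _ hx; rw [map_smul]; exact Submodule.smul_mem _ c hx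

theorem completeInt_mul_mem_spanLen {r : ℕ∞} {f : Sym} (hf : f ∈ spanLen r) (m : ℤ) :
    completeInt m * f ∈ spanLen (r + 1) := by
  obtain ⟨K, hK⟩ := exists_shiftCoeff_eq_zero 1 f
  rw [completeInt_mul hK]
  exact Submodule.sum_mem _ fun k _ => creation_mem_spanLen (shiftCoeff_one_mem_spanLen hf k) _

theorem one_mem_spanLen (r : ℕ∞) : (1 : Sym) ∈ spanLen r :=
  Submodule.subset_span ⟨⊥, by rw [len, colLen_bot]; simp, modQ_bot⟩

theorem X_mul_mem_spanLen_top {f : Sym} (hf : f ∈ spanLen ⊤) (i : ℕ) :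
    MvPolynomial.X (Nat.succPNat i) * f ∈ spanLen ⊤ := by
  induction i using Nat.strong_induction_on generalizing f with
  | _ k ih =>
    have h := congrArg (· * f) (newton k)
    rw [Finset.sum_range_succ, Nat.sub_self, complete_zero, mul_one, ← completeInt_natCast] at h
    simp only [add_mul, Finset.sum_mul] at h
    rw [eq_sub_of_add_eq' h.symm]
    refine sub_mem ?_ (Submodule.sum_mem _ fun i hi => ?_)
    · rw [mul_assoc, ← nsmul_eq_mul]
      exact Submodule.smul_of_tower_mem _ _ (completeInt_mul_mem_spanLen hf _)
    · rw [mul_assoc, ← completeInt_natCast]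
      exact ih i (Finset.mem_range.mp hi) (completeInt_mul_mem_spanLen hf _)

theorem spanLen_top : spanLen ⊤ = ⊤ := by
  rw [eq_top_iff]
  rintro f -
  induction f using MvPolynomial.induction_on with
  | C c =>
    rw [← mul_one (MvPolynomial.C c), ← MvPolynomial.smul_eq_C_mul]
    exact Submodule.smul_mem _ _ (one_mem_spanLen _)
  | add p q hp hq => exact add_mem hp hq
  | mul_X p i hp =>
    rw [mul_comm, ← PNat.succPNat_natPred i]
    exact X_mul_mem_spanLen_top hp _

/-! ### Orthogonality -/

/-- In the exchange relation with `d = j - m > 0` the scalar term is absent, and the other one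
vanishes by induction. -/
theorem annihilation_modQ_eq_zero {l : YoungDiagram} {j : ℤ} (hj : l.rowLen 0 < j) :
    annihilation j (modQ l) = 0 := by
  induction l using diagram_induction generalizing j with
  | bot =>
    rw [rowLen_bot] at hj
    rw [modQ_bot, annihilation_one, negComplete_of_neg (by push_cast at hj; omega)]
  | cons m l h hm ih =>
    rw [rowLen_consRow_zero] at hj
    have hz : ∀ i : ℤ, j ≤ i → annihilation i (modQ l) = 0 := fun i hi => ih (by omega)
    have h1 := annihilation_creation (j - m).toNat j (modQ l) fun i hi => by
      rw [hz i hi.le, map_zero]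
    rw [hz j le_rfl, map_zero, smul_zero, add_zero, if_neg (by omega), smul_zero] at h1
    rw [modQ_consRow, ← h1]
    congr 3
    have : m < j := hj
    omega

/-- `B*_m B_m f = (1 - t) f + t B_m B*_m f` is applied to each row equal to `m` in turn, and `(1 -
t) + t (1 - t^c) = 1 - t^(c+1)`; shorter rows are killed by `B*_m`. -/
theorem annihilation_modQ_consRow {m : ℕ} {l : YoungDiagram} (h : l.rowLen 0 ≤ m) (hm : 0 < m) :
    annihilation m (modQ (consRow m l h)) = (1 - t ^ (l.rowLens.count m + 1)) • modQ l := by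
  induction l using diagram_induction with
  | bot =>
    have h1 := annihilation_creation 0 m (modQ ⊥) fun i hi => by
      rw [annihilation_modQ_eq_zero (by rw [rowLen_bot]; push_cast; omega), map_zero]
    rw [annihilation_modQ_eq_zero (by rw [rowLen_bot]; exact_mod_cast hm), map_zero, smul_zero,
      add_zero, if_pos rfl, Nat.cast_zero, sub_zero] at h1
    rw [modQ_consRow, h1, count_rowLens_eq_zero (by rwa [rowLen_bot]), zero_add, pow_one]
  | cons n l hn hn0 ih =>
    have h' := h
    rw [rowLen_consRow_zero] at h'
    have h1 := annihilation_creation 0 m (modQ (consRow n l hn)) fun i hi => by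
      rw [annihilation_modQ_eq_zero (by rw [rowLen_consRow_zero]; omega), map_zero]
    rw [if_pos rfl, Nat.cast_zero, sub_zero] at h1
    rw [modQ_consRow, h1]
    rcases h'.lt_or_eq with hlt | rfl
    · have hlt' : (consRow n l hn).rowLen 0 < m := by rwa [rowLen_consRow_zero]
      rw [annihilation_modQ_eq_zero (by exact_mod_cast hlt'), map_zero, smul_zero, add_zero,
        count_rowLens_eq_zero hlt', zero_add, pow_one]
    · rw [ih hn, map_smul, ← modQ_consRow hn, smul_smul, ← add_smul, rowLens_consRow hn hm,
        List.count_cons_self]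
      congr 1
      ring

-- The longer of the two first rows is moved across as an annihilation operator: different lengths
-- give `0`, and equal ones give the factor by which `b` grows.
open Classical in
theorem pairing_modQ (l m : YoungDiagram) :
    pairing (modQ l) (modQ m) = if l = m then b l else 0 := by
  induction l using diagram_induction generalizing m with
  | bot =>
    rcases Nat.eq_zero_or_pos (m.rowLen 0) with h0 | h0
    · rw [eq_bot_of_rowLen_zero h0, if_pos rfl, b_bot, modQ_bot, MvPolynomial.one_def,
        pairing_monomial, MvPolynomial.coeff_monomial]
      simp [normSq]
    · obtain ⟨m', h, e, -⟩ := exists_eq_consRow h0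
      rw [if_neg, pairing_comm, e, modQ_consRow, pairing_creation, annihilation_modQ_eq_zero,
        map_zero]
      · rw [rowLen_bot]; exact_mod_cast h0
      · rintro rfl; rw [rowLen_bot] at h0; omega
  | cons n l h hn ih =>
    rcases lt_trichotomy (m.rowLen 0) n with hlt | heq | hgt
    · rw [modQ_consRow, pairing_creation, annihilation_modQ_eq_zero (by exact_mod_cast hlt),
        map_zero, if_neg]
      rintro rfl
      rw [rowLen_consRow_zero] at hlt; omega
    · obtain ⟨m', h', e, -⟩ := exists_eq_consRow (heq ▸ hn)
      rw [e, modQ_consRow h, pairing_creation]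
      subst heq
      rw [annihilation_modQ_consRow h' hn, map_smul, ih, b_consRow h hn, smul_eq_mul]
      by_cases hl : l = m'
      · subst hl; rw [if_pos rfl, if_pos rfl]
      · rw [if_neg hl, if_neg fun hc => hl (consRow_injective _ _ hc), mul_zero]
    · obtain ⟨m', h', e, -⟩ := exists_eq_consRow (l := m) (by omega)
      rw [if_neg, pairing_comm, e, modQ_consRow h', pairing_creation, annihilation_modQ_eq_zero,
        map_zero]
      · rw [rowLen_consRow_zero]; exact_mod_cast hgt
      · intro hc
        have := congrArg (fun l => YoungDiagram.rowLen l 0) hc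
        simp only [rowLen_consRow_zero] at this; omega

theorem linearIndependent_modQ : LinearIndependent Coef modQ := by
  classical
  rw [linearIndependent_iff]
  intro c hc
  ext1 m
  have h := congrArg (pairing (modQ m)) hc
  rw [Finsupp.linearCombination_apply, Finsupp.sum, map_sum, map_zero] at h
  simp only [map_smul, pairing_modQ, smul_eq_mul, mul_ite, mul_zero, Finset.sum_ite_eq] at h
  by_contra hm
  rw [if_pos (Finsupp.mem_support_iff.mpr hm)] at h
  exact mul_ne_zero hm (b_ne_zero m) h

/-- The basis of the ring of symmetric functions formed by the `Q'_λ`. -/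
def modQBasis : Module.Basis YoungDiagram Coef Sym :=
  Module.Basis.mk linearIndependent_modQ <| by
    rw [← spanLen_top, spanLen]
    refine Submodule.span_mono ?_
    rintro _ ⟨l, -, rfl⟩
    exact ⟨l, rfl⟩

theorem modQBasis_apply (l : YoungDiagram) : modQBasis l = modQ l := by
  rw [modQBasis, Module.Basis.mk_apply]

/-! ### The specialization of the skew functions at one letter -/

theorem mem_subdiagrams {l m : YoungDiagram} : m ∈ subdiagrams l ↔ m ≤ l := by
  simp [subdiagrams]

theorem colLen_eq_zero {l : YoungDiagram} {j : ℕ} (h : l.rowLen 0 ≤ j) : l.colLen j = 0 := by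
  by_contra hc
  have := YoungDiagram.mem_iff_lt_rowLen.mp
    (YoungDiagram.mem_iff_lt_colLen.mpr (Nat.pos_of_ne_zero hc))
  omega

theorem colLen_eq_count {l : YoungDiagram} {m : ℕ} (h : l.rowLen 0 ≤ m) (hm : 0 < m) :
    l.colLen (m - 1) = l.rowLens.count m := by
  induction l using diagram_induction with
  | bot =>
    rw [colLen_bot, count_rowLens_eq_zero]
    rwa [rowLen_bot]
  | cons n l hl hn ih =>
    have h' := h
    rw [rowLen_consRow_zero] at h'
    rcases h'.lt_or_eq with hlt | rfl
    · rw [colLen_eq_zero (by rw [rowLen_consRow_zero]; omega), count_rowLens_eq_zero]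
      rwa [rowLen_consRow_zero]
    · rw [colLen_consRow_of_lt hl (by omega), rowLens_consRow hl hm, List.count_cons_self, ih hl]

theorem rowLen_zero_le_of_le {l m : YoungDiagram} (h : m ≤ l) : m.rowLen 0 ≤ l.rowLen 0 := by
  by_contra! hc
  have := h (YoungDiagram.mem_iff_lt_rowLen.mpr hc)
  exact lt_irrefl _ (YoungDiagram.mem_iff_lt_rowLen.mp this)

theorem colLen_le_of_le {l m : YoungDiagram} (h : m ≤ l) (j : ℕ) : m.colLen j ≤ l.colLen j := by
  by_contra! hc
  have := h (YoungDiagram.mem_iff_lt_colLen.mpr hc)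
  exact lt_irrefl _ (YoungDiagram.mem_iff_lt_colLen.mp this)

/-- `B_(m-1)` passes each row equal to `m` at the cost of `t`, by `creation_creation_succ`, and then
adds a row of length `m - 1`. The outcome is the diagram `(m, l)` without the bottom box of its last
column. -/
theorem creation_pred_modQ (l : YoungDiagram) {m : ℕ} (h : l.rowLen 0 ≤ m) (hm : 0 < m) :
    ∃ l' : YoungDiagram,
      creation ((m : ℤ) - 1) (modQ l) = t ^ ((consRow m l h).colLen (m - 1) - 1) • modQ l' ∧
      ∀ i j, (i, j) ∈ l' ↔ (i, j) ∈ consRow m l h ∧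
        ¬ (i = (consRow m l h).colLen (m - 1) - 1 ∧ j = m - 1) := by
  induction hn : l.card using Nat.strong_induction_on generalizing l with
  | _ n ih =>
    have hcol := colLen_consRow_of_lt h (j := m - 1) (by omega)
    rcases h.lt_or_eq with hlt | heq
    · have hle : l.rowLen 0 ≤ m - 1 := by omega
      rw [colLen_eq_zero hle] at hcol
      refine ⟨consRow (m - 1) l hle, ?_, ?_⟩
      · rw [hcol, modQ_consRow, Nat.sub_self, pow_zero, one_smul, Nat.cast_sub hm, Nat.cast_one]
      · intro i j
        rw [hcol]
        cases i with
        | zero => rw [zero_mem_consRow, zero_mem_consRow]; omega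
        | succ i => rw [succ_mem_consRow, succ_mem_consRow]; simp
    · obtain ⟨l₁, h₁, e, hcard⟩ := exists_eq_consRow (heq ▸ hm : 0 < l.rowLen 0)
      subst heq
      obtain ⟨l₂, h2, h3⟩ := ih _ (hn ▸ hcard) l₁ h₁ rfl
      rw [← e] at h2 h3
      have hle : l₂.rowLen 0 ≤ l.rowLen 0 :=
        rowLen_zero_le_of_le (fun c hc => ((h3 c.1 c.2).mp hc).1)
      have hpos : 0 < l.colLen (l.rowLen 0 - 1) :=
        YoungDiagram.mem_iff_lt_colLen.mp (YoungDiagram.mem_iff_lt_rowLen.mpr (by omega))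
      refine ⟨consRow _ l₂ hle, ?_, ?_⟩
      · have hQ : modQ l = creation (l.rowLen 0) (modQ l₁) := by rw [← modQ_consRow h₁, ← e]
        have hc := creation_creation_succ ((l.rowLen 0 : ℤ) - 1) (modQ l₁)
        rw [sub_add_cancel, ← hQ, h2, map_smul, ← modQ_consRow hle, smul_smul, ← pow_succ'] at hc
        rw [hc, hcol]
        congr 2
        omega
      · intro i j
        rw [hcol]
        cases i with
        | zero => rw [zero_mem_consRow, zero_mem_consRow]; omega
        | succ i =>
          rw [succ_mem_consRow, succ_mem_consRow, h3]
          exact and_congr_right fun _ => not_congr (and_congr_left fun _ => by omega)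

/-! ### Recursions for the product formula `aleph`. -/

theorem nSkew_eq_sum (l m : YoungDiagram) {N : ℕ} (hN : l.rowLen 0 ≤ N) :
    nSkew l m = ∑ i ∈ Finset.range N, (l.colLen i - m.colLen i).choose 2 := by
  refine Finset.sum_subset (Finset.range_mono hN) fun i _ hi => ?_
  rw [colLen_eq_zero (by simpa using hi), Nat.zero_sub]
  rfl

/-- Column differences are unchanged, the product gains the factor of the new row, and `b` gains `1
- t` to the multiplicity of `m` in the new smaller diagram. -/
theorem aleph_consRow_consRow {m : ℕ} {l l' : YoungDiagram} (h : l.rowLen 0 ≤ m)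
    (h' : l'.rowLen 0 ≤ m) (hm : 0 < m) :
    (1 - t ^ (consRow m l' h').colLen (m - 1)) * aleph (consRow m l h) (consRow m l' h') =
      (1 - t ^ (consRow m l h).colLen (m - 1)) * aleph l l' := by
  have hn : nSkew (consRow m l h) (consRow m l' h') = nSkew l l' := by
    rw [nSkew_eq_sum l l' h, nSkew, rowLen_consRow_zero]
    refine Finset.sum_congr rfl fun i hi => ?_
    have hi := Finset.mem_range.mp hi
    rw [colLen_consRow_of_lt h hi, colLen_consRow_of_lt h' hi, Nat.add_sub_add_right]
  have hp : ∏ k ∈ Finset.range (len (consRow m l' h')),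
      (1 - t ^ ((consRow m l h).colLen ((consRow m l' h').rowLen k - 1) - k)) =
      (∏ k ∈ Finset.range (len l'), (1 - t ^ (l.colLen (l'.rowLen k - 1) - k))) *
        (1 - t ^ (consRow m l h).colLen (m - 1)) := by
    rw [len_consRow h' hm, Finset.prod_range_succ', rowLen_consRow_zero, Nat.sub_zero]
    congr 1
    refine Finset.prod_congr rfl fun k _ => ?_
    have := l'.rowLen_anti 0 k (Nat.zero_le _)
    rw [rowLen_consRow_succ, colLen_consRow_of_lt h (by omega), Nat.add_sub_add_right]
  have hb : (1 - t ^ (consRow m l' h').colLen (m - 1)) * (b (consRow m l' h'))⁻¹ = (b l')⁻¹ := by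
    have h1 := b_mul_inv (consRow m l' h')
    have h2 := b_mul_inv l'
    have h3 := b_consRow h' hm
    rw [← colLen_eq_count h' hm, ← colLen_consRow_of_lt h' (by omega : m - 1 < m)] at h3
    apply mul_left_cancel₀ (b_ne_zero l')
    rw [h2]
    refine Eq.trans ?_ h1
    generalize (b (consRow m l' h'))⁻¹ = c
    rw [h3]
    ring
  rw [aleph, aleph, hn, hp, ← hb]
  ring

theorem one_sub_mul_prod_range (k a : ℕ) :
    (1 - t ^ k) * ∏ j ∈ Finset.range a, (1 - t ^ (k - 1 - j)) =
      (∏ j ∈ Finset.range a, (1 - t ^ (k - j))) * (1 - t ^ (k - a) : Coef) := by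
  rw [← Finset.prod_range_succ (fun j => (1 - t ^ (k - j) : Coef)), Finset.prod_range_succ',
    mul_comm, Nat.sub_zero]
  congr 1
  refine Finset.prod_congr rfl fun j _ => ?_
  rw [Nat.sub_sub, add_comm 1]

/-- Only the last column changes, from `k` to `k - 1`. With `a` boxes of `m` in it, the exponent
`nSkew` drops by `k - 1 - a`, and only the factors of the `a` rows of `m` of length `n` are
affected; they telescope. -/
theorem aleph_remove_corner {l l' m : YoungDiagram} {n : ℕ} (hl : l.rowLen 0 = n) (hn : 0 < n)
    (hl' : ∀ i j, (i, j) ∈ l' ↔ (i, j) ∈ l ∧ ¬ (i = l.colLen (n - 1) - 1 ∧ j = n - 1))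
    (hm : m ≤ l') :
    (1 - t ^ l.colLen (n - 1)) * (t ^ (l.colLen (n - 1) - 1) * aleph l' m) =
      t ^ m.colLen (n - 1) * (1 - t ^ (l.colLen (n - 1) - m.colLen (n - 1))) * aleph l m := by
  have hle : l' ≤ l := fun c hc => ((hl' c.1 c.2).mp hc).1
  set k := l.colLen (n - 1) with hk
  set a := m.colLen (n - 1) with ha
  have hpos : 0 < k :=
    YoungDiagram.mem_iff_lt_colLen.mp (YoungDiagram.mem_iff_lt_rowLen.mpr (by omega))
  have hcol : l'.colLen (n - 1) = k - 1 := eq_of_forall_lt_iff fun i => by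
    rw [← YoungDiagram.mem_iff_lt_colLen, hl', YoungDiagram.mem_iff_lt_colLen]; omega
  have hcol' : ∀ j, j ≠ n - 1 → l'.colLen j = l.colLen j := fun j hj =>
    eq_of_forall_lt_iff fun i => by
      rw [← YoungDiagram.mem_iff_lt_colLen, hl', YoungDiagram.mem_iff_lt_colLen]; omega
  have hak : a ≤ k - 1 := hcol ▸ colLen_le_of_le hm (n - 1)
  have hmn : m.rowLen 0 ≤ n := hl ▸ rowLen_zero_le_of_le (hm.trans hle)
  have hns : k - 1 + nSkew l' m = a + nSkew l m := by
    rw [nSkew_eq_sum l' m (hl ▸ rowLen_zero_le_of_le hle), nSkew_eq_sum l m hl.le,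
      ← Finset.sum_erase_add _ _ (Finset.mem_range.mpr (by omega : n - 1 < n)),
      ← Finset.sum_erase_add (Finset.range n) (fun i => (l.colLen i - m.colLen i).choose 2)
        (Finset.mem_range.mpr (by omega : n - 1 < n)), hcol, ← hk, ← ha,
      Finset.sum_congr rfl fun i hi => by rw [hcol' i (Finset.mem_erase.mp hi).1]]
    have : (k - a).choose 2 = (k - 1 - a).choose 2 + (k - 1 - a) := by
      obtain ⟨d, hd⟩ := Nat.exists_eq_add_of_le hak
      rw [show k - a = d + 1 by omega, show k - 1 - a = d by omega, Nat.choose_succ_succ' d 1,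
        Nat.choose_one_right, add_comm]
    omega
  have hrow : ∀ j, j < a → m.rowLen j = n := fun j hj => by
    have h1 := YoungDiagram.mem_iff_lt_rowLen.mp (YoungDiagram.mem_iff_lt_colLen.mpr hj)
    have h2 := m.rowLen_anti 0 j (Nat.zero_le _)
    omega
  have hrow' : ∀ j, a ≤ j → m.rowLen j < n := fun j hj => by
    by_contra! hc
    have h1 : (j, n - 1) ∈ m := YoungDiagram.mem_iff_lt_rowLen.mpr (by omega)
    have h2 := YoungDiagram.mem_iff_lt_colLen.mp h1
    omega
  have halen : a ≤ len m := m.colLen_anti _ _ (Nat.zero_le _)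
  have hprod : ∀ ν : YoungDiagram, ∏ j ∈ Finset.range (len m),
      (1 - t ^ (ν.colLen (m.rowLen j - 1) - j) : Coef) =
      (∏ j ∈ Finset.range a, (1 - t ^ (ν.colLen (n - 1) - j))) *
        ∏ j ∈ Finset.Ico a (len m), (1 - t ^ (ν.colLen (m.rowLen j - 1) - j)) := fun ν => by
    rw [← Finset.prod_range_mul_prod_Ico _ halen]
    congr 1
    refine Finset.prod_congr rfl fun j hj => ?_
    rw [hrow j (Finset.mem_range.mp hj)]
  have htail : ∏ j ∈ Finset.Ico a (len m), (1 - t ^ (l'.colLen (m.rowLen j - 1) - j) : Coef) =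
      ∏ j ∈ Finset.Ico a (len m), (1 - t ^ (l.colLen (m.rowLen j - 1) - j)) := by
    refine Finset.prod_congr rfl fun j hj => ?_
    obtain ⟨h1, h2⟩ := Finset.mem_Ico.mp hj
    have h3 : 0 < m.rowLen j :=
      YoungDiagram.mem_iff_lt_rowLen.mp (YoungDiagram.mem_iff_lt_colLen.mpr h2)
    have h4 := hrow' j h1
    rw [hcol' _ (by omega)]
  have hpow : t ^ (k - 1) * t ^ nSkew l' m = t ^ a * (t ^ nSkew l m : Coef) := by
    rw [← pow_add, ← pow_add, hns]
  rw [aleph, aleph, hprod, hprod, htail, hcol, ← hk]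
  linear_combination ((b m)⁻¹ * t ^ (k - 1) * t ^ nSkew l' m *
      ∏ j ∈ Finset.Ico a (len m), (1 - t ^ (l.colLen (m.rowLen j - 1) - j))) *
      one_sub_mul_prod_range k a + ((b m)⁻¹ * (∏ j ∈ Finset.range a, (1 - t ^ (k - j))) *
      (1 - t ^ (k - a)) *
      ∏ j ∈ Finset.Ico a (len m), (1 - t ^ (l.colLen (m.rowLen j - 1) - j))) * hpow

-- With `k` and `a` the last column lengths of the two diagrams, this is `1 - t^k = (1 - t^a) + t^a
-- (1 - t^(k-a))` times `aleph`. The side conditions fail exactly when `a = 0`, respectively `a =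
-- k`, where the corresponding summand is zero anyway.
open Classical in
theorem aleph_consRow {n : ℕ} {l l' m : YoungDiagram} (h : l.rowLen 0 ≤ n) (hn : 0 < n)
    (hl' : ∀ i j, (i, j) ∈ l' ↔ (i, j) ∈ consRow n l h ∧
      ¬ (i = (consRow n l h).colLen (n - 1) - 1 ∧ j = n - 1)) (hm : m ≤ consRow n l h) :
    aleph (consRow n l h) m = (if m.rowLen 0 = n then aleph l (tailRow m) else 0) +
      t ^ ((consRow n l h).colLen (n - 1) - 1) * (if m ≤ l' then aleph l' m else 0) := by
  set L := consRow n l h with hL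
  have hrow : L.rowLen 0 = n := rowLen_consRow_zero h
  have hpos : 0 < L.colLen (n - 1) :=
    YoungDiagram.mem_iff_lt_colLen.mp (YoungDiagram.mem_iff_lt_rowLen.mpr (by omega))
  have hmn : m.rowLen 0 ≤ n := hrow ▸ rowLen_zero_le_of_le hm
  have hak := colLen_le_of_le hm (n - 1)
  have h2 : (1 - t ^ L.colLen (n - 1)) * (t ^ (L.colLen (n - 1) - 1) *
      (if m ≤ l' then aleph l' m else 0)) =
      t ^ m.colLen (n - 1) * (1 - t ^ (L.colLen (n - 1) - m.colLen (n - 1))) * aleph L m := by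
    split_ifs with hml
    · exact aleph_remove_corner hrow hn hl' hml
    · have : m.colLen (n - 1) = L.colLen (n - 1) := by
        by_contra hne
        refine hml fun c hc => (hl' c.1 c.2).mpr ⟨hm hc, ?_⟩
        rintro ⟨h3, h4⟩
        have h5 := YoungDiagram.mem_iff_lt_colLen.mp (show (c.1, c.2) ∈ m from hc)
        rw [h4] at h5
        omega
      rw [this, Nat.sub_self]; simp
  have h1 : (1 - t ^ L.colLen (n - 1)) * (if m.rowLen 0 = n then aleph l (tailRow m) else 0) =
      (1 - t ^ m.colLen (n - 1)) * aleph L m := by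
    split_ifs with hmn'
    · subst hmn'
      have h3 := aleph_consRow_consRow h (rowLen_tailRow_le m) hn
      rw [consRow_tailRow] at h3
      exact h3.symm
    · rw [colLen_eq_zero (l := m) (by omega)]; simp
  apply mul_left_cancel₀ (one_sub_t_pow_ne_zero hpos.ne')
  rw [mul_add, h1, h2, mul_sub, mul_one, ← pow_add, Nat.add_sub_cancel' hak]
  ring

/-- For `λ = (n, l₁)`, `addOne_creation` gives two terms. In one, `B_(n-1) Q'_(l₁)` is a multiple of
`Q'` for a diagram with one box fewer. In the other, `B_n` acts on `Q'_μ` with `μ ⊆ l₁`, so `μ_1 ≤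
n` and it merely adds a row, without straightening. Both are known by induction on the size, and the
coefficients match by `aleph_consRow`. -/
theorem addOne_modQ (l : YoungDiagram) :
    addOne (modQ l) = ∑ m ∈ subdiagrams l, aleph l m • modQ m := by
  classical
  induction hc : l.card using Nat.strong_induction_on generalizing l with
  | _ N ih =>
    subst hc
    rcases Nat.eq_zero_or_pos (l.rowLen 0) with h0 | h0
    · rw [eq_bot_of_rowLen_zero h0]
      have h1 : subdiagrams ⊥ = {⊥} := by
        ext m; rw [mem_subdiagrams, Finset.mem_singleton, le_bot_iff]
      have h2 : aleph ⊥ ⊥ = 1 := by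
        have := b_mul_inv ⊥
        rw [b_bot, one_mul] at this
        rw [aleph, b_bot, this, len, colLen_bot, nSkew, rowLen_bot]
        simp
      rw [h1, Finset.sum_singleton, h2, modQ_bot, map_one, one_smul]
    · obtain ⟨l₁, h, e, hcard⟩ := exists_eq_consRow h0
      set n := l.rowLen 0 with hn
      obtain ⟨l₂, hQ, hl₂⟩ := creation_pred_modQ l₁ h h0
      have hrec : ∀ m ∈ subdiagrams l, aleph l m • modQ m =
          (if m.rowLen 0 = n then aleph l₁ (tailRow m) • modQ m else 0) +
          t ^ (l.colLen (n - 1) - 1) • (if m ≤ l₂ then aleph l₂ m • modQ m else 0) := by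
        intro m hm
        rw [mem_subdiagrams, e] at hm
        have := aleph_consRow h h0 hl₂ hm
        rw [← e] at this
        rw [this, add_smul, ite_smul, zero_smul, mul_smul, ite_smul, zero_smul]
      have hle : l₂ ≤ l := fun c hc => e ▸ ((hl₂ c.1 c.2).mp hc).1
      have hlt : l₂.card < l.card := by
        refine Finset.card_lt_card (YoungDiagram.cells_ssubset_iff.mpr (lt_of_le_of_ne hle ?_))
        intro heq
        have h1 : 0 < l.colLen (n - 1) :=
          YoungDiagram.mem_iff_lt_colLen.mp (YoungDiagram.mem_iff_lt_rowLen.mpr (by omega))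
        have h2 : (l.colLen (n - 1) - 1, n - 1) ∈ l₂ := by
          rw [heq]; exact YoungDiagram.mem_iff_lt_colLen.mpr (by omega)
        rw [hl₂, ← e] at h2
        exact h2.2 ⟨rfl, rfl⟩
      rw [← e] at hQ
      have hQ' : modQ l = creation n (modQ l₁) := by rw [← modQ_consRow h, ← e]
      rw [Finset.sum_congr rfl hrec, Finset.sum_add_distrib, ← Finset.smul_sum,
        ← Finset.sum_filter, ← Finset.sum_filter, hQ', addOne_creation, hQ, map_smul,
        ih _ hlt l₂ rfl, ih _ hcard l₁ rfl, add_comm, map_sum]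
      congr 1
      -- Removing the first row identifies the `m ⊆ l` with first row `n` with all the `μ ⊆ l₁`.
      · symm
        refine Finset.sum_nbij tailRow ?_ ?_ ?_ ?_
        · intro m hm
          rw [Finset.mem_filter, mem_subdiagrams] at hm
          rw [mem_subdiagrams]
          rintro ⟨i, j⟩ hc
          have h1 := hm.1 (mem_tailRow.mp hc)
          rw [e] at h1
          exact (succ_mem_consRow h).mp h1
        · intro m hm m' hm' hmm
          rw [Finset.mem_coe, Finset.mem_filter] at hm hm'
          have h1 : consRow n (tailRow m) (hm.2 ▸ rowLen_tailRow_le m) = m := by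
            have := consRow_tailRow m
            simp only [hm.2] at this
            exact this
          have h2 : consRow n (tailRow m') (hm'.2 ▸ rowLen_tailRow_le m') = m' := by
            have := consRow_tailRow m'
            simp only [hm'.2] at this
            exact this
          rw [← h1, ← h2]
          congr 1
        · intro m hm
          rw [Finset.mem_coe, mem_subdiagrams] at hm
          have hmn : m.rowLen 0 ≤ n := (rowLen_zero_le_of_le hm).trans h
          refine ⟨consRow n m hmn, ?_, ?_⟩
          · rw [Finset.mem_coe, Finset.mem_filter, mem_subdiagrams]
            refine ⟨?_, rowLen_consRow_zero hmn⟩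
            rintro ⟨i, j⟩ hc
            rw [e]
            cases i with
            | zero => exact (zero_mem_consRow h).mpr ((zero_mem_consRow hmn).mp hc)
            | succ i => exact (succ_mem_consRow h).mpr (hm ((succ_mem_consRow hmn).mp hc))
          · ext1
            ext ⟨i, j⟩
            rw [YoungDiagram.mem_cells, YoungDiagram.mem_cells, mem_tailRow, succ_mem_consRow]
        · intro m hm
          rw [Finset.mem_filter] at hm
          rw [map_smul, ← hm.2, ← modQ_consRow (rowLen_tailRow_le m), consRow_tailRow]
      · congr 1
        refine Finset.sum_congr ?_ fun _ _ => rfl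
        ext m
        rw [Finset.mem_filter, mem_subdiagrams, mem_subdiagrams]
        exact ⟨fun hm => ⟨hm.trans hle, hm⟩, fun hm => hm.2⟩

/-- By base change the `1 ⊗ Q'_k` form a basis over the left factor. Hence the definition of
`skewModQ` never falls into its default value. -/
theorem existsUnique_modQ_expansion (x : Sym ⊗[Coef] Sym) :
    ∃! c : YoungDiagram →₀ Sym, x = c.sum fun k f => f ⊗ₜ[Coef] modQ k := by
  let B := Algebra.TensorProduct.basis Sym modQBasis
  have hB : ∀ c : YoungDiagram →₀ Sym,
      (c.sum fun k f => f ⊗ₜ[Coef] modQ k) = Finsupp.linearCombination Sym B c := fun c => by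
    rw [Finsupp.linearCombination_apply]
    refine Finsupp.sum_congr fun k _ => ?_
    rw [Algebra.TensorProduct.basis_apply, modQBasis_apply, TensorProduct.smul_tmul', smul_eq_mul,
      mul_one]
  refine ⟨B.repr x, ?_, fun c hc => ?_⟩
  · show x = _
    rw [hB, B.linearCombination_repr]
  · have hc : x = c.sum fun k f => f ⊗ₜ[Coef] modQ k := hc
    rw [hB] at hc
    rw [hc, B.repr_linearCombination]

open Classical in
theorem evalOne_skewModQ (l m : YoungDiagram) :
    evalOne (skewModQ l m) = if m ≤ l then aleph l m else 0 := by
  have hex := existsUnique_modQ_expansion (addAlphabet (modQ l))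
  rw [skewModQ, dif_pos hex]
  have hc := hex.exists.choose_spec
  set c := hex.exists.choose with hcdef
  -- `φ` is `f ⊗ g ↦ f(1) g`; it turns `Q'_λ(X + Y)` into `Q'_λ(Y + 1)`.
  let φ : Sym ⊗[Coef] Sym →ₐ[Coef] Sym :=
    Algebra.TensorProduct.productMap ((Algebra.ofId Coef Sym).comp evalOne) (AlgHom.id Coef Sym)
  have hφ : φ.comp addAlphabet = addOne := by
    apply MvPolynomial.algHom_ext
    intro i
    rw [AlgHom.comp_apply, addAlphabet, evalAt_X, addOne, evalAt_X, map_add,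
      Algebra.TensorProduct.productMap_apply_tmul, Algebra.TensorProduct.productMap_apply_tmul]
    simp [evalOne, evalAt_X, add_comm]
  have h1 : addOne (modQ l) = ∑ k ∈ c.support, evalOne (c k) • modQ k := by
    rw [← hφ, AlgHom.comp_apply, hc, Finsupp.sum, map_sum]
    refine Finset.sum_congr rfl fun k _ => ?_
    rw [Algebra.TensorProduct.productMap_apply_tmul, Algebra.smul_def]
    rfl
  have h2 := congrArg (pairing (modQ m)) (h1.symm.trans (addOne_modQ l))
  rw [map_sum, map_sum] at h2
  simp only [map_smul, pairing_modQ, smul_eq_mul, mul_ite, mul_zero, Finset.sum_ite_eq,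
    mem_subdiagrams] at h2
  apply mul_right_cancel₀ (b_ne_zero m)
  rw [ite_mul, zero_mul, ← h2]
  split_ifs with h
  · rfl
  · rw [Finsupp.notMem_support_iff.mp h, map_zero, zero_mul]

/-! ### The Cauchy formula -/

theorem evalAt_monomial {R : Type*} [CommRing R] [Algebra Coef R] (a : ℕ+ → R) (s : ℕ+ →₀ ℕ)
    (c : Coef) : evalAt a (MvPolynomial.monomial s c) = c • s.prod fun i k => a i ^ k := by
  rw [evalAt, MvPolynomial.aeval_monomial, Algebra.smul_def]

theorem evalAt_eq_sum {R : Type*} [CommRing R] [Algebra Coef R] (a : ℕ+ → R) (f : Sym)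
    {S : Finset (ℕ+ →₀ ℕ)} (hS : f.support ⊆ S) :
    evalAt a f = ∑ s ∈ S, f.coeff s • s.prod fun i k => a i ^ k := by
  conv_lhs => rw [f.as_sum, map_sum]
  simp only [evalAt_monomial]
  refine Finset.sum_subset hS fun s _ hs => ?_
  rw [MvPolynomial.notMem_support_iff.mp hs, zero_smul]

/-- The left side is the pairing of `S_d` with the product `∏ p_i^(s i)`. By adjunction this is the
coefficient of `w^d` in that product evaluated at `(1 - t)w`. -/
theorem coeff_complete_mul_normSq (d : ℕ) (s : ℕ+ →₀ ℕ) :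
    normSq s * (complete d).coeff s =
      if weight s = d then s.prod fun i k => (1 - t ^ (i : ℕ)) ^ k else 0 := by
  have h := pairing_scaledComplete_mul 1 d 1 (MvPolynomial.monomial s 1)
  have hn : normSq 0 = 1 := by simp [normSq]
  have h1 : ∀ f, pairing 1 f = MvPolynomial.constantCoeff f := fun f => by
    have := pairing_monomial 0 1 f
    rw [hn, one_mul, one_mul] at this
    exact this
  rw [scaledComplete_one, mul_one, pairing_comm, pairing_monomial, one_mul, h1,
    shiftCoeff_apply] at h
  have h2 : (Polynomial.mapRingHom (MvPolynomial.constantCoeff : Sym →+* Coef))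
      (shift 1 (MvPolynomial.monomial s 1)) =
      Polynomial.monomial (weight s) (s.prod fun i k => (1 - t ^ (i : ℕ)) ^ k) := by
    rw [shift, evalAt_monomial, one_smul, Finsupp.prod, map_prod]
    have : ∀ i ∈ s.support, (Polynomial.mapRingHom (MvPolynomial.constantCoeff : Sym →+* Coef))
        ((Polynomial.C (MvPolynomial.X i : Sym) +
          ((1 : Coef) * (1 - t ^ (i : ℕ))) • Polynomial.X ^ (i : ℕ)) ^ s i) =
        Polynomial.C ((1 - t ^ (i : ℕ)) ^ s i) * Polynomial.X ^ (s i * (i : ℕ)) := by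
      intro i _
      have e : ((1 : Coef) * (1 - t ^ (i : ℕ))) • (Polynomial.X ^ (i : ℕ) : Polynomial Sym) =
          Polynomial.C (MvPolynomial.C (1 - t ^ (i : ℕ))) * Polynomial.X ^ (i : ℕ) := by
        rw [one_mul, Algebra.smul_def]
        rfl
      rw [e, map_pow, map_add, map_mul, map_pow]
      simp only [Polynomial.coe_mapRingHom, Polynomial.map_C, Polynomial.map_X,
        MvPolynomial.constantCoeff_X, MvPolynomial.constantCoeff_C, map_zero, zero_add]
      rw [mul_pow, ← map_pow, ← pow_mul, mul_comm (i : ℕ)]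
    rw [Finset.prod_congr rfl this, Finset.prod_mul_distrib, ← map_prod, Finset.prod_pow_eq_pow_sum,
      Polynomial.C_mul_X_pow_eq_monomial]
    rfl
  rw [h]
  have h3 := congrArg (fun p => Polynomial.coeff p d) h2
  simp only [Polynomial.coe_mapRingHom, Polynomial.coeff_map, Polynomial.coeff_monomial] at h3
  exact h3

theorem len_le_card (l : YoungDiagram) : len l ≤ l.card := by
  rw [len, YoungDiagram.colLen_eq_card]
  exact Finset.card_le_card (Finset.filter_subset _ _)

theorem rowLen_zero_le_card (l : YoungDiagram) : l.rowLen 0 ≤ l.card := by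
  rw [YoungDiagram.rowLen_eq_card]
  exact Finset.card_le_card (Finset.filter_subset _ _)

theorem finite_card_eq (d : ℕ) : {l : YoungDiagram | l.card = d}.Finite := by
  refine Set.Finite.of_finite_image (f := YoungDiagram.cells)
    ((Finset.range d ×ˢ Finset.range d).powerset.finite_toSet.subset ?_) ?_
  · rintro _ ⟨l, hl, rfl⟩
    rw [Finset.mem_coe, Finset.mem_powerset]
    rintro ⟨i, j⟩ hc
    have hc : (i, j) ∈ l := hc
    have hl : l.card = d := hl
    have h1 := len_le_card l
    have h2 := rowLen_zero_le_card l
    have h3 := YoungDiagram.mem_iff_lt_colLen.mp (l.up_left_mem le_rfl (Nat.zero_le j) hc)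
    have h4 := YoungDiagram.mem_iff_lt_rowLen.mp (l.up_left_mem (Nat.zero_le i) le_rfl hc)
    rw [Finset.mem_product, Finset.mem_range, Finset.mem_range]
    exact ⟨by simp only [len] at h1; omega, by simp only; omega⟩
  · intro m _ k _ h
    exact YoungDiagram.ext h

/-- The finite set of all partitions of size `d`. -/
def diagrams (d : ℕ) : Finset YoungDiagram := (finite_card_eq d).toFinset

theorem mem_diagrams {d : ℕ} {l : YoungDiagram} : l ∈ diagrams d ↔ l.card = d := by
  simp [diagrams]

/-- Orthogonal expansion; the degree operator being self-adjoint, only partitions of size `d`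
contribute. -/
theorem sum_pairing_smul_modQ {d : ℕ} {f : Sym} (hf : euler f = (d : Coef) • f) :
    ∑ l ∈ diagrams d, ((b l)⁻¹ * pairing f (modQ l)) • modQ l = f := by
  classical
  apply eq_of_pairing_eq
  intro k
  rw [pairing_comm, pairing_comm k]
  have : ∀ {φ ψ : Sym →ₗ[Coef] Coef}, (∀ m, φ (modQ m) = ψ (modQ m)) → φ k = ψ k :=
    fun h => LinearMap.congr_fun (modQBasis.ext fun m => by rw [modQBasis_apply, h]) k
  apply this
  intro m
  rw [map_sum, LinearMap.sum_apply]
  simp only [map_smul, LinearMap.smul_apply, pairing_modQ, smul_eq_mul, mul_ite, mul_zero]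
  rw [Finset.sum_ite_eq']
  split_ifs with h
  · rw [mul_right_comm, mul_comm (b m)⁻¹, b_mul_inv, one_mul]
  · rw [mem_diagrams] at h
    have h1 := pairing_euler f (modQ m)
    rw [hf, euler_modQ, map_smul, map_smul, LinearMap.smul_apply] at h1
    by_contra hne
    have h2 := congrArg (PowerSeries.constantCoeff (R := ℚ)) (mul_right_cancel₀ (Ne.symm hne) h1)
    rw [map_natCast, map_natCast] at h2
    exact h (by exact_mod_cast h2.symm)

theorem evalAt_Q {R : Type*} [CommRing R] [Algebra Coef R] (a : ℕ+ → R) (l : YoungDiagram) :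
    evalAt a (Q l) = evalAt (fun i => (1 - t ^ (i : ℕ)) • a i) (modQ l) := by
  rw [Q, algHom_evalAt]
  simp only [map_smul, evalAt_X]

/-- Cauchy formula from dual bases. Each product of power sums of weight `d` in `c` is expanded on
the `Q'_λ`. The norm appearing in its coefficients, times that of `S_d`, is `∏ (1 - t^i)^(s i)`,
which changes the argument `a` into `a (1 - t)` and produces `P_λ`. -/
theorem evalAt_mul_complete {R : Type*} [CommRing R] [Algebra Coef R] (a c : ℕ+ → R) (d : ℕ) :
    evalAt (fun i => a i * c i) (complete d) =
      ∑ l ∈ diagrams d, evalAt a (P l) * evalAt c (modQ l) := by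
  have hs : ∀ s ∈ (complete d).support, weight s = d := fun s hs => by
    by_contra h
    have := coeff_complete_mul_normSq d s
    rw [if_neg h] at this
    exact MvPolynomial.mem_support_iff.mp hs
      ((mul_eq_zero.mp this).resolve_left (normSq_ne_zero s))
  have h1 : ∀ s ∈ (complete d).support, (complete d).coeff s • (s.prod fun i k => (a i * c i) ^ k) =
      ∑ l ∈ diagrams d, ((b l)⁻¹ • ((modQ l).coeff s •
        s.prod fun i k => ((1 - t ^ (i : ℕ)) • a i) ^ k)) * evalAt c (modQ l) := by
    intro s h
    have hm : euler (MvPolynomial.monomial s 1) = (d : Coef) • MvPolynomial.monomial s 1 := by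
      rw [euler_monomial, hs s h]
    have h2 := congrArg (evalAt c) (sum_pairing_smul_modQ hm)
    rw [evalAt_monomial, one_smul, map_sum] at h2
    have h3 : (s.prod fun i k => (a i * c i) ^ k) =
        (s.prod fun i k => a i ^ k) * s.prod fun i k => c i ^ k := by
      simp only [mul_pow, Finsupp.prod, Finset.prod_mul_distrib]
    have h4 : (s.prod fun i k => ((1 - t ^ (i : ℕ)) • a i) ^ k) =
        (s.prod fun i k => (1 - t ^ (i : ℕ) : Coef) ^ k) • s.prod fun i k => a i ^ k := by
      simp only [Algebra.smul_def, mul_pow, Finsupp.prod, Finset.prod_mul_distrib, map_prod, map_pow]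
    have h5 := coeff_complete_mul_normSq d s
    rw [if_pos (hs s h)] at h5
    rw [h3, ← h2, h4, ← h5, Finset.mul_sum, Finset.smul_sum]
    refine Finset.sum_congr rfl fun l _ => ?_
    rw [map_smul, pairing_monomial, one_mul]
    simp only [Algebra.smul_def, map_mul]
    ring
  rw [evalAt_eq_sum _ _ subset_rfl, Finset.sum_congr rfl h1, Finset.sum_comm]
  refine Finset.sum_congr rfl fun l hl => ?_
  rw [← Finset.sum_mul, ← Finset.smul_sum, P, map_smul, evalAt_Q]
  congr 2
  refine (evalAt_eq_sum _ _ fun s h => ?_).symm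
  -- Every monomial of weight `d` occurs in `S_d`, so its support may serve to expand `Q'_λ`.
  have hw : weight s = d := by
    rw [← mem_diagrams.mp hl]
    exact weight_eq_of_coeff_ne_zero (euler_modQ l) (MvPolynomial.mem_support_iff.mp h)
  rw [MvPolynomial.mem_support_iff]
  intro h0
  have := coeff_complete_mul_normSq d s
  rw [if_pos hw, h0, mul_zero] at this
  exact (Finset.prod_ne_zero_iff.mpr fun i _ =>
    pow_ne_zero _ (one_sub_t_pow_ne_zero i.ne_zero)) this.symm

/-! ### Vanishing for finite alphabets -/

theorem evalAt_add_pow {R : Type*} [CommRing R] [Algebra Coef R] (a : ℕ+ → R) (x : R) (f : Sym) :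
    ∃ N, evalAt (fun i => (1 - t ^ (i : ℕ)) • x ^ (i : ℕ) + a i) f =
      ∑ k ∈ Finset.range N, evalAt a (shiftCoeff 1 k f) * x ^ k := by
  have h : (Polynomial.eval₂RingHom (evalAt a).toRingHom x).comp (shift 1).toRingHom =
      (evalAt fun i => (1 - t ^ (i : ℕ)) • x ^ (i : ℕ) + a i).toRingHom := by
    apply MvPolynomial.ringHom_ext
    · intro r
      have h1 : ∀ c : ℕ+ → R, evalAt c (MvPolynomial.C r) = algebraMap Coef R r :=
        fun c => (evalAt c).commutes r
      simp [h1]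
    · intro i
      have e : ((1 : Coef) * (1 - t ^ (i : ℕ))) • (Polynomial.X ^ (i : ℕ) : Polynomial Sym) =
          Polynomial.C (MvPolynomial.C (1 - t ^ (i : ℕ))) * Polynomial.X ^ (i : ℕ) := by
        rw [one_mul, Algebra.smul_def]
        rfl
      have h1 : ∀ (c : ℕ+ → R) (r : Coef), evalAt c (MvPolynomial.C r) = algebraMap Coef R r :=
        fun c => (evalAt c).commutes
      simp only [RingHom.comp_apply, AlgHom.toRingHom_eq_coe, RingHom.coe_coe, shift_X, e,
        evalAt_X, Polynomial.coe_eval₂RingHom, Polynomial.eval₂_add, Polynomial.eval₂_mul,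
        Polynomial.eval₂_C, Polynomial.eval₂_X_pow, h1, Algebra.smul_def]
      rw [add_comm]
  refine ⟨(shift 1 f).natDegree + 1, ?_⟩
  have h2 := congrArg (fun φ : Sym →+* R => φ f) h
  refine h2.symm.trans ?_
  exact Polynomial.eval₂_eq_sum_range _ _

/-- Extracting a letter `x` replaces `f` by the coefficients of its shift. These are adjoint to
multiplication by `S_k`, which raises the length by at most one, so they are orthogonal to lengths
one less. With no letter left, orthogonality to `1` kills the constant term. -/
theorem evalAt_powerSum_eq_zero {R ι : Type*} [CommRing R] [Algebra Coef R] (g : ι → R)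
    (s : Finset ι) {f : Sym} (hf : ∀ k ∈ spanLen s.card, pairing k f = 0) :
    evalAt (fun i => (1 - t ^ (i : ℕ)) • ∑ x ∈ s, g x ^ (i : ℕ)) f = 0 := by
  classical
  induction s using Finset.induction_on generalizing f with
  | empty =>
    have h := hf 1 (one_mem_spanLen _)
    have h1 := pairing_monomial 0 1 f
    rw [show (MvPolynomial.monomial 0 1 : Sym) = 1 from rfl, h, one_mul] at h1
    have h2 := (mul_eq_zero.mp h1.symm).resolve_left (normSq_ne_zero 0)
    simp only [Finset.sum_empty, smul_zero]
    have : evalAt (fun _ : ℕ+ => (0 : R)) f = algebraMap Coef R (MvPolynomial.constantCoeff f) :=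
      MvPolynomial.aeval_zero' f
    rw [this, MvPolynomial.constantCoeff_eq, h2, map_zero]
  | insert x s hx ih =>
    simp only [Finset.sum_insert hx, smul_add]
    obtain ⟨N, hN⟩ := evalAt_add_pow (fun i => (1 - t ^ (i : ℕ)) • ∑ x ∈ s, g x ^ (i : ℕ)) (g x) f
    rw [hN]
    refine Finset.sum_eq_zero fun k _ => ?_
    rw [ih, zero_mul]
    intro q hq
    rw [← pairing_scaledComplete_mul, scaledComplete_one, ← completeInt_natCast]
    apply hf
    rw [Finset.card_insert_of_notMem hx, Nat.cast_succ]
    exact completeInt_mul_mem_spanLen hq k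

theorem evalAt_P_eq_zero {R ι : Type*} [CommRing R] [Algebra Coef R] (g : ι → R)
    (s : Finset ι) {l : YoungDiagram} (hl : s.card < len l) :
    evalAt (fun i => ∑ x ∈ s, g x ^ (i : ℕ)) (P l) = 0 := by
  rw [P, map_smul, evalAt_Q, evalAt_powerSum_eq_zero, smul_zero]
  intro k hk
  induction hk using Submodule.span_induction with
  | mem f hf =>
    obtain ⟨m, hm, rfl⟩ := hf
    rw [pairing_modQ, if_neg]
    rintro rfl
    exact absurd hl (not_lt.mpr (by exact_mod_cast hm))
  | zero => simp
  | add f g _ _ hf hg => rw [map_add, LinearMap.add_apply, hf, hg, add_zero]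
  | smul c f _ hf => rw [map_smul, LinearMap.smul_apply, hf, smul_zero]

/-! ### The summand of a partition -/

theorem evalAt_one_add_modQ {R : Type*} [CommRing R] [Algebra Coef R] (a : ℕ+ → R)
    (l : YoungDiagram) :
    evalAt (fun i => 1 + (1 - t ^ (i : ℕ)) • a i) (modQ l) =
      ∑ m ∈ subdiagrams l, (b m * evalOne (skewModQ l m)) • evalAt a (P m) := by
  have h := algHom_evalAt (evalAt fun i => (1 - t ^ (i : ℕ)) • a i)
    (fun i => (MvPolynomial.X i + 1 : Sym)) (modQ l)
  simp only [map_add, map_one, evalAt_X] at h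
  simp only [add_comm (1 : R)]
  rw [← h]
  change evalAt _ (addOne (modQ l)) = _
  rw [addOne_modQ, map_sum]
  refine Finset.sum_congr rfl fun m hm => ?_
  rw [evalOne_skewModQ, if_pos (mem_subdiagrams.mp hm), map_smul, ← evalAt_Q, P, map_smul,
    smul_smul, mul_right_comm, b_mul_inv, one_mul]

/-- The factorization `X + XY(1 - t) = X (1 + Y(1 - t))` combines the Cauchy formula with the
branching rule. -/
theorem evalAt_complete_eq_sum {R : Type*} [CommRing R] [Algebra Coef R] (a c : ℕ+ → R) (d : ℕ) :
    evalAt (fun i => a i + (1 - t ^ (i : ℕ)) • (a i * c i)) (complete d) =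
      ∑ l ∈ diagrams d, ∑ m ∈ subdiagrams l,
        (b m * evalOne (skewModQ l m)) • (evalAt a (P l) * evalAt c (P m)) := by
  have h : (fun i => a i + (1 - t ^ (i : ℕ)) • (a i * c i)) =
      fun i : ℕ+ => a i * (1 + (1 - t ^ (i : ℕ)) • c i) := by
    funext i; rw [mul_add, mul_one, mul_smul_comm]
  rw [h, evalAt_mul_complete]
  refine Finset.sum_congr rfl fun l _ => ?_
  rw [evalAt_one_add_modQ, Finset.mul_sum]
  exact Finset.sum_congr rfl fun m _ => mul_smul_comm _ _ _

/-! ### Reduction of power series modulo high monomials -/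

section Truncation

variable {σ : Type*}

/-- The power series without monomials dividing a given one. -/
def truncIdeal (d : σ →₀ ℕ) : Ideal (MvPowerSeries σ Coef) where
  carrier := {f | ∀ e ≤ d, MvPowerSeries.coeff e f = 0}
  zero_mem' := fun _ _ => rfl
  add_mem' := fun hf hg e he => by rw [map_add, hf e he, hg e he, add_zero]
  smul_mem' := fun c f hf e he => by
    classical
    rw [smul_eq_mul, MvPowerSeries.coeff_mul]
    refine Finset.sum_eq_zero fun p hp => ?_
    rw [Finset.HasAntidiagonal.mem_antidiagonal] at hp
    rw [hf p.2 ((le_add_self.trans hp.le).trans he), mul_zero]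

/-- Reduction modulo `truncIdeal d`. -/
abbrev red (d : σ →₀ ℕ) : MvPowerSeries σ Coef →ₐ[Coef] MvPowerSeries σ Coef ⧸ truncIdeal d :=
  Ideal.Quotient.mkₐ Coef (truncIdeal d)

theorem red_eq_red {d : σ →₀ ℕ} {f g : MvPowerSeries σ Coef} :
    red d f = red d g ↔ ∀ e ≤ d, MvPowerSeries.coeff e f = MvPowerSeries.coeff e g := by
  rw [Ideal.Quotient.mkₐ_eq_mk, Ideal.Quotient.eq]
  refine forall₂_congr fun e _ => ?_
  rw [map_sub, sub_eq_zero]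

theorem coeff_eq_of_red_eq {d : σ →₀ ℕ} {f g : MvPowerSeries σ Coef} (h : red d f = red d g) :
    MvPowerSeries.coeff d f = MvPowerSeries.coeff d g :=
  red_eq_red.mp h d le_rfl

/-- Modulo `truncIdeal d` only the finitely many letters in the support of `d` remain, so both
alphabets become finite. -/
theorem red_X_eq_zero {d : σ →₀ ℕ} {x : σ} (hx : x ∉ d.support) :
    red d (MvPowerSeries.X x) = 0 := by
  classical
  rw [← map_zero (red d), red_eq_red]
  intro e he
  rw [MvPowerSeries.coeff_X, if_neg, map_zero]
  rintro rfl
  have := he x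
  rw [Finsupp.single_eq_same, Finsupp.notMem_support_iff.mp hx] at this
  omega

theorem formalHasSum_of_coeff {ι : Type*} {f : ι → MvPowerSeries σ Coef} {F : MvPowerSeries σ Coef}
    (h : ∀ d, ∃ S : Finset ι, ∀ S', S ⊆ S' →
      MvPowerSeries.coeff d (∑ i ∈ S', f i) = MvPowerSeries.coeff d F) : FormalHasSum f F := by
  let _ : TopologicalSpace Coef := ⊥
  refine (MvPowerSeries.WithPiTopology.tendsto_iff_coeff_tendsto _ _ _).mpr fun d => ?_
  obtain ⟨S, hS⟩ := h d
  refine tendsto_const_nhds.congr' ?_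
  rw [SummationFilter.unconditional_filter]
  filter_upwards [Filter.eventually_ge_atTop S] with S' h'
  exact (hS S' h').symm

theorem formalHasProd_of_coeff {ι : Type*} {f : ι → MvPowerSeries σ Coef}
    {F : MvPowerSeries σ Coef}
    (h : ∀ d, ∃ S : Finset ι, ∀ S', S ⊆ S' →
      MvPowerSeries.coeff d (∏ i ∈ S', f i) = MvPowerSeries.coeff d F) : FormalHasProd f F := by
  let _ : TopologicalSpace Coef := ⊥
  refine (MvPowerSeries.WithPiTopology.tendsto_iff_coeff_tendsto _ _ _).mpr fun d => ?_
  obtain ⟨S, hS⟩ := h d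
  refine tendsto_const_nhds.congr' ?_
  rw [SummationFilter.unconditional_filter]
  filter_upwards [Filter.eventually_ge_atTop S] with S' h'
  exact (hS S' h').symm

/-- Each coefficient of the limit is read off a finite product; monotonicity of `S` makes these
choices compatible below `d`. -/
theorem exists_formalHasProd {ι : Type*} (u : ι → MvPowerSeries σ Coef)
    (S : (σ →₀ ℕ) → Finset ι) (hmono : Monotone S) (hS : ∀ d, ∀ q ∉ S d, red d (u q) = 1) :
    ∃ F, FormalHasProd u F ∧ ∀ d, red d F = ∏ q ∈ S d, red d (u q) := by
  have h1 : ∀ d S', S d ⊆ S' → red d (∏ q ∈ S', u q) = ∏ q ∈ S d, red d (u q) := by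
    intro d S' h'
    rw [map_prod]
    exact (Finset.prod_subset h' fun q _ hq => hS d q hq).symm
  let F : MvPowerSeries σ Coef := fun d => MvPowerSeries.coeff d (∏ q ∈ S d, u q)
  have hF : ∀ d, MvPowerSeries.coeff d F = MvPowerSeries.coeff d (∏ q ∈ S d, u q) := fun _ => rfl
  refine ⟨F, formalHasProd_of_coeff fun d => ⟨S d, fun S' h' => ?_⟩, fun d => ?_⟩
  · rw [hF]
    exact coeff_eq_of_red_eq ((h1 d S' h').trans (h1 d _ subset_rfl).symm)
  · rw [← h1 d _ subset_rfl, red_eq_red]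
    intro e he
    rw [hF]
    exact coeff_eq_of_red_eq ((h1 e _ subset_rfl).trans (h1 e _ (hmono he)).symm)

theorem coeff_powerSum {ι : Type*} (f : ι ↪ σ) (i : ℕ+) {e : σ →₀ ℕ} {S : Finset ι}
    (hS : ∀ x, f x ∈ e.support → x ∈ S) :
    MvPowerSeries.coeff e (powerSum f i) =
      MvPowerSeries.coeff e (∑ x ∈ S, (MvPowerSeries.X (f x) : MvPowerSeries σ Coef) ^ (i : ℕ)) := by
  classical
  simp only [map_sum, MvPowerSeries.coeff_X_pow]
  change (if _ then _ else _) = _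
  split_ifs with h
  · obtain ⟨x, rfl⟩ := h
    rw [Finset.sum_eq_single x, if_pos rfl]
    · intro y _ hy
      rw [if_neg]
      intro h
      exact hy (f.injective ((Finsupp.single_left_inj i.ne_zero).mp h).symm)
    · intro hx
      exact absurd (hS x (by simp)) hx
  · refine (Finset.sum_eq_zero fun x _ => if_neg fun hx => h ⟨x, hx⟩).symm

theorem red_powerSum {ι : Type*} (f : ι ↪ σ) (i : ℕ+) {d : σ →₀ ℕ} {S : Finset ι}
    (hS : ∀ x, f x ∈ d.support → x ∈ S) :
    red d (powerSum f i) = ∑ x ∈ S, red d (MvPowerSeries.X (f x)) ^ (i : ℕ) := by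
  simp only [← map_pow, ← map_sum]
  rw [red_eq_red]
  exact fun e he => coeff_powerSum f i fun x hx => hS x (Finsupp.support_mono he hx)

/-- Homogeneity turns the bound on the orders of the power sums into one for `f`; this makes the
infinite sums locally finite. -/
theorem le_order_evalAt {a : ℕ+ → MvPowerSeries σ Coef} (ha : ∀ i : ℕ+, ((i : ℕ) : ℕ∞) ≤ (a i).order)
    {f : Sym} {k : ℕ} (hf : euler f = (k : Coef) • f) : (k : ℕ∞) ≤ (evalAt a f).order := by
  refine MvPowerSeries.le_order fun d hd => ?_
  rw [evalAt_eq_sum a f subset_rfl, map_sum]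
  refine Finset.sum_eq_zero fun s hs => ?_
  have hw := weight_eq_of_coeff_ne_zero hf (MvPolynomial.mem_support_iff.mp hs)
  rw [map_smul, MvPowerSeries.coeff_of_lt_order, smul_zero]
  refine lt_of_lt_of_le hd ?_
  rw [← hw, weight, Finsupp.sum, Finsupp.prod]
  push_cast
  refine le_trans (Finset.sum_le_sum fun i _ => ?_) (MvPowerSeries.le_order_prod _ _)
  refine le_trans ?_ (MvPowerSeries.le_order_pow _)
  rw [nsmul_eq_mul]
  gcongr
  exact ha i

theorem le_order_powerSum {ι : Type*} (f : ι ↪ σ) (i : ℕ+) :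
    ((i : ℕ) : ℕ∞) ≤ (powerSum f i).order := by
  classical
  refine MvPowerSeries.le_order fun d hd => ?_
  change (if _ then _ else _) = _
  rw [if_neg]
  rintro ⟨x, rfl⟩
  simp at hd

end Truncation

/-! ### The generating series -/

theorem hSeries_add_sum {R ι : Type*} [CommRing R] [Algebra Coef R] (a : ℕ+ → R) (x y : ι → R)
    (s : Finset ι) :
    hSeries (fun i => a i + ∑ q ∈ s, (x q ^ (i : ℕ) - y q ^ (i : ℕ))) *
        ∏ q ∈ s, (1 - PowerSeries.C (x q) * PowerSeries.X) =
      hSeries a * ∏ q ∈ s, (1 - PowerSeries.C (y q) * PowerSeries.X) := by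
  classical
  induction s using Finset.induction_on with
  | empty => simp
  | insert q s hq ih =>
    have := hSeries_add_pow_sub_pow (a := fun i => a i + ∑ q ∈ s, (x q ^ (i : ℕ) - y q ^ (i : ℕ)))
      (a' := fun i => a i + ∑ q ∈ insert q s, (x q ^ (i : ℕ) - y q ^ (i : ℕ)))
      (x := x q) (y := y q) (fun i => by rw [Finset.sum_insert hq]; ring)
    rw [Finset.prod_insert hq, Finset.prod_insert hq, ← mul_assoc, mul_comm (hSeries _), this]
    linear_combination (1 - PowerSeries.C (y q) * PowerSeries.X) * ih

/-- Under `hK` the generating series is a polynomial. Its product formula, valid for power series,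
therefore holds for polynomials and may be evaluated at `1`. -/
theorem sum_evalAt_complete_mul {R ι κ : Type*} [CommRing R] [Algebra Coef R] (z : κ → R)
    (x y : ι → R) (s : Finset κ) (r : Finset ι) {K : ℕ}
    (hK : ∀ k ≥ K, evalAt (fun i => ∑ q ∈ s, z q ^ (i : ℕ) +
      ∑ q ∈ r, (x q ^ (i : ℕ) - y q ^ (i : ℕ))) (complete k) = 0) :
    (∑ k ∈ Finset.range K, evalAt (fun i => ∑ q ∈ s, z q ^ (i : ℕ) +
      ∑ q ∈ r, (x q ^ (i : ℕ) - y q ^ (i : ℕ))) (complete k)) *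
      ((∏ q ∈ s, (1 - z q)) * ∏ q ∈ r, (1 - x q)) = ∏ q ∈ r, (1 - y q) := by
  set a : ℕ+ → R := fun i => ∑ q ∈ s, z q ^ (i : ℕ) +
      ∑ q ∈ r, (x q ^ (i : ℕ) - y q ^ (i : ℕ)) with ha
  have h1 := hSeries_add_sum (fun i => ∑ q ∈ s, z q ^ (i : ℕ)) x y r
  have h2 := hSeries_add_sum 0 z 0 s
  have h3 : hSeries (0 : ℕ+ → R) = 1 := by
    ext k
    rw [hSeries, PowerSeries.coeff_mk, PowerSeries.coeff_one]
    exact evalAt_zero_complete k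
  have e : (fun i : ℕ+ => (0 : ℕ+ → R) i + ∑ q ∈ s, (z q ^ (i : ℕ) - (0 : κ → R) q ^ (i : ℕ))) =
      fun i : ℕ+ => ∑ q ∈ s, z q ^ (i : ℕ) := by
    funext i
    simp
  rw [e, h3] at h2
  simp only [Pi.zero_apply, map_zero, zero_mul, sub_zero, Finset.prod_const_one, one_mul] at h2
  have h4 : hSeries a * ((∏ q ∈ s, (1 - PowerSeries.C (z q) * PowerSeries.X)) *
      ∏ q ∈ r, (1 - PowerSeries.C (x q) * PowerSeries.X)) =
      ∏ q ∈ r, (1 - PowerSeries.C (y q) * PowerSeries.X) := by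
    rw [mul_comm (∏ q ∈ s, _), ← mul_assoc, h1, mul_right_comm, h2, one_mul]
  let p : Polynomial R := ∑ k ∈ Finset.range K, Polynomial.monomial k (evalAt a (complete k))
  have hp : (p : PowerSeries R) = hSeries a := by
    ext k
    rw [Polynomial.coeff_coe, hSeries, PowerSeries.coeff_mk, Polynomial.finsetSum_coeff]
    simp only [Polynomial.coeff_monomial]
    rw [Finset.sum_ite_eq']
    split_ifs with h
    · rfl
    · exact (hK k (by simpa using h)).symm
  have hlin : ∀ u : R, ((1 - Polynomial.C u * Polynomial.X : Polynomial R) : PowerSeries R) =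
      1 - PowerSeries.C u * PowerSeries.X := fun u => by simp
  have h5 : p * ((∏ q ∈ s, (1 - Polynomial.C (z q) * Polynomial.X)) *
      ∏ q ∈ r, (1 - Polynomial.C (x q) * Polynomial.X)) =
      ∏ q ∈ r, (1 - Polynomial.C (y q) * Polynomial.X) := by
    have hinj : ∀ u v : Polynomial R, Polynomial.coeToPowerSeries.ringHom u =
        Polynomial.coeToPowerSeries.ringHom v → u = v := fun _ _ h => Polynomial.coe_injective R h
    apply hinj
    simp only [map_mul, map_prod, Polynomial.coeToPowerSeries.ringHom_apply, hp]
    simpa only [hlin] using h4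
  have h6 := congrArg (Polynomial.eval 1) h5
  simpa [p, Polynomial.eval_finsetSum, Polynomial.eval_prod] using h6

/-! ### The kernel -/

section Kernel

variable {α β : Type*}

theorem le_order_pX (i : ℕ+) : ((i : ℕ) : ℕ∞) ≤ (pX α β i).order :=
  le_order_powerSum _ i

theorem le_order_pKernel (i : ℕ+) : ((i : ℕ) : ℕ∞) ≤ (pKernel α β i).order := by
  refine le_trans (le_min (le_order_pX i) ?_) MvPowerSeries.min_order_le_add
  refine le_trans ?_ MvPowerSeries.le_order_smul
  exact le_trans ((le_order_pX i).trans le_self_add) MvPowerSeries.le_order_mul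

theorem euler_complete (k : ℕ) : euler (complete k) = (k : Coef) • complete k := by
  have := euler_scaledComplete 1 k
  rwa [scaledComplete_one] at this

theorem coeff_evalAt_pKernel_complete {d : α ⊕ β →₀ ℕ} {k : ℕ} (h : d.degree < k) :
    MvPowerSeries.coeff d (evalAt (pKernel α β) (complete k)) = 0 :=
  MvPowerSeries.coeff_of_lt_order
    (lt_of_lt_of_le (by exact_mod_cast h) (le_order_evalAt le_order_pKernel (euler_complete k)))

theorem mul_inv_of_constantCoeff {f : Series α β} (h : MvPowerSeries.constantCoeff f = 1) :
    f * inv f = 1 :=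
  MvPowerSeries.mul_invOfUnit f 1 h

theorem one_sub_letterX_mul_inv (x : α) :
    (1 - letterX x : Series α β) * inv (1 - letterX x) = 1 :=
  mul_inv_of_constantCoeff (by simp [letterX])

theorem one_sub_letterX_mul_letterY_mul_inv (x : α) (y : β) :
    (1 - letterX x * letterY y : Series α β) * inv (1 - letterX x * letterY y) = 1 :=
  mul_inv_of_constantCoeff (by simp [letterX])

theorem red_pKernel (d : α ⊕ β →₀ ℕ) (i : ℕ+) :
    red d (pKernel α β i) = ∑ x ∈ d.support.toLeft, red d (letterX x) ^ (i : ℕ) +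
      ∑ q ∈ d.support.toLeft ×ˢ d.support.toRight,
        ((red d (letterX q.1) * red d (letterY q.2)) ^ (i : ℕ) -
          (t • (red d (letterX q.1) * red d (letterY q.2))) ^ (i : ℕ)) := by
  have hX : red d (pX α β i) = ∑ x ∈ d.support.toLeft, red d (letterX x) ^ (i : ℕ) :=
    red_powerSum _ i fun x hx => Finset.mem_toLeft.mpr hx
  have hY : red d (pY α β i) = ∑ y ∈ d.support.toRight, red d (letterY y) ^ (i : ℕ) :=
    red_powerSum _ i fun x hx => Finset.mem_toRight.mpr hx
  rw [pKernel, map_add, map_smul, map_mul, hX, hY, Finset.sum_mul_sum, ← Finset.sum_product',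
    Finset.smul_sum]
  congr 1
  refine Finset.sum_congr rfl fun q _ => ?_
  rw [smul_pow, mul_pow, sub_smul, one_smul]

/-- Modulo `truncIdeal d` the kernel is the finite alphabet of letters `x` and `xy` minus the
letters `t xy`, and the complete functions of degree above `d.degree` vanish. -/
theorem coeff_prod_eq_sum {F G : Series α β}
    (hF : ∀ d, red d F = ∏ x ∈ d.support.toLeft, red d (inv (1 - letterX x)))
    (hG : ∀ d, red d G = ∏ q ∈ d.support.toLeft ×ˢ d.support.toRight,
      red d ((1 - t • (letterX q.1 * letterY q.2)) * inv (1 - letterX q.1 * letterY q.2)))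
    (d : α ⊕ β →₀ ℕ) :
    MvPowerSeries.coeff d (F * G) = ∑ k ∈ Finset.range (d.degree + 1),
      MvPowerSeries.coeff d (evalAt (pKernel α β) (complete k)) := by
  rw [← map_sum]
  apply coeff_eq_of_red_eq
  have he : ∀ k, red d (evalAt (pKernel α β) (complete k)) =
      evalAt (fun i => ∑ x ∈ d.support.toLeft, red d (letterX x) ^ (i : ℕ) +
      ∑ q ∈ d.support.toLeft ×ˢ d.support.toRight,
        ((red d (letterX q.1) * red d (letterY q.2)) ^ (i : ℕ) -
          (t • (red d (letterX q.1) * red d (letterY q.2))) ^ (i : ℕ))) (complete k) := fun k => by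
    rw [algHom_evalAt]
    congr 2
    funext i
    exact red_pKernel d i
  have h := sum_evalAt_complete_mul (fun x : α => red d (letterX x))
    (fun q : α × β => red d (letterX q.1) * red d (letterY q.2))
    (fun q : α × β => t • (red d (letterX q.1) * red d (letterY q.2)))
    d.support.toLeft (d.support.toLeft ×ˢ d.support.toRight) (K := d.degree + 1) fun k hk => by
      rw [← he, ← map_zero (red d), red_eq_red]
      intro e hle
      rw [map_zero]
      exact coeff_evalAt_pKernel_complete (lt_of_le_of_lt (Finsupp.degree_mono hle) hk)
  simp only [← he, ← map_sum (red d)] at h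
  have h1 : (∏ x ∈ d.support.toLeft, (1 - red d (letterX x))) * red d F = 1 := by
    rw [hF, ← Finset.prod_mul_distrib]
    refine Finset.prod_eq_one fun x _ => ?_
    rw [← map_one (red d), ← map_sub, ← map_mul, one_sub_letterX_mul_inv]
  have h2 : ∀ q : α × β, (1 - red d (letterX q.1) * red d (letterY q.2)) *
      red d (inv (1 - letterX q.1 * letterY q.2)) = 1 := fun q => by
    rw [← map_mul, ← map_one (red d), ← map_sub, ← map_mul, one_sub_letterX_mul_letterY_mul_inv]
  have h3 : red d G = (∏ q ∈ d.support.toLeft ×ˢ d.support.toRight,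
      (1 - t • (red d (letterX q.1) * red d (letterY q.2)))) *
      ∏ q ∈ d.support.toLeft ×ˢ d.support.toRight, red d (inv (1 - letterX q.1 * letterY q.2)) := by
    rw [hG, ← Finset.prod_mul_distrib]
    refine Finset.prod_congr rfl fun q _ => ?_
    rw [map_mul, map_sub, map_one, map_smul, map_mul]
  have h4 : (∏ q ∈ d.support.toLeft ×ˢ d.support.toRight,
      (1 - red d (letterX q.1) * red d (letterY q.2))) *
      ∏ q ∈ d.support.toLeft ×ˢ d.support.toRight,
        red d (inv (1 - letterX q.1 * letterY q.2)) = 1 := by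
    rw [← Finset.prod_mul_distrib]
    exact Finset.prod_eq_one fun q _ => h2 q
  rw [map_mul, h3, ← h]
  linear_combination (exp := 1)
    (red d (∑ k ∈ Finset.range (d.degree + 1), evalAt (pKernel α β) (complete k))) * h1 +
    (red d (∑ k ∈ Finset.range (d.degree + 1), evalAt (pKernel α β) (complete k))) *
      ((∏ x ∈ d.support.toLeft, (1 - red d (letterX x))) * red d F) * h4

/-- A length exceeding `n` exceeds the number of letters, so `α` is finite and the vanishing for
finite alphabets applies. -/
theorem evalAt_pX_P_eq_zero {n : ℕ∞} (hn : ENat.card α ≤ n) {l : YoungDiagram}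
    (hl : ¬ (len l : ℕ∞) ≤ n) : evalAt (pX α β) (P l) = 0 := by
  have hlt : ENat.card α < len l := lt_of_le_of_lt hn (not_le.mp hl)
  have hfin : Finite α := ENat.card_lt_top.mp (hlt.trans_le le_top)
  have := Fintype.ofFinite α
  have h : pX α β = fun i : ℕ+ => ∑ x ∈ Finset.univ, (letterX x : Series α β) ^ (i : ℕ) := by
    funext i
    ext1 e
    exact coeff_powerSum _ i fun x _ => Finset.mem_univ x
  rw [h]
  apply evalAt_P_eq_zero
  rw [ENat.card_eq_coe_fintype_card] at hlt
  exact_mod_cast hlt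

theorem coeff_evalAt_pX_P_mul {d : α ⊕ β →₀ ℕ} {l : YoungDiagram} (h : d.degree < l.card)
    (z : Series α β) : MvPowerSeries.coeff d (evalAt (pX α β) (P l) * z) = 0 := by
  refine MvPowerSeries.coeff_of_lt_order (lt_of_lt_of_le ?_ MvPowerSeries.le_order_mul)
  refine lt_of_lt_of_le (b := (l.card : ℕ∞)) (by exact_mod_cast h) (le_trans ?_ le_self_add)
  rw [P, map_smul, evalAt_Q]
  refine le_trans (le_order_evalAt (fun i => ?_) (euler_modQ l)) MvPowerSeries.le_order_smul
  exact (le_order_pX i).trans MvPowerSeries.le_order_smul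

/-- A partition larger than the degree of `d` does not reach the coefficient of `d`. The others are
grouped by size, and those of length more than `n`, absent from `Part n`, contribute zero. -/
theorem formalHasSum_part {n : ℕ∞} (hn : ENat.card α ≤ n) {H : Series α β}
    (hH : ∀ d, MvPowerSeries.coeff d H = ∑ k ∈ Finset.range (d.degree + 1),
      MvPowerSeries.coeff d (evalAt (pKernel α β) (complete k))) :
    FormalHasSum (fun l : Part n => ∑ m ∈ subdiagrams l.1,
      (b m * evalOne (skewModQ l.1 m)) •
        (evalAt (pX α β) (P l.1) * evalAt (pY α β) (P m))) H := by
  classical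
  let u : YoungDiagram → Series α β := fun l => ∑ m ∈ subdiagrams l,
      (b m * evalOne (skewModQ l m)) • (evalAt (pX α β) (P l) * evalAt (pY α β) (P m))
  have hdeg : ∀ (d : α ⊕ β →₀ ℕ) l, d.degree < l.card → MvPowerSeries.coeff d (u l) = 0 := by
    intro d l h
    rw [map_sum]
    refine Finset.sum_eq_zero fun m _ => ?_
    rw [map_smul, coeff_evalAt_pX_P_mul h, smul_zero]
  refine formalHasSum_of_coeff fun d => ⟨((Finset.range (d.degree + 1)).biUnion diagrams).subtype
    fun l => (len l : ℕ∞) ≤ n, fun S' h' => ?_⟩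
  change MvPowerSeries.coeff d (∑ l ∈ S', u l.1) = _
  rw [map_sum, ← Finset.sum_subset h']
  · rw [Finset.sum_subtype_eq_sum_filter (f := fun l => MvPowerSeries.coeff d (u l)),
      Finset.sum_filter_of_ne, Finset.sum_biUnion, hH]
    · refine Finset.sum_congr rfl fun k _ => ?_
      rw [← map_sum]
      exact congrArg _ (evalAt_complete_eq_sum (pX α β) (pY α β) k).symm
    · intro i _ j _ hij
      refine Finset.disjoint_left.mpr fun l hi hj => hij ?_
      exact (mem_diagrams.mp hi).symm.trans (mem_diagrams.mp hj)
    · intro l _ h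
      by_contra hl
      refine h ?_
      simp only [u, evalAt_pX_P_eq_zero hn hl, zero_mul, smul_zero, Finset.sum_const_zero, map_zero]
  · intro l _ hl
    refine hdeg d l.1 ?_
    by_contra h
    refine hl (Finset.mem_subtype.mpr (Finset.mem_biUnion.mpr ⟨l.1.card, ?_, mem_diagrams.mpr rfl⟩))
    exact Finset.mem_range.mpr (by omega)

end Kernel

end HallLittlewood

end

theorem mainTheorem5 (α β : Type*) (n : ℕ∞) (hn : ENat.card α ≤ n) :
    (∃ F G : Series α β,
      FormalHasProd (fun x : α => inv (1 - letterX x)) F ∧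
      FormalHasProd (fun q : α × β =>
        (1 - t • (letterX q.1 * letterY q.2)) * inv (1 - letterX q.1 * letterY q.2)) G ∧
      FormalHasSum (fun k : ℕ => evalAt (pKernel α β) (complete k)) (F * G) ∧
      FormalHasSum (fun l : Part n => ∑ m ∈ subdiagrams l.1,
        (b m * evalOne (skewModQ l.1 m)) •
          (evalAt (pX α β) (P l.1) * evalAt (pY α β) (P m))) (F * G)) ∧
    ∀ l m : YoungDiagram, m ≤ l → evalOne (skewModQ l m) = aleph l m := by
  refine ⟨?_, fun l m h => by rw [evalOne_skewModQ, if_pos h]⟩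
  -- Modulo `truncIdeal d`, a factor involving a letter outside the support of `d` reduces to `1`;
  -- the same holds for `G`.
  obtain ⟨F, hF, hF'⟩ := exists_formalHasProd
    (fun x : α => (inv (1 - letterX x) : Series α β)) (fun d => d.support.toLeft)
    (fun d e h => Finset.toLeft_subset_toLeft (Finsupp.support_mono h)) fun d x hx => by
      have h0 : red d (letterX x : Series α β) = 0 :=
        red_X_eq_zero fun h => hx (Finset.mem_toLeft.mpr h)
      have h := congrArg (red d) (one_sub_letterX_mul_inv (β := β) x)
      rwa [map_mul, map_sub, map_one, h0, sub_zero, one_mul] at h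
  obtain ⟨G, hG, hG'⟩ := exists_formalHasProd
    (fun q : α × β => ((1 - t • (letterX q.1 * letterY q.2)) *
      inv (1 - letterX q.1 * letterY q.2) : Series α β))
    (fun d => d.support.toLeft ×ˢ d.support.toRight)
    (fun d e h => Finset.product_subset_product (Finset.toLeft_subset_toLeft (Finsupp.support_mono h))
      (Finset.toRight_subset_toRight (Finsupp.support_mono h))) fun d q hq => by
      have h0 : red d (letterX q.1 * letterY q.2 : Series α β) = 0 := by
        rw [Finset.mem_product, not_and_or] at hq
        rw [map_mul]
        rcases hq with hq | hq
        · have h0 : red d (letterX q.1 : Series α β) = 0 :=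
            red_X_eq_zero fun h => hq (Finset.mem_toLeft.mpr h)
          rw [h0, zero_mul]
        · have h0 : red d (letterY q.2 : Series α β) = 0 :=
            red_X_eq_zero fun h => hq (Finset.mem_toRight.mpr h)
          rw [h0, mul_zero]
      have h := congrArg (red d) (one_sub_letterX_mul_letterY_mul_inv q.1 q.2)
      rw [map_mul, map_sub, map_one, h0, sub_zero, one_mul] at h
      rw [map_mul, h, map_sub, map_smul, h0, smul_zero, map_one, sub_zero, mul_one]
  have hH := coeff_prod_eq_sum hF' hG'
  refine ⟨F, G, hF, hG, formalHasSum_of_coeff fun d => ⟨Finset.range (d.degree + 1), ?_⟩,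
    formalHasSum_part hn hH⟩
  intro S' h'
  rw [map_sum, hH]
  refine (Finset.sum_subset h' fun k _ hk => coeff_evalAt_pKernel_complete ?_).symm
  rw [Finset.mem_range] at hk
  omega
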